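/- Let $n\ge1$ be an integer, $\alpha>1/2$, $b>0$, $a\in\mathbb R^n$, and let $g(u)=|u|^bu$ or $g(u)=-|u|^bu$. Consider, for real- or complex-valued $u$, the problem $$u_t+(-\Delta)^\alpha u=(a\cdot\nabla)g(u)\quad (t>0,\ x\in\mathbb R^n),\qquad u(0)=\varphi .\tag{1}$$ Let $S_\alpha(t)=e^{-t(-\Delta)^\alpha}$ be the convolution with the inverse Fourier transform of $e^{-t|\xi|^{2\alpha}}$. A mild solution of (1) on $[0,T)$ is a function $u:[0,T)\to L^r(\mathbb R^n)$ with $u(0)=\varphi$ and, for $0<t<T$, $$u(t)=S_\alpha(t)\varphi+\int_0^tS_\alpha(t-\tau)(a\cdot\nabla)g(u(\tau))\,d\tau ,$$ the integral being a Bochner integral in $L^r(\mathbb R^n)$. Let $r_1=\frac{nb}{2\alpha-1}$ and suppose that $1<r_1\le r$. Let $(q,p,r)$ be a generalized admissible triplet, that is, $\frac1q=\frac n{2\alpha}\left(\frac1r-\frac1p\right)$ and $1<r\le p<\infty$, with moreover $p<\frac{nr}{n-2\alpha r}$ if $n>2\alpha r$. Suppose also that $p>r$ (that is, $q<\infty$)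 and $p\ge b+1$. For $0<T\le\infty$ and $I=[0,T)$, let $C_b(I;L^r)$ be the set of bounded continuous functions from $I$ to $L^r(\mathbb R^n)$, and let $\dot{\mathcal C}_q(I;L^p)$ be the set of continuous functions $u:(0,T)\to L^p(\mathbb R^n)$ with $\sup_{0<t<T}t^{1/q}\|u(t)\|_{L^p}<\infty$ and $\lim_{t\to0^+}t^{1/q}\|u(t)\|_{L^p}=0$. Let $Y(I)=C_b(I;L^r)\cap\dot{\mathcal C}_q(I;L^p)$. (i) For every $\varphi\in L^r(\mathbb R^n)$ there is a $T>0$ such that (1) has a unique mild solution $u\in Y([0,T))$. If $r>r_1$, then $T$ can be chosen to depend on $\varphi$ only through $\|\varphi\|_{L^r}$; more precisely, for every $M$ there is a $T>0$ that serves for all $\varphi$ with $\|\varphi\|_{L^r}\le M$. If $r=r_1$, then $T$ may depend on $\varphi$ itself. (ii) If $r=r_1$, then there is a $\delta>0$ such that for every $\varphi$ with $\|\varphi\|_{L^r}\le\delta$ one can take $T=\infty$ in (i): there is a unique mild solution $u\in C_b([0,\infty);L^r)\cap\dot{\mathcal C}_q([0,\infty);L^p)$. (iii) Let $r>r_1$.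 Every $\varphi\in L^r(\mathbb R^n)$ has a solution with a maximal existence interval $[0,T^*)$, $0<T^*\le\infty$; that is, a function $u$ on $[0,T^*)$ that is a mild solution in $Y([0,T))$ for every $T<T^*$ and that is not the restriction of a mild solution in $Y([0,T))$ for any $T>T^*$. There is a constant $C>0$, independent of $\varphi$, $u$, $T^*$ and $s$, such that for every such $u$ with $T^*<\infty$, $$\|u(s)\|_{L^r}\ge\frac{C}{(T^*-s)^{\frac1b-\frac1{2b\alpha}-\frac n{2r\alpha}}}\qquad(0\le s<T^*).$$ -/

import Mathlib

open MeasureTheory Filter Topology Set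
open scoped ENNReal FourierTransform

noncomputable section

/-- Generalized admissible triplets `(q, p, r)` in dimension `n` for the exponent `α`:
`1/q = n/(2α) (1/r - 1/p)`, `1 < r ≤ p`, with `p < n r / (n - 2 α r)` if `n > 2 α r` and
`p < ∞` otherwise. The value `q = ∞` is allowed (it corresponds to `p = r`). -/
structure IsGeneralizedAdmissible (n : ℕ) (α : ℝ) (q p r : ℝ≥0∞) : Prop where
  one_lt : 1 < r
  le : r ≤ p
  lt_top : p < ∞
  lt_of_dim : 2 * α * r.toReal < n → p.toReal < n * r.toReal / (n - 2 * α * r.toReal)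
  inv_eq : q⁻¹ = ENNReal.ofReal (n / (2 * α) * (1 / r.toReal - 1 / p.toReal))

/-- The interval `[0, T)`, for `T ∈ [0, ∞]`. -/
def timeInterval (T : ℝ≥0∞) : Set ℝ := {t | 0 ≤ t ∧ ENNReal.ofReal t < T}

section Spaces

variable {B : Type*} [NormedAddCommGroup B]

/-- `f ∈ C_b([0, T); B)`. -/
def MemCb (T : ℝ≥0∞) (f : ℝ → B) : Prop :=
  ContinuousOn f (timeInterval T) ∧ ∃ M : ℝ, ∀ t ∈ timeInterval T, ‖f t‖ ≤ M

/-- `f` belongs to the time-weighted space `𝒞_q([0, T); B)`: `f` is continuous for positive times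
and `sup t^{1/q} ‖f(t)‖ < ∞`. The value of `f` at `t = 0` plays no role. -/
def MemCWeighted (q T : ℝ≥0∞) (f : ℝ → B) : Prop :=
  ContinuousOn f (timeInterval T \ {0}) ∧
    ∃ M : ℝ, ∀ t ∈ timeInterval T \ {0}, t ^ q⁻¹.toReal * ‖f t‖ ≤ M

/-- `f` belongs to the homogeneous time-weighted space `𝒞̇_q([0, T); B)`: in addition,
`t^{1/q} ‖f(t)‖ → 0` as `t → 0+`. -/
def MemCWeightedDot (q T : ℝ≥0∞) (f : ℝ → B) : Prop :=
  MemCWeighted q T f ∧ Tendsto (fun t : ℝ => t ^ q⁻¹.toReal * ‖f t‖) (𝓝[>] 0) (𝓝 0)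

end Spaces

section Equation

variable {n : ℕ} {𝕜 : Type*} [RCLike 𝕜]

/-- The kernel of `S_α(t) = exp(-t (-Δ)^α)`, that is, the inverse Fourier transform
`(2π)^{-n} ∫ e^{i x·ξ} e^{-t |ξ|^{2α}} dξ`. Mathlib's inverse Fourier transform has the phase
`e^{2π i x·ξ}` and no prefactor, so `|ξ|` becomes `2π |ξ|`. As the symbol is even, the kernel is
real, and taking the real part only changes the codomain. -/
def fracKernel (α t : ℝ) (x : EuclideanSpace ℝ (Fin n)) : ℝ :=
  (𝓕⁻ (fun ξ : EuclideanSpace ℝ (Fin n) =>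
    ((Real.exp (-t * (2 * Real.pi * ‖ξ‖) ^ (2 * α)) : ℝ) : ℂ)) x).re

/-- `S_α(t) f = K_t * f`, for `t > 0`. -/
def fracSemigroup (α t : ℝ) (f : EuclideanSpace ℝ (Fin n) → 𝕜) :
    EuclideanSpace ℝ (Fin n) → 𝕜 :=
  fun x => ∫ y, fracKernel α t (x - y) • f y

/-- `S_α(t) (a · ∇) f = (a · ∇ K_t) * f`, for `t > 0`. -/
def fracSemigroupDeriv (α t : ℝ) (a : EuclideanSpace ℝ (Fin n))
    (f : EuclideanSpace ℝ (Fin n) → 𝕜) : EuclideanSpace ℝ (Fin n) → 𝕜 :=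
  fun x => ∫ y, (fderiv ℝ (fracKernel α t) (x - y) a) • f y

/-- The nonlinearity `g(z) = σ |z|^b z`, where `σ` is a sign. -/
def powerNonlinearity (σ b : ℝ) (z : 𝕜) : 𝕜 := (σ * ‖z‖ ^ b) • z

/-- `u` is a mild solution on `[0, T)`, with values in `L^r`, of
`u_t + (-Δ)^α u = (a · ∇) g(u)`, `u(0) = φ`: for `0 < t < T`,
`u(t) = S_α(t) φ + ∫_0^t S_α(t - τ) (a · ∇) g(u(τ)) dτ`,
the integral being a (convergent) Bochner integral in `L^r`. Here `F τ` is the class in `L^r` of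
`S_α(t - τ) (a · ∇) g(u(τ))`. -/
def IsMildSolution (α b σ : ℝ) (a : EuclideanSpace ℝ (Fin n)) {r : ℝ≥0∞} [Fact (1 ≤ r)]
    (φ : Lp 𝕜 r (volume : Measure (EuclideanSpace ℝ (Fin n)))) (T : ℝ≥0∞)
    (u : ℝ → Lp 𝕜 r (volume : Measure (EuclideanSpace ℝ (Fin n)))) : Prop :=
  u 0 = φ ∧ ∀ t ∈ timeInterval T, 0 < t →
    ∃ F : ℝ → Lp 𝕜 r (volume : Measure (EuclideanSpace ℝ (Fin n))),
      (∀ τ ∈ Ioo 0 t,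
        F τ =ᵐ[volume] fracSemigroupDeriv α (t - τ) a fun y => powerNonlinearity σ b (u τ y)) ∧
      IntervalIntegrable F volume 0 t ∧
      u t =ᵐ[volume] fun x =>
        fracSemigroup α t φ x + (∫ τ in (0 : ℝ)..t, F τ) x

/-- `u ∈ Y([0, T)) = C_b([0, T); L^r) ∩ 𝒞̇_q([0, T); L^p)`. -/
def MemY (q p : ℝ≥0∞) {r : ℝ≥0∞} [Fact (1 ≤ p)] [Fact (1 ≤ r)] (T : ℝ≥0∞)
    (u : ℝ → Lp 𝕜 r (volume : Measure (EuclideanSpace ℝ (Fin n)))) : Prop :=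
  MemCb T u ∧
    ∃ v : ℝ → Lp 𝕜 p (volume : Measure (EuclideanSpace ℝ (Fin n))),
      MemCWeightedDot q T v ∧ ∀ t ∈ timeInterval T, 0 < t → v t =ᵐ[volume] u t

/-- `u` is a mild solution on `[0, T)` that belongs to `Y([0, T))`. -/
def IsYSolution (α b σ : ℝ) (a : EuclideanSpace ℝ (Fin n)) (q p : ℝ≥0∞) {r : ℝ≥0∞}
    [Fact (1 ≤ p)] [Fact (1 ≤ r)]
    (φ : Lp 𝕜 r (volume : Measure (EuclideanSpace ℝ (Fin n)))) (T : ℝ≥0∞)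
    (u : ℝ → Lp 𝕜 r (volume : Measure (EuclideanSpace ℝ (Fin n)))) : Prop :=
  IsMildSolution α b σ a φ T u ∧ MemY q p T u

/-- There is exactly one mild solution in `Y([0, T))` (functions of time being identified if they
agree on `[0, T)`). -/
def HasUniqueYSolution (α b σ : ℝ) (a : EuclideanSpace ℝ (Fin n)) (q p : ℝ≥0∞) {r : ℝ≥0∞}
    [Fact (1 ≤ p)] [Fact (1 ≤ r)]
    (φ : Lp 𝕜 r (volume : Measure (EuclideanSpace ℝ (Fin n)))) (T : ℝ≥0∞) : Prop :=
  ∃ u : ℝ → Lp 𝕜 r (volume : Measure (EuclideanSpace ℝ (Fin n))),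
    IsYSolution α b σ a q p φ T u ∧
      ∀ v, IsYSolution α b σ a q p φ T v → EqOn v u (timeInterval T)

/-- `[0, Tmax)`, with `0 < Tmax ≤ ∞`, is the maximal existence interval of the solution `u`: `u` is
a solution in `Y([0, T))` for every `T < Tmax`, and no solution in `Y([0, T))` with
`T > Tmax` extends `u`. -/
def IsMaximalYSolution (α b σ : ℝ) (a : EuclideanSpace ℝ (Fin n)) (q p : ℝ≥0∞) {r : ℝ≥0∞}
    [Fact (1 ≤ p)] [Fact (1 ≤ r)]
    (φ : Lp 𝕜 r (volume : Measure (EuclideanSpace ℝ (Fin n)))) (Tmax : ℝ≥0∞)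
    (u : ℝ → Lp 𝕜 r (volume : Measure (EuclideanSpace ℝ (Fin n)))) : Prop :=
  0 < Tmax ∧ (∀ T, 0 < T → T < Tmax → IsYSolution α b σ a q p φ T u) ∧
    ∀ T v, Tmax < T → IsYSolution α b σ a q p φ T v → ¬ EqOn v u (timeInterval Tmax)

end Equation

end

set_option linter.unusedSectionVars false

noncomputable section

/-! ### Duhamel integrals with algebraic singularities at both ends -/

section Duhamel

/-! The mild equation is a fixed-point problem `u = S φ + J u`. It is solved with two norms at once:
in `L^r` the solution is only bounded, while in `L^p` it may be singular like `t^{-1/q}`, with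
`t^{1/q} ‖u‖_p → 0`. Interpolation between the two bounds puts `|u|^b u` in some `L^s` with norm
`O(τ^{-β})`, and `S(t-τ)(a·∇)` maps `L^s` to `L^r` or `L^p` with norm `O((t-τ)^{-γ})`. For `β, γ <
1` the Duhamel integral is bounded by Euler's beta integral. It has size `t^ω` in `L^r` and
`t^{ω-1/q}` in `L^p`, where `ω = (2α-1-nb/r)/(2α)`; thus `ω > 0` for `r > r₁` and `ω = 0` for `r =
r₁`.

All claims follow from one contraction on the set `‖u‖_r ≤ 2R`, `t^{1/q} ‖u‖_p ≤ 2ε`. With `R = ε`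
proportional to `‖φ‖` it requires `‖φ‖^b T^ω` to be small: for `ω > 0` this gives a time that
depends on `‖φ‖` only, for `ω = 0` global solutions for small data (`exists_solves_of_small`). With
`R` fixed and `ε` small, which is possible since `t^{1/q} ‖S(t) φ‖_p → 0`, it gives local solutions
for all data, also when `ω = 0` (`exists_solves`). Uniqueness in the whole class holds because two
solutions both have small weighted norm near `0`, hence agree there, and the agreement then
propagates in steps of fixed length (`IsSolution.unique`). For the lower bound, if `‖u(s)‖
(T*-s)^{ω/b}` were below the existence threshold, the solution restarted at `s` would live beyond
`T*` and could be glued to `u` (`IsSolution.glue`, `lower_bound_of_maximal`).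

This argument is carried out for an abstract `MildSystem`. Its hypotheses are checked in
`exists_realizes`. Different auxiliary exponents `s` are used for the estimates in `L^r` and in
`L^p` (`exists_auxiliary_exponents`); this is what covers the full range of `p`. The linear
estimates follow from Young's inequality and from `L¹` and sup bounds on the kernels of `S(t)` and
`(a·∇)S(t)`, which reduce to `t = 1` by scaling. Since `e^{-|ξ|^{2α}}` need not be smooth at `0`,
integrability of its inverse Fourier transform is proved by a dyadic decomposition
(`integrable_fourierInv_of_dyadic`). -/

theorem intervalIntegrable_sub_rpow_mul_rpow {γ β t : ℝ} (hγ : γ < 1) (hβ : β < 1) (ht : 0 < t) :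
    IntervalIntegrable (fun τ : ℝ => (t - τ) ^ (-γ) * τ ^ (-β)) volume 0 t := by
  have h2 : 0 < t / 2 := by positivity
  -- On the left half only the singularity at `0` is present. The reflection `τ ↦ t - τ` exchanges
  -- the two exponents and yields the right half.
  have key : ∀ {γ β : ℝ}, β < 1 →
      IntervalIntegrable (fun τ : ℝ => (t - τ) ^ (-γ) * τ ^ (-β)) volume 0 (t / 2) := by
    intro γ β hβ
    refine IntervalIntegrable.continuousOn_mul
      (intervalIntegral.intervalIntegrable_rpow' (by linarith)) ?_
    rw [uIcc_of_le h2.le]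
    refine ContinuousOn.rpow_const (by fun_prop) fun x hx => Or.inl ?_
    have := hx.2
    linarith
  refine (key hβ).trans ?_
  have h := ((key (γ := β) (β := γ) hγ).comp_sub_left t).symm
  have h3 : t - t / 2 = t / 2 := by ring
  simp only [sub_sub_cancel, sub_zero, h3] at h
  exact h.congr fun x _ => mul_comm _ _

/-- Euler's beta integral `∫_0^1 (1-σ)^{-γ} σ^{-β} dσ`. -/
def betaConst (γ β : ℝ) : ℝ := ∫ σ in (0 : ℝ)..1, (1 - σ) ^ (-γ) * σ ^ (-β)

theorem betaConst_nonneg (γ β : ℝ) : 0 ≤ betaConst γ β :=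
  intervalIntegral.integral_nonneg zero_le_one fun σ hσ =>
    mul_nonneg (Real.rpow_nonneg (by linarith [hσ.2]) _) (Real.rpow_nonneg hσ.1 _)

theorem integral_sub_rpow_mul_rpow (γ β : ℝ) {t : ℝ} (ht : 0 < t) :
    ∫ τ in (0 : ℝ)..t, (t - τ) ^ (-γ) * τ ^ (-β) = betaConst γ β * t ^ (1 - γ - β) := by
  have h := intervalIntegral.mul_integral_comp_mul_left (a := 0) (b := 1)
    (f := fun τ : ℝ => (t - τ) ^ (-γ) * τ ^ (-β)) t
  simp only [mul_zero, mul_one] at h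
  rw [← h, betaConst]
  have h1 : ∫ σ in (0 : ℝ)..1, (t - t * σ) ^ (-γ) * (t * σ) ^ (-β)
      = ∫ σ in (0 : ℝ)..1, t ^ (-γ - β) * ((1 - σ) ^ (-γ) * σ ^ (-β)) := by
    refine intervalIntegral.integral_congr fun σ hσ => ?_
    rw [uIcc_of_le zero_le_one] at hσ
    have e : t - t * σ = t * (1 - σ) := by ring
    rw [e, Real.mul_rpow ht.le (by linarith [hσ.2]), Real.mul_rpow ht.le hσ.1, sub_eq_add_neg (-γ),
      Real.rpow_add ht]
    ring
  rw [h1, intervalIntegral.integral_const_mul]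
  have h2 : t ^ (1 - γ - β) = t * t ^ (-γ - β) := by
    conv_rhs => rw [← Real.rpow_one t, mul_comm, Real.rpow_one, ← Real.rpow_add_one ht.ne']
    congr 1; ring
  rw [h2]; ring

variable {E F : Type*} [NormedAddCommGroup E] [NormedSpace ℝ E] [NormedAddCommGroup F]
  [NormedSpace ℝ F]

/-- A strongly continuous family of operators with an algebraic singularity at `t = 0`. -/
structure IsSmoothing (D : ℝ → F →L[ℝ] E) (C γ : ℝ) : Prop where
  nonneg : 0 ≤ C
  continuousOn : ∀ f, ContinuousOn (fun t => D t f) (Ioi 0)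
  norm_le : ∀ t, 0 < t → ∀ f, ‖D t f‖ ≤ C * t ^ (-γ) * ‖f‖

/-- Strong continuity becomes joint continuity because the operator norms are locally bounded on `t
> 0`: split `D(s) g = D(s) f + D(s) (g - f)`. -/
theorem IsSmoothing.tendsto {D : ℝ → F →L[ℝ] E} {C γ : ℝ} (hD : IsSmoothing D C γ) {ι : Type*}
    {l : Filter ι} {s : ι → ℝ} {g : ι → F} {t : ℝ} {f : F} (ht : 0 < t) (hs : Tendsto s l (𝓝 t))
    (hg : Tendsto g l (𝓝 f)) : Tendsto (fun i => D (s i) (g i)) l (𝓝 (D t f)) := by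
  have h1 : Tendsto (fun i => D (s i) f) l (𝓝 (D t f)) :=
    ((hD.continuousOn f).continuousAt (Ioi_mem_nhds ht)).tendsto.comp hs
  have h2 : Tendsto (fun i => D (s i) (g i - f)) l (𝓝 0) := by
    have hb : Tendsto (fun i => C * (s i) ^ (-γ) * ‖g i - f‖) l (𝓝 (C * t ^ (-γ) * ‖f - f‖)) :=
      (((hs.rpow_const (Or.inl ht.ne')).const_mul C).mul (hg.sub_const f).norm)
    rw [sub_self, norm_zero, mul_zero] at hb
    refine squeeze_zero_norm' ?_ hb
    filter_upwards [hs.eventually (Ioi_mem_nhds ht)] with i hi using hD.norm_le _ hi _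
  simpa using h1.add h2

/-- The Duhamel integral `∫_0^t D(t-τ) G(τ) dτ`. -/
def duhamel (D : ℝ → F →L[ℝ] E) (G : ℝ → F) (t : ℝ) : E := ∫ τ in (0 : ℝ)..t, D (t - τ) (G τ)

variable {D : ℝ → F →L[ℝ] E} {C γ β H : ℝ} {G : ℝ → F} {t : ℝ}

theorem IsSmoothing.continuousOn_integrand (hD : IsSmoothing D C γ)
    (hG : ContinuousOn G (Ioo 0 t)) : ContinuousOn (fun τ => D (t - τ) (G τ)) (Ioo 0 t) := by
  intro τ hτ
  refine hD.tendsto (sub_pos.2 hτ.2) ?_ (hG τ hτ)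
  exact (tendsto_const_nhds.sub tendsto_id).mono_left inf_le_left

theorem IsSmoothing.norm_integrand_le (hD : IsSmoothing D C γ)
    (hH : ∀ τ ∈ Ioo 0 t, ‖G τ‖ ≤ H * τ ^ (-β)) {τ : ℝ} (hτ : τ ∈ Ioo 0 t) :
    ‖D (t - τ) (G τ)‖ ≤ C * H * ((t - τ) ^ (-γ) * τ ^ (-β)) := by
  have h0 : 0 ≤ (t - τ) ^ (-γ) := Real.rpow_nonneg (sub_nonneg.2 hτ.2.le) _
  calc _ ≤ C * (t - τ) ^ (-γ) * ‖G τ‖ := hD.norm_le _ (sub_pos.2 hτ.2) _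
    _ ≤ C * (t - τ) ^ (-γ) * (H * τ ^ (-β)) :=
      mul_le_mul_of_nonneg_left (hH τ hτ) (mul_nonneg hD.nonneg h0)
    _ = _ := by ring

theorem IsSmoothing.intervalIntegrable (hD : IsSmoothing D C γ) (hγ : γ < 1) (hβ : β < 1)
    (ht : 0 < t) (hG : ContinuousOn G (Ioo 0 t)) (hH : ∀ τ ∈ Ioo 0 t, ‖G τ‖ ≤ H * τ ^ (-β)) :
    IntervalIntegrable (fun τ => D (t - τ) (G τ)) volume 0 t := by
  have hb := (intervalIntegrable_sub_rpow_mul_rpow hγ hβ ht).const_mul (C * H)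
  rw [intervalIntegrable_iff_integrableOn_Ioo_of_le ht.le] at hb ⊢
  refine Integrable.mono' hb ((hD.continuousOn_integrand hG).aestronglyMeasurable
    measurableSet_Ioo) ?_
  filter_upwards [ae_restrict_mem measurableSet_Ioo] with τ hτ using hD.norm_integrand_le hH hτ

theorem IsSmoothing.norm_duhamel_le (hD : IsSmoothing D C γ) (hγ : γ < 1) (hβ : β < 1)
    (ht : 0 < t) (hH : ∀ τ ∈ Ioo 0 t, ‖G τ‖ ≤ H * τ ^ (-β)) :
    ‖duhamel D G t‖ ≤ C * H * betaConst γ β * t ^ (1 - γ - β) := by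
  rw [mul_assoc (C * H), ← integral_sub_rpow_mul_rpow γ β ht,
    ← intervalIntegral.integral_const_mul]
  refine intervalIntegral.norm_integral_le_of_norm_le ht.le ?_
    ((intervalIntegrable_sub_rpow_mul_rpow hγ hβ ht).const_mul _)
  have hne : ∀ᵐ τ : ℝ, τ ≠ t := by simp [ae_iff, measure_singleton]
  filter_upwards [hne] with τ hne hτ
  exact hD.norm_integrand_le hH ⟨hτ.1, lt_of_le_of_ne hτ.2 hne⟩

/-- Used for continuation from time `s`: the bound carries a positive power of `t - s`, so it is
small for short steps whatever the size of `H`. -/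
theorem IsSmoothing.norm_duhamel_le_of_eq_zero (hD : IsSmoothing D C γ) (hγ : γ < 1) {s : ℝ}
    (hs : 0 ≤ s) (hst : s < t) (h0 : ∀ τ ∈ Ioc 0 s, G τ = 0) (hH : ∀ τ ∈ Ioo s t, ‖G τ‖ ≤ H) :
    ‖duhamel D G t‖ ≤ C * H * ((t - s) ^ (1 - γ) / (1 - γ)) := by
  have e : duhamel D G t = ∫ τ in s..t, D (t - τ) (G τ) := by
    rw [duhamel, intervalIntegral.integral_of_le (hs.trans hst.le),
      intervalIntegral.integral_of_le hst.le]
    refine (setIntegral_eq_of_subset_of_forall_sdiff_eq_zero measurableSet_Ioc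
      (Ioc_subset_Ioc_left hs) fun τ hτ => ?_)
    have : τ ∈ Ioc 0 s := ⟨hτ.1.1, not_lt.1 fun h => hτ.2 ⟨h, hτ.1.2⟩⟩
    rw [h0 τ this, map_zero]
  have hi : IntervalIntegrable (fun τ : ℝ => (t - τ) ^ (-γ)) volume s t := by
    have := (intervalIntegral.intervalIntegrable_rpow' (a := t - s) (b := 0) (r := -γ)
      (by linarith)).comp_sub_left t
    simpa using this
  have hv : ∫ τ in s..t, (t - τ) ^ (-γ) = (t - s) ^ (1 - γ) / (1 - γ) := by
    rw [intervalIntegral.integral_comp_sub_left (fun x : ℝ => x ^ (-γ)) t, sub_self,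
      integral_rpow (Or.inl (by linarith)), Real.zero_rpow (by linarith), sub_zero]
    rw [show -γ + 1 = 1 - γ by ring]
  rw [e, ← hv, ← intervalIntegral.integral_const_mul]
  refine intervalIntegral.norm_integral_le_of_norm_le hst.le ?_ (hi.const_mul _)
  have hne : ∀ᵐ τ : ℝ, τ ≠ t := by simp [ae_iff, measure_singleton]
  filter_upwards [hne] with τ hne hτ
  have h2 : 0 < t - τ := sub_pos.2 (lt_of_le_of_ne hτ.2 hne)
  calc _ ≤ C * (t - τ) ^ (-γ) * ‖G τ‖ := hD.norm_le _ h2 _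
    _ ≤ C * (t - τ) ^ (-γ) * H :=
      mul_le_mul_of_nonneg_left (hH τ ⟨hτ.1, lt_of_le_of_ne hτ.2 hne⟩)
        (mul_nonneg hD.nonneg (Real.rpow_nonneg h2.le _))
    _ = _ := by ring

/-- The substitution `τ = t σ` fixes the interval of integration; dominated convergence then applies
with a multiple of the beta integrand as majorant. -/
theorem IsSmoothing.continuousOn_duhamel (hD : IsSmoothing D C γ) (hγ : γ < 1) (hβ : β < 1)
    {I : Set ℝ} (hI : IsOpen I) (hI0 : ∀ t ∈ I, 0 < t) (hIt : ∀ t ∈ I, Ioc 0 t ⊆ I)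
    (hG : ContinuousOn G I) (hH : ∀ τ ∈ I, ‖G τ‖ ≤ H * τ ^ (-β)) :
    ContinuousOn (duhamel D G) I := by
  intro t₀ ht₀
  refine ContinuousAt.continuousWithinAt ?_
  have hpos := hI0 t₀ ht₀
  have e : duhamel D G = fun t => t • ∫ σ in (0 : ℝ)..1, D (t - t * σ) (G (t * σ)) := by
    funext t
    have := intervalIntegral.smul_integral_comp_mul_left (a := 0) (b := 1)
      (fun τ => D (t - τ) (G τ)) t
    rw [duhamel, this, mul_zero, mul_one]
  rw [e]
  refine continuousAt_id.smul ?_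
  have hloc : ∀ᶠ t in 𝓝 t₀, t ∈ I ∧ C * H * t ^ (-γ - β) < C * H * t₀ ^ (-γ - β) + 1 := by
    refine Filter.Eventually.and (hI.mem_nhds ht₀) ?_
    have : ContinuousAt (fun t : ℝ => C * H * t ^ (-γ - β)) t₀ :=
      (continuousAt_id.rpow_const (Or.inl hpos.ne')).const_mul _
    exact this.eventually (gt_mem_nhds (by simp))
  have hmem : ∀ t ∈ I, ∀ σ ∈ Ioo (0 : ℝ) 1, t * σ ∈ I ∧ t * σ ∈ Ioo 0 t := by
    intro t ht σ hσ
    have h0 := hI0 t ht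
    have h1 : t * σ ∈ Ioo 0 t := ⟨mul_pos h0 hσ.1, mul_lt_of_lt_one_right h0 hσ.2⟩
    exact ⟨hIt t ht ⟨h1.1, h1.2.le⟩, h1⟩
  have hne : ∀ᵐ σ : ℝ, σ ≠ 1 := by simp [ae_iff, measure_singleton]
  refine intervalIntegral.continuousAt_of_dominated_interval (bound := fun σ =>
    (C * H * t₀ ^ (-γ - β) + 1) * ((1 - σ) ^ (-γ) * σ ^ (-β))) ?_ ?_
    ((intervalIntegrable_sub_rpow_mul_rpow hγ hβ one_pos).const_mul _) ?_
  · filter_upwards [hloc] with t ht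
    rw [uIoc_of_le zero_le_one, ← restrict_Ioo_eq_restrict_Ioc]
    refine ContinuousOn.aestronglyMeasurable ?_ measurableSet_Ioo
    have h1 : ContinuousOn (fun τ => D (t - τ) (G τ)) (Ioo 0 t) :=
      hD.continuousOn_integrand (hG.mono fun x hx => hIt t ht.1 ⟨hx.1, hx.2.le⟩)
    exact h1.comp (f := fun σ => t * σ) (by fun_prop) fun σ hσ => (hmem t ht.1 σ hσ).2
  · filter_upwards [hloc] with t ht
    filter_upwards [hne] with σ hne hσ
    rw [uIoc_of_le zero_le_one] at hσ
    have hσ' : σ ∈ Ioo (0 : ℝ) 1 := ⟨hσ.1, lt_of_le_of_ne hσ.2 hne⟩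
    have h0 := hI0 t ht.1
    refine (hD.norm_integrand_le (H := H) (β := β)
      (fun τ hτ => hH τ (hIt t ht.1 ⟨hτ.1, hτ.2.le⟩)) (hmem t ht.1 σ hσ').2).trans ?_
    have e : t - t * σ = t * (1 - σ) := by ring
    rw [e, Real.mul_rpow h0.le (by linarith [hσ.2]), Real.mul_rpow h0.le hσ.1.le]
    have hr : 0 ≤ (1 - σ) ^ (-γ) * σ ^ (-β) :=
      mul_nonneg (Real.rpow_nonneg (by linarith [hσ.2]) _) (Real.rpow_nonneg hσ.1.le _)
    have := mul_le_mul_of_nonneg_right ht.2.le hr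
    rw [sub_eq_add_neg (-γ), Real.rpow_add h0, ← sub_eq_add_neg] at this
    linarith
  · filter_upwards [hne] with σ hne hσ
    rw [uIoc_of_le zero_le_one] at hσ
    have hσ' : σ ∈ Ioo (0 : ℝ) 1 := ⟨hσ.1, lt_of_le_of_ne hσ.2 hne⟩
    have h1 := hmem t₀ ht₀ σ hσ'
    refine hD.tendsto (sub_pos.2 h1.2.2) (Continuous.tendsto (by fun_prop) t₀) ?_
    have h2 : ContinuousAt G (t₀ * σ) := hG.continuousAt (hI.mem_nhds h1.1)
    exact h2.tendsto.comp (Continuous.tendsto (f := fun t => t * σ) (by fun_prop) t₀)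

/-- The case `ω = 0` is the delicate one: no power of `t` is left over, and the limit `0` comes
entirely from the assumption that `τ^β ‖G τ‖` tends to `0`. -/
theorem IsSmoothing.tendsto_duhamel (hD : IsSmoothing D C γ) (hγ : γ < 1) (hβ : β < 1)
    {ω : ℝ} (hω : 0 ≤ ω) (hG : Tendsto (fun τ => τ ^ β * ‖G τ‖) (𝓝[>] 0) (𝓝 0)) :
    Tendsto (fun t => t ^ (ω + γ + β - 1) * ‖duhamel D G t‖) (𝓝[>] 0) (𝓝 0) := by
  rw [Metric.tendsto_nhdsWithin_nhds]
  intro ε hε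
  have hK : 0 ≤ C * betaConst γ β := mul_nonneg hD.nonneg (betaConst_nonneg _ _)
  set η := ε / (C * betaConst γ β + 1) with hη
  have hη0 : 0 < η := by positivity
  obtain ⟨δ, hδ, h⟩ := Metric.tendsto_nhdsWithin_nhds.1 hG η hη0
  refine ⟨min δ 1, lt_min hδ one_pos, fun t ht htd => ?_⟩
  have ht0 : 0 < t := ht
  rw [dist_zero_right, Real.norm_of_nonneg ht0.le] at htd
  have hb : ∀ τ ∈ Ioo 0 t, ‖G τ‖ ≤ η * τ ^ (-β) := by
    intro τ hτ
    have h1 := h (x := τ) hτ.1 (by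
      rw [dist_zero_right, Real.norm_of_nonneg hτ.1.le]
      exact (hτ.2.trans htd).trans_le (min_le_left _ _))
    have h3 : 0 < τ ^ β := Real.rpow_pos_of_pos hτ.1 _
    rw [dist_zero_right, Real.norm_of_nonneg (by positivity)] at h1
    rw [Real.rpow_neg hτ.1.le, ← div_eq_mul_inv, le_div_iff₀ h3]
    linarith
  have h1 := hD.norm_duhamel_le hγ hβ ht0 hb
  rw [dist_zero_right, Real.norm_of_nonneg (by positivity)]
  have h2 : t ^ (ω + γ + β - 1) * ‖duhamel D G t‖
      ≤ t ^ (ω + γ + β - 1) * (C * η * betaConst γ β * t ^ (1 - γ - β)) :=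
    mul_le_mul_of_nonneg_left h1 (by positivity)
  have h3 : t ^ (ω + γ + β - 1) * (C * η * betaConst γ β * t ^ (1 - γ - β))
      = C * betaConst γ β * η * t ^ ω := by
    have : t ^ ω = t ^ (ω + γ + β - 1) * t ^ (1 - γ - β) := by
      rw [← Real.rpow_add ht0]; congr 1; ring
    rw [this]; ring
  have h4 : t ^ ω ≤ 1 := Real.rpow_le_one ht0.le (htd.le.trans (min_le_right _ _)) hω
  have h5 : C * betaConst γ β * η < ε := by
    rw [hη, mul_div_assoc', div_lt_iff₀ (by positivity)]; nlinarith
  calc _ ≤ C * betaConst γ β * η * t ^ ω := h2.trans h3.le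
    _ ≤ C * betaConst γ β * η * 1 := mul_le_mul_of_nonneg_left h4 (by positivity)
    _ < ε := by linarith

end Duhamel

/-! ### The half-open time interval -/

section TimeInterval

theorem timeInterval_sdiff_pos {T : ℝ≥0∞} {t : ℝ} (ht : t ∈ timeInterval T \ {0}) : 0 < t :=
  lt_of_le_of_ne ht.1.1 (Ne.symm ht.2)

theorem timeInterval_Icc_subset {T : ℝ≥0∞} {t : ℝ} (ht : t ∈ timeInterval T) :
    Icc 0 t ⊆ timeInterval T :=
  fun _ hs => ⟨hs.1, (ENNReal.ofReal_le_ofReal hs.2).trans_lt ht.2⟩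

theorem timeInterval_mono {T T' : ℝ≥0∞} (h : T ≤ T') : timeInterval T ⊆ timeInterval T' :=
  fun _ ht => ⟨ht.1, ht.2.trans_le h⟩

theorem timeInterval_sdiff_Ioc_subset {T : ℝ≥0∞} {t : ℝ} (ht : t ∈ timeInterval T \ {0}) :
    Ioc 0 t ⊆ timeInterval T \ {0} :=
  fun _ hs => ⟨timeInterval_Icc_subset ht.1 ⟨hs.1.le, hs.2⟩, hs.1.ne'⟩

theorem isOpen_timeInterval_sdiff (T : ℝ≥0∞) : IsOpen (timeInterval T \ {0}) := by
  have : timeInterval T \ {0} = Ioi 0 ∩ ENNReal.ofReal ⁻¹' (Iio T) := by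
    ext t
    refine ⟨fun h => ⟨timeInterval_sdiff_pos h, h.1.2⟩, fun h => ⟨⟨?_, h.2⟩, ?_⟩⟩
    · exact le_of_lt h.1
    · exact ne_of_gt h.1
  rw [this]
  exact isOpen_Ioi.inter (isOpen_Iio.preimage ENNReal.continuous_ofReal)

theorem zero_mem_timeInterval {T : ℝ≥0∞} (hT : 0 < T) : (0 : ℝ) ∈ timeInterval T :=
  ⟨le_rfl, by simpa using hT⟩

theorem exists_Ioo_subset_timeInterval {T : ℝ≥0∞} (hT : 0 < T) :
    ∃ δ : ℝ, 0 < δ ∧ Ico 0 δ ⊆ timeInterval T := by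
  obtain ⟨δ, h0, h1⟩ := ENNReal.lt_iff_exists_real_btwn.1 hT
  refine ⟨δ, by simpa using h1.1, fun t ht => ⟨ht.1, ?_⟩⟩
  exact (ENNReal.ofReal_le_ofReal ht.2.le).trans_lt h1.2

theorem nhdsWithin_timeInterval_le {T : ℝ≥0∞} (hT : 0 < T) :
    𝓝[>] (0 : ℝ) ≤ 𝓝[timeInterval T \ {0}] 0 := by
  obtain ⟨δ, hδ, h⟩ := exists_Ioo_subset_timeInterval hT
  refine nhdsWithin_le_of_mem ?_
  filter_upwards [Ioo_mem_nhdsGT hδ] with t ht using ⟨h ⟨ht.1.le, ht.2⟩, ht.1.ne'⟩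

/-- Without `0` the interval is open, which makes continuity there a matter of full neighbourhoods;
the endpoint contributes a single one-sided limit. -/
theorem continuousOn_timeInterval_iff {B : Type*} [TopologicalSpace B] {T : ℝ≥0∞} (hT : 0 < T)
    {f : ℝ → B} : ContinuousOn f (timeInterval T) ↔
      ContinuousOn f (timeInterval T \ {0}) ∧ Tendsto f (𝓝[>] 0) (𝓝 (f 0)) := by
  constructor
  · intro h
    refine ⟨h.mono sdiff_subset, (h 0 (zero_mem_timeInterval hT)).tendsto.mono_left
      ((nhdsWithin_timeInterval_le hT).trans (nhdsWithin_mono _ sdiff_subset))⟩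
  · rintro ⟨h1, h2⟩ t ht
    by_cases h0 : t = 0
    · subst h0
      have h3 : ContinuousWithinAt f (Ici 0) 0 := by
        rw [← Ioi_insert, continuousWithinAt_insert_self]
        exact h2
      exact h3.mono fun x hx => hx.1
    · exact (h1.continuousAt ((isOpen_timeInterval_sdiff T).mem_nhds ⟨ht, h0⟩)).continuousWithinAt

end TimeInterval

/-! ### Bochner integrals in closed subspaces -/

section Integrals

/-- Apply the continuous projection onto the quotient by `W`, which is normed because `W` is closed;
it commutes with the integral and kills the integrand. -/
theorem Submodule.integral_mem_of_isClosed {E : Type*} [NormedAddCommGroup E] [NormedSpace ℝ E]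
    [CompleteSpace E] {α : Type*} [MeasurableSpace α] {μ : Measure α} (W : Submodule ℝ E)
    (hW : IsClosed (W : Set E)) {f : α → E} (hf : Integrable f μ) (h : ∀ᵐ x ∂μ, f x ∈ W) :
    ∫ x, f x ∂μ ∈ W := by
  have : IsClosed (W : Set E) := hW
  rw [← Submodule.Quotient.mk_eq_zero, ← Submodule.mkQ_apply, ← Submodule.mkQL_apply]
  rw [← ContinuousLinearMap.integral_comp_comm _ hf]
  refine integral_eq_zero_of_ae ?_
  filter_upwards [h] with x hx
  simpa using hx

end Integrals

/-! ### Interpolated norms and nonlinearities of order `b + 1` -/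

section MixedNorm

variable {X P F : Type*} [NormedAddCommGroup X] [NormedAddCommGroup P] [NormedAddCommGroup F]

/-- The interpolation quantity `‖x‖^{1-θ} ‖y‖^θ`. -/
def mixNorm (θ : ℝ) (w : X × P) : ℝ := ‖w.1‖ ^ (1 - θ) * ‖w.2‖ ^ θ

theorem mixNorm_nonneg (θ : ℝ) (w : X × P) : 0 ≤ mixNorm θ w := by
  unfold mixNorm; positivity

theorem mixNorm_zero {θ : ℝ} (hθ : 0 < θ) : mixNorm θ (0 : X × P) = 0 := by
  simp [mixNorm, Real.zero_rpow hθ.ne']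

theorem continuous_mixNorm {θ : ℝ} (hθ : 0 < θ) (hθ1 : θ ≤ 1) :
    Continuous (mixNorm θ : X × P → ℝ) := by
  refine Continuous.mul ?_ ?_
  · exact continuous_fst.norm.rpow_const fun _ => Or.inr (by linarith)
  · exact continuous_snd.norm.rpow_const fun _ => Or.inr hθ.le

theorem mixNorm_le {θ μ τ a c : ℝ} (hθ : 0 ≤ θ) (hθ1 : θ ≤ 1) (hτ : 0 < τ) {w : X × P}
    (h1 : ‖w.1‖ ≤ a) (h2 : τ ^ μ * ‖w.2‖ ≤ c) :
    mixNorm θ w ≤ a ^ (1 - θ) * c ^ θ * τ ^ (-(μ * θ)) := by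
  have hp : 0 < τ ^ μ := Real.rpow_pos_of_pos hτ _
  have h3 : ‖w.2‖ = (τ ^ μ * ‖w.2‖) * τ ^ (-μ) := by
    rw [Real.rpow_neg hτ.le]; field_simp
  have h4 : 0 ≤ τ ^ μ * ‖w.2‖ := by positivity
  have h5 : 0 ≤ a := (norm_nonneg _).trans h1
  rw [mixNorm, mul_assoc]
  refine mul_le_mul (Real.rpow_le_rpow (norm_nonneg _) h1 (by linarith)) ?_ (by positivity)
    (by positivity)
  rw [h3, Real.mul_rpow h4 (by positivity), ← Real.rpow_mul hτ.le, neg_mul]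
  gcongr

theorem mixNorm_le_mul {θ μ τ d R ε : ℝ} (hθ : 0 ≤ θ) (hθ1 : θ ≤ 1) (hτ : 0 < τ) {w : X × P}
    (hd : 0 ≤ d) (hR : 0 ≤ R) (hε : 0 ≤ ε) (h1 : ‖w.1‖ ≤ d * R) (h2 : τ ^ μ * ‖w.2‖ ≤ d * ε) :
    mixNorm θ w ≤ d * (R ^ (1 - θ) * ε ^ θ) * τ ^ (-(μ * θ)) := by
  refine (mixNorm_le hθ hθ1 hτ h1 h2).trans (le_of_eq ?_)
  rw [Real.mul_rpow hd hR, Real.mul_rpow hd hε]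
  have : d ^ (1 - θ) * d ^ θ = d := by
    rw [← Real.rpow_add_of_nonneg hd (by linarith) hθ]; simp
  calc _ = (d ^ (1 - θ) * d ^ θ) * (R ^ (1 - θ) * ε ^ θ) * τ ^ (-(μ * θ)) := by ring
    _ = _ := by rw [this]

variable [NormedSpace ℝ X] [NormedSpace ℝ P]

/-- A nonlinearity of order `b + 1` on the pairs in `W`, measured by `mixNorm θ`. -/
structure IsPowerLike (W : Submodule ℝ (X × P)) (N : X × P → F) (b θ c : ℝ) : Prop where
  b_pos : 0 < b
  θ_pos : 0 < θ
  θ_le : θ ≤ 1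
  nonneg : 0 ≤ c
  map_zero : N 0 = 0
  norm_sub_le : ∀ w ∈ W, ∀ w' ∈ W,
    ‖N w - N w'‖ ≤ c * (mixNorm θ w + mixNorm θ w') ^ b * mixNorm θ (w - w')

variable {W : Submodule ℝ (X × P)} {N : X × P → F} {b θ c : ℝ}

theorem IsPowerLike.continuousOn (hN : IsPowerLike W N b θ c) : ContinuousOn N W := by
  intro w hw
  have hc := continuous_mixNorm (X := X) (P := P) hN.θ_pos hN.θ_le
  have h1 : Tendsto (fun w' => c * (mixNorm θ w' + mixNorm θ w) ^ b * mixNorm θ (w' - w))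
      (𝓝[W] w) (𝓝 (c * (mixNorm θ w + mixNorm θ w) ^ b * mixNorm θ (w - w))) := by
    refine Tendsto.mono_left (Continuous.tendsto ?_ w) nhdsWithin_le_nhds
    refine Continuous.mul (continuous_const.mul ?_) (hc.comp (by fun_prop))
    exact (hc.add continuous_const).rpow_const fun _ => Or.inr hN.b_pos.le
  rw [sub_self, mixNorm_zero hN.θ_pos, mul_zero] at h1
  rw [ContinuousWithinAt, tendsto_iff_norm_sub_tendsto_zero]
  refine squeeze_zero' (Eventually.of_forall fun _ => norm_nonneg _) ?_ h1
  filter_upwards [self_mem_nhdsWithin] with w' hw' using hN.norm_sub_le w' hw' w hw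

/-- Here `d` is a relative distance, measured in units of `R` in `X` and of `ε` in the weighted norm
of `P`. Since `mixNorm` is homogeneous of degree one, the bound is linear in `d`, so that one number
governs the contraction in both spaces. -/
theorem IsPowerLike.norm_sub_le_mul (hN : IsPowerLike W N b θ c) {μ τ d R ε : ℝ} (hτ : 0 < τ)
    {w w' : X × P} (hw : w ∈ W) (hw' : w' ∈ W) (hd : 0 ≤ d) (hR : 0 ≤ R) (hε : 0 ≤ ε)
    (h1 : ‖w.1‖ ≤ 2 * R) (h2 : τ ^ μ * ‖w.2‖ ≤ 2 * ε) (h1' : ‖w'.1‖ ≤ 2 * R)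
    (h2' : τ ^ μ * ‖w'.2‖ ≤ 2 * ε) (h3 : ‖w.1 - w'.1‖ ≤ d * R)
    (h4 : τ ^ μ * ‖w.2 - w'.2‖ ≤ d * ε) :
    ‖N w - N w'‖ ≤ c * 4 ^ b * (R ^ (1 - θ) * ε ^ θ) ^ (b + 1) * d * τ ^ (-(μ * θ * (b + 1))) := by
  set Q := R ^ (1 - θ) * ε ^ θ with hQ
  set ρ := τ ^ (-(μ * θ)) with hρ
  have hQ0 : 0 ≤ Q := by positivity
  have hρ0 : 0 < ρ := by positivity
  have a1 := mixNorm_le_mul hN.θ_pos.le hN.θ_le hτ zero_le_two hR hε h1 h2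
  have a2 := mixNorm_le_mul hN.θ_pos.le hN.θ_le hτ zero_le_two hR hε h1' h2'
  have a3 := mixNorm_le_mul (w := w - w') hN.θ_pos.le hN.θ_le hτ hd hR hε h3 h4
  have hb := hN.b_pos
  have hc := hN.nonneg
  have m1 := mixNorm_nonneg θ w
  have m2 := mixNorm_nonneg θ w'
  have m3 := mixNorm_nonneg θ (w - w')
  calc ‖N w - N w'‖ ≤ c * (mixNorm θ w + mixNorm θ w') ^ b * mixNorm θ (w - w') :=
        hN.norm_sub_le w hw w' hw'
    _ ≤ c * (4 * (Q * ρ)) ^ b * (d * Q * ρ) := by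
        gcongr
        linarith
    _ = c * 4 ^ b * Q ^ (b + 1) * d * τ ^ (-(μ * θ * (b + 1))) := by
        have e : τ ^ (-(μ * θ * (b + 1))) = ρ ^ (b + 1) := by
          rw [hρ, ← Real.rpow_mul hτ.le]; congr 1; ring
        rw [e, Real.mul_rpow (by norm_num) (by positivity), Real.mul_rpow hQ0 hρ0.le,
          Real.rpow_add_one' hQ0 (by linarith), Real.rpow_add_one hρ0.ne']
        ring

theorem IsPowerLike.norm_le_mul (hN : IsPowerLike W N b θ c) {μ τ R ε : ℝ} (hτ : 0 < τ)
    {w : X × P} (hw : w ∈ W) (hR : 0 ≤ R) (hε : 0 ≤ ε)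
    (h1 : ‖w.1‖ ≤ 2 * R) (h2 : τ ^ μ * ‖w.2‖ ≤ 2 * ε) :
    ‖N w‖ ≤ c * 4 ^ b * (R ^ (1 - θ) * ε ^ θ) ^ (b + 1) * 2 * τ ^ (-(μ * θ * (b + 1))) := by
  have := hN.norm_sub_le_mul hτ hw W.zero_mem zero_le_two hR hε h1 h2 (by simpa using hR)
    (by simpa using hε) (by simpa using h1) (by simpa using h2)
  simpa [hN.map_zero] using this

/-- As `θ > 0`, a bound in `X` and a vanishing weighted norm in `P` make the interpolated norm
vanish with its weight; this is what makes the critical case `ω = 0` work. -/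
theorem IsPowerLike.tendsto (hN : IsPowerLike W N b θ c) {μ M : ℝ} {u : ℝ → X} {v : ℝ → P}
    (hW : ∀ᶠ τ in 𝓝[>] 0, (u τ, v τ) ∈ W) (hu : ∀ᶠ τ in 𝓝[>] 0, ‖u τ‖ ≤ M)
    (hv : Tendsto (fun τ => τ ^ μ * ‖v τ‖) (𝓝[>] 0) (𝓝 0)) :
    Tendsto (fun τ => τ ^ (μ * θ * (b + 1)) * ‖N (u τ, v τ)‖) (𝓝[>] 0) (𝓝 0) := by
  have hb := hN.b_pos
  have hc := hN.nonneg
  have hlim : Tendsto (fun τ => c * (M ^ (1 - θ) * (τ ^ μ * ‖v τ‖) ^ θ) ^ (b + 1)) (𝓝[>] 0)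
      (𝓝 (c * (M ^ (1 - θ) * 0 ^ θ) ^ (b + 1))) :=
    (((hv.rpow_const (Or.inr hN.θ_pos.le)).const_mul _).rpow_const
      (Or.inr (by linarith))).const_mul _
  rw [Real.zero_rpow hN.θ_pos.ne', mul_zero, Real.zero_rpow (by linarith), mul_zero] at hlim
  refine squeeze_zero' ?_ ?_ hlim
  · filter_upwards [self_mem_nhdsWithin] with τ hτ
    have : (0 : ℝ) < τ := hτ
    positivity
  · filter_upwards [self_mem_nhdsWithin, hW, hu] with τ hτ hw hM
    have hτ : (0 : ℝ) < τ := hτ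
    have h1 := hN.norm_sub_le _ hw 0 W.zero_mem
    rw [hN.map_zero, sub_zero, sub_zero, mixNorm_zero hN.θ_pos, add_zero, mul_assoc,
      ← Real.rpow_add_one' (mixNorm_nonneg _ _) (by linarith)] at h1
    have h2 := mixNorm_le (θ := θ) (μ := μ) (w := (u τ, v τ)) hN.θ_pos.le hN.θ_le hτ hM le_rfl
    set Q := M ^ (1 - θ) * (τ ^ μ * ‖v τ‖) ^ θ with hQ
    have hM0 : 0 ≤ M := (norm_nonneg _).trans hM
    have hQ0 : 0 ≤ Q := by positivity
    calc _ ≤ τ ^ (μ * θ * (b + 1)) * (c * (Q * τ ^ (-(μ * θ))) ^ (b + 1)) := by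
          have := mixNorm_nonneg θ (u τ, v τ)
          refine mul_le_mul_of_nonneg_left (h1.trans ?_) (by positivity)
          gcongr
      _ = c * Q ^ (b + 1) * (τ ^ (μ * θ * (b + 1)) * τ ^ (-(μ * θ) * (b + 1))) := by
          rw [Real.mul_rpow hQ0 (by positivity), ← Real.rpow_mul hτ.le]; ring
      _ = _ := by rw [← Real.rpow_add hτ]; ring_nf; simp

end MixedNorm

/-- The functional-analytic data behind a semilinear equation `u' = A u + (a·∇) g(u)`: a semigroup
`S` on `X`, smoothing into `P`, with pairs in `W ⊆ X × P` standing for elements of `X ∩ P`, and the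
operators `D₁`, `D₂` applied to the nonlinearity, with values in `X` and in `P`. -/
structure MildSystem (X P F₁ F₂ : Type*) [NormedAddCommGroup X] [NormedSpace ℝ X]
    [NormedAddCommGroup P] [NormedSpace ℝ P] [NormedAddCommGroup F₁] [NormedSpace ℝ F₁]
    [NormedAddCommGroup F₂] [NormedSpace ℝ F₂] where
  W : Submodule ℝ (X × P)
  S : ℝ → X →L[ℝ] X
  SP : ℝ → X →L[ℝ] P
  D₁ : ℝ → F₁ →L[ℝ] X
  D₂ : ℝ → F₂ →L[ℝ] P
  N₁ : X × P → F₁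
  N₂ : X × P → F₂
  (b μ θ₁ θ₂ γ₁ γ₂ ω C c₁ c₂ C₁ C₂ : ℝ)
  isClosed_W : IsClosed (W : Set (X × P))
  -- The component in `P` of a pair in `W` is determined by its component in `X`.
  eq_zero_of_mem : ∀ y : P, ((0 : X), y) ∈ W → y = 0
  μ_pos : 0 < μ
  γ₁_lt : γ₁ < 1
  γ₂_lt : γ₂ < 1
  β₁_lt : μ * θ₁ * (b + 1) < 1
  β₂_lt : μ * θ₂ * (b + 1) < 1
  ω_nonneg : 0 ≤ ω
  -- Both Duhamel terms gain the same power `t^ω`, the one in `P` after multiplication by its weight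
  -- `t^μ`. The critical case is `ω = 0`.
  scaling₁ : 1 - γ₁ - μ * θ₁ * (b + 1) = ω
  scaling₂ : 1 - γ₂ - μ * θ₂ * (b + 1) + μ = ω
  -- Superlinearity in the weighted norm: it permits `ε` to be taken small with `R` fixed.
  lt_θ₂ : 1 < θ₂ * (b + 1)
  one_le_C : 1 ≤ C
  S_bound : ∀ t, 0 < t → ∀ x, ‖S t x‖ ≤ C * ‖x‖
  S_cont : ∀ x, ContinuousOn (fun t => S t x) (Ioi 0)
  S_tendsto : ∀ x, Tendsto (fun t => S t x) (𝓝[>] 0) (𝓝 x)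
  SP_smoothing : IsSmoothing SP C μ
  SP_tendsto : ∀ x, Tendsto (fun t => t ^ μ * ‖SP t x‖) (𝓝[>] 0) (𝓝 0)
  D₁_smoothing : IsSmoothing D₁ C₁ γ₁
  D₂_smoothing : IsSmoothing D₂ C₂ γ₂
  N₁_power : IsPowerLike W N₁ b θ₁ c₁
  N₂_power : IsPowerLike W N₂ b θ₂ c₂
  S_mem : ∀ t, 0 < t → ∀ x, (S t x, SP t x) ∈ W
  D_mem : ∀ t, 0 < t → ∀ w ∈ W, (D₁ t (N₁ w), D₂ t (N₂ w)) ∈ W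
  S_add : ∀ s t, 0 < s → 0 < t → ∀ x, S (s + t) x = S s (S t x)
  D_add : ∀ s t, 0 < s → 0 < t → ∀ x, D₁ (s + t) x = S s (D₁ t x)

/-! ### The abstract integral equation: curves and the fixed-point map -/

namespace MildSystem

variable {X P F₁ F₂ : Type*} [NormedAddCommGroup X] [NormedSpace ℝ X]
  [NormedAddCommGroup P] [NormedSpace ℝ P] [NormedAddCommGroup F₁] [NormedSpace ℝ F₁]
  [NormedAddCommGroup F₂] [NormedSpace ℝ F₂] (A : MildSystem X P F₁ F₂)

theorem b_pos : 0 < A.b := A.N₁_power.b_pos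

/-- Curves `u` in `X` and `v` in `P` on `[0, T)` standing for the same function, continuous in `X`
and in the homogeneous time-weighted space over `P`. -/
structure IsCurve (T : ℝ≥0∞) (u : ℝ → X) (v : ℝ → P) : Prop where
  cont_u : ContinuousOn u (timeInterval T)
  cont_v : ContinuousOn v (timeInterval T \ {0})
  tendsto_v : Tendsto (fun t => t ^ A.μ * ‖v t‖) (𝓝[>] 0) (𝓝 0)
  mem_W : ∀ t ∈ timeInterval T \ {0}, (u t, v t) ∈ A.W

/-- The Duhamel part of the integral equation in `X`. -/
def J₁ (u : ℝ → X) (v : ℝ → P) (t : ℝ) : X := duhamel A.D₁ (fun τ => A.N₁ (u τ, v τ)) t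

/-- The Duhamel part of the integral equation in `P`. -/
def J₂ (u : ℝ → X) (v : ℝ → P) (t : ℝ) : P := duhamel A.D₂ (fun τ => A.N₂ (u τ, v τ)) t

variable {A} {T : ℝ≥0∞} {u u' : ℝ → X} {v v' : ℝ → P} {R ε d : ℝ}

theorem IsCurve.cont_pair (h : A.IsCurve T u v) :
    ContinuousOn (fun τ => (u τ, v τ)) (timeInterval T \ {0}) :=
  (h.cont_u.mono sdiff_subset).prodMk h.cont_v

theorem IsCurve.cont_N₁ (h : A.IsCurve T u v) :
    ContinuousOn (fun τ => A.N₁ (u τ, v τ)) (timeInterval T \ {0}) :=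
  A.N₁_power.continuousOn.comp h.cont_pair h.mem_W

theorem IsCurve.cont_N₂ (h : A.IsCurve T u v) :
    ContinuousOn (fun τ => A.N₂ (u τ, v τ)) (timeInterval T \ {0}) :=
  A.N₂_power.continuousOn.comp h.cont_pair h.mem_W

theorem IsCurve.mono {T' : ℝ≥0∞} (h : A.IsCurve T u v) (hT : T' ≤ T) : A.IsCurve T' u v where
  cont_u := h.cont_u.mono (timeInterval_mono hT)
  cont_v := h.cont_v.mono (sdiff_subset_sdiff_left (timeInterval_mono hT))
  tendsto_v := h.tendsto_v
  mem_W t ht := h.mem_W t ⟨timeInterval_mono hT ht.1, ht.2⟩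

/-- `‖u‖ ≤ 2R` and `t^μ ‖v‖ ≤ 2ε` on `(0, T)`. -/
def IsBdd (A : MildSystem X P F₁ F₂) (T : ℝ≥0∞) (R ε : ℝ) (u : ℝ → X) (v : ℝ → P) : Prop :=
  ∀ t ∈ timeInterval T \ {0}, ‖u t‖ ≤ 2 * R ∧ t ^ A.μ * ‖v t‖ ≤ 2 * ε

theorem IsCurve.integrable₁ (h : A.IsCurve T u v) (hb : A.IsBdd T R ε u v) (hR : 0 ≤ R)
    (hε : 0 ≤ ε) {t : ℝ} (ht : t ∈ timeInterval T \ {0}) :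
    IntervalIntegrable (fun τ => A.D₁ (t - τ) (A.N₁ (u τ, v τ))) volume 0 t := by
  have hs : Ioo 0 t ⊆ timeInterval T \ {0} :=
    fun τ hτ => timeInterval_sdiff_Ioc_subset ht ⟨hτ.1, hτ.2.le⟩
  have hH := fun τ (hτ : τ ∈ Ioo 0 t) => A.N₁_power.norm_le_mul hτ.1 (h.mem_W τ (hs hτ)) hR hε
    (hb τ (hs hτ)).1 (hb τ (hs hτ)).2
  exact A.D₁_smoothing.intervalIntegrable A.γ₁_lt A.β₁_lt (timeInterval_sdiff_pos ht)
    (h.cont_N₁.mono hs) hH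

theorem IsCurve.integrable₂ (h : A.IsCurve T u v) (hb : A.IsBdd T R ε u v) (hR : 0 ≤ R)
    (hε : 0 ≤ ε) {t : ℝ} (ht : t ∈ timeInterval T \ {0}) :
    IntervalIntegrable (fun τ => A.D₂ (t - τ) (A.N₂ (u τ, v τ))) volume 0 t := by
  have hs : Ioo 0 t ⊆ timeInterval T \ {0} :=
    fun τ hτ => timeInterval_sdiff_Ioc_subset ht ⟨hτ.1, hτ.2.le⟩
  have hH := fun τ (hτ : τ ∈ Ioo 0 t) => A.N₂_power.norm_le_mul hτ.1 (h.mem_W τ (hs hτ)) hR hε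
    (hb τ (hs hτ)).1 (hb τ (hs hτ)).2
  exact A.D₂_smoothing.intervalIntegrable A.γ₂_lt A.β₂_lt (timeInterval_sdiff_pos ht)
    (h.cont_N₂.mono hs) hH

/-- The two Duhamel integrals are the components of one Bochner integral in `X × P`, whose integrand
lies in the closed subspace `W`. -/
theorem IsCurve.J_mem [CompleteSpace X] [CompleteSpace P] (h : A.IsCurve T u v)
    (hb : A.IsBdd T R ε u v) (hR : 0 ≤ R) (hε : 0 ≤ ε) {t : ℝ} (ht : t ∈ timeInterval T \ {0}) :
    (A.J₁ u v t, A.J₂ u v t) ∈ A.W := by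
  have h1 := h.integrable₁ hb hR hε ht
  have h2 := h.integrable₂ hb hR hε ht
  have ht0 := timeInterval_sdiff_pos ht
  rw [intervalIntegrable_iff_integrableOn_Ioo_of_le ht0.le] at h1 h2
  rw [J₁, J₂, duhamel, duhamel, intervalIntegral.integral_of_le ht0.le,
    intervalIntegral.integral_of_le ht0.le, integral_Ioc_eq_integral_Ioo,
    integral_Ioc_eq_integral_Ioo, ← integral_pair h1 h2]
  refine A.W.integral_mem_of_isClosed A.isClosed_W (h1.prodMk h2) ?_
  filter_upwards [ae_restrict_mem measurableSet_Ioo] with τ hτ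
  exact A.D_mem _ (sub_pos.2 hτ.2) _
    (h.mem_W τ (timeInterval_sdiff_Ioc_subset ht ⟨hτ.1, hτ.2.le⟩))

variable (A) in
/-- The constant of the contraction estimate in `X`. -/
def K₁ : ℝ := A.C₁ * (A.c₁ * 4 ^ A.b) * betaConst A.γ₁ (A.μ * A.θ₁ * (A.b + 1))

variable (A) in
/-- The constant of the contraction estimate in `P`. -/
def K₂ : ℝ := A.C₂ * (A.c₂ * 4 ^ A.b) * betaConst A.γ₂ (A.μ * A.θ₂ * (A.b + 1))

theorem K₁_nonneg : 0 ≤ A.K₁ :=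
  mul_nonneg (mul_nonneg A.D₁_smoothing.nonneg (mul_nonneg A.N₁_power.nonneg (by positivity)))
    (betaConst_nonneg _ _)

theorem K₂_nonneg : 0 ≤ A.K₂ :=
  mul_nonneg (mul_nonneg A.D₂_smoothing.nonneg (mul_nonneg A.N₂_power.nonneg (by positivity)))
    (betaConst_nonneg _ _)

theorem IsCurve.J₁_sub (h : A.IsCurve T u v) (h' : A.IsCurve T u' v') (hb : A.IsBdd T R ε u v)
    (hb' : A.IsBdd T R ε u' v') (hR : 0 ≤ R) (hε : 0 ≤ ε) {t : ℝ}
    (ht : t ∈ timeInterval T \ {0}) :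
    A.J₁ u v t - A.J₁ u' v' t
      = duhamel A.D₁ (fun τ => A.N₁ (u τ, v τ) - A.N₁ (u' τ, v' τ)) t := by
  simp only [J₁, duhamel, map_sub]
  exact (intervalIntegral.integral_sub (h.integrable₁ hb hR hε ht)
    (h'.integrable₁ hb' hR hε ht)).symm

theorem IsCurve.J₂_sub (h : A.IsCurve T u v) (h' : A.IsCurve T u' v') (hb : A.IsBdd T R ε u v)
    (hb' : A.IsBdd T R ε u' v') (hR : 0 ≤ R) (hε : 0 ≤ ε) {t : ℝ}
    (ht : t ∈ timeInterval T \ {0}) :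
    A.J₂ u v t - A.J₂ u' v' t
      = duhamel A.D₂ (fun τ => A.N₂ (u τ, v τ) - A.N₂ (u' τ, v' τ)) t := by
  simp only [J₂, duhamel, map_sub]
  exact (intervalIntegral.integral_sub (h.integrable₂ hb hR hε ht)
    (h'.integrable₂ hb' hR hε ht)).symm

/-- The contraction estimate. The number multiplying `d` involves `R`, `ε` and `t^ω` only;
comparison with the zero curve also gives the a priori bound. -/
theorem IsCurve.norm_J₁_sub_le (h : A.IsCurve T u v) (h' : A.IsCurve T u' v')
    (hb : A.IsBdd T R ε u v) (hb' : A.IsBdd T R ε u' v') (hR : 0 ≤ R) (hε : 0 ≤ ε) (hd0 : 0 ≤ d)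
    {t : ℝ} (ht : t ∈ timeInterval T \ {0})
    (hd : ∀ τ ∈ Ioo 0 t, ‖u τ - u' τ‖ ≤ d * R ∧ τ ^ A.μ * ‖v τ - v' τ‖ ≤ d * ε) :
    ‖A.J₁ u v t - A.J₁ u' v' t‖
      ≤ A.K₁ * (R ^ (1 - A.θ₁) * ε ^ A.θ₁) ^ (A.b + 1) * t ^ A.ω * d := by
  have hs : Ioo 0 t ⊆ timeInterval T \ {0} :=
    fun τ hτ => timeInterval_sdiff_Ioc_subset ht ⟨hτ.1, hτ.2.le⟩
  rw [h.J₁_sub h' hb hb' hR hε ht]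
  refine (A.D₁_smoothing.norm_duhamel_le A.γ₁_lt A.β₁_lt (timeInterval_sdiff_pos ht)
    fun τ hτ => A.N₁_power.norm_sub_le_mul hτ.1 (h.mem_W τ (hs hτ)) (h'.mem_W τ (hs hτ)) hd0 hR hε
      (hb τ (hs hτ)).1 (hb τ (hs hτ)).2 (hb' τ (hs hτ)).1 (hb' τ (hs hτ)).2 (hd τ hτ).1
      (hd τ hτ).2).trans (le_of_eq ?_)
  rw [K₁, A.scaling₁]; ring

theorem IsCurve.norm_J₂_sub_le (h : A.IsCurve T u v) (h' : A.IsCurve T u' v')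
    (hb : A.IsBdd T R ε u v) (hb' : A.IsBdd T R ε u' v') (hR : 0 ≤ R) (hε : 0 ≤ ε) (hd0 : 0 ≤ d)
    {t : ℝ} (ht : t ∈ timeInterval T \ {0})
    (hd : ∀ τ ∈ Ioo 0 t, ‖u τ - u' τ‖ ≤ d * R ∧ τ ^ A.μ * ‖v τ - v' τ‖ ≤ d * ε) :
    t ^ A.μ * ‖A.J₂ u v t - A.J₂ u' v' t‖
      ≤ A.K₂ * (R ^ (1 - A.θ₂) * ε ^ A.θ₂) ^ (A.b + 1) * t ^ A.ω * d := by
  have hs : Ioo 0 t ⊆ timeInterval T \ {0} :=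
    fun τ hτ => timeInterval_sdiff_Ioc_subset ht ⟨hτ.1, hτ.2.le⟩
  have ht0 := timeInterval_sdiff_pos ht
  rw [h.J₂_sub h' hb hb' hR hε ht]
  refine (mul_le_mul_of_nonneg_left (A.D₂_smoothing.norm_duhamel_le A.γ₂_lt A.β₂_lt ht0
    fun τ hτ => A.N₂_power.norm_sub_le_mul hτ.1 (h.mem_W τ (hs hτ)) (h'.mem_W τ (hs hτ)) hd0 hR hε
      (hb τ (hs hτ)).1 (hb τ (hs hτ)).2 (hb' τ (hs hτ)).1 (hb' τ (hs hτ)).2 (hd τ hτ).1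
      (hd τ hτ).2) (by positivity)).trans (le_of_eq ?_)
  rw [K₂, ← A.scaling₂, Real.rpow_add ht0]; ring

theorem isCurve_zero : A.IsCurve T (fun _ => 0) (fun _ => 0) where
  cont_u := continuousOn_const
  cont_v := continuousOn_const
  tendsto_v := by simp
  mem_W _ _ := A.W.zero_mem

theorem J₁_zero (t : ℝ) : A.J₁ (fun _ => 0) (fun _ => 0) t = 0 := by
  have : ((0 : X), (0 : P)) = 0 := rfl
  simp [J₁, duhamel, this, A.N₁_power.map_zero]

theorem J₂_zero (t : ℝ) : A.J₂ (fun _ => 0) (fun _ => 0) t = 0 := by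
  have : ((0 : X), (0 : P)) = 0 := rfl
  simp [J₂, duhamel, this, A.N₂_power.map_zero]

theorem isBdd_zero (hR : 0 ≤ R) (hε : 0 ≤ ε) : A.IsBdd T R ε (fun _ => 0) (fun _ => 0) := by
  intro t _; simp [hR, hε]

variable (A) in
/-- The right-hand side of the integral equation in `X`. -/
def stepU (φ : X) (u : ℝ → X) (v : ℝ → P) (t : ℝ) : X :=
  -- Nothing is assumed about `S 0`, so the initial value is prescribed separately.
  if 0 < t then A.S t φ + A.J₁ u v t else φ

variable (A) in
/-- The right-hand side of the integral equation in `P`. -/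
def stepV (φ : X) (u : ℝ → X) (v : ℝ → P) (t : ℝ) : P := A.SP t φ + A.J₂ u v t

theorem stepU_of_pos (φ : X) {t : ℝ} (ht : 0 < t) :
    A.stepU φ u v t = A.S t φ + A.J₁ u v t := if_pos ht

theorem stepU_zero (φ : X) : A.stepU φ u v 0 = φ := if_neg (lt_irrefl _)

theorem IsCurve.eventually_bdd (h : A.IsCurve T u v) (hT : 0 < T) :
    ∀ᶠ τ in 𝓝[>] (0 : ℝ), ‖u τ‖ ≤ ‖u 0‖ + 1 := by
  have := ((continuousOn_timeInterval_iff hT).1 h.cont_u).2.norm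
  filter_upwards [this.eventually (gt_mem_nhds (lt_add_one ‖u 0‖))] with τ hτ using hτ.le

theorem IsCurve.eventually_mem (h : A.IsCurve T u v) (hT : 0 < T) :
    ∀ᶠ τ in 𝓝[>] (0 : ℝ), (u τ, v τ) ∈ A.W := by
  have h1 : ∀ᶠ τ in 𝓝[timeInterval T \ {0}] (0 : ℝ), (u τ, v τ) ∈ A.W := by
    filter_upwards [self_mem_nhdsWithin] with τ hτ using h.mem_W τ hτ
  exact nhdsWithin_timeInterval_le hT h1

/-- Attainment of the initial value. For `ω = 0` it relies on `t^μ ‖v‖ → 0`, which is part of the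
notion of a curve. -/
theorem IsCurve.tendsto_J₁ (h : A.IsCurve T u v) (hT : 0 < T) :
    Tendsto (A.J₁ u v) (𝓝[>] 0) (𝓝 0) := by
  have h1 := A.D₁_smoothing.tendsto_duhamel A.γ₁_lt A.β₁_lt A.ω_nonneg
    (A.N₁_power.tendsto (h.eventually_mem hT) (h.eventually_bdd hT) h.tendsto_v)
  have e : A.ω + A.γ₁ + A.μ * A.θ₁ * (A.b + 1) - 1 = 0 := by rw [← A.scaling₁]; ring
  simp only [e, Real.rpow_zero, one_mul] at h1
  exact tendsto_zero_iff_norm_tendsto_zero.2 h1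

theorem IsCurve.tendsto_J₂ (h : A.IsCurve T u v) (hT : 0 < T) :
    Tendsto (fun t => t ^ A.μ * ‖A.J₂ u v t‖) (𝓝[>] 0) (𝓝 0) := by
  have h1 := A.D₂_smoothing.tendsto_duhamel A.γ₂_lt A.β₂_lt A.ω_nonneg
    (A.N₂_power.tendsto (h.eventually_mem hT) (h.eventually_bdd hT) h.tendsto_v)
  have e : A.ω + A.γ₂ + A.μ * A.θ₂ * (A.b + 1) - 1 = A.μ := by rw [← A.scaling₂]; ring
  simp only [e] at h1
  exact h1

theorem IsCurve.step [CompleteSpace X] [CompleteSpace P] (h : A.IsCurve T u v)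
    (hb : A.IsBdd T R ε u v) (hR : 0 ≤ R) (hε : 0 ≤ ε) (hT : 0 < T) (φ : X) :
    A.IsCurve T (A.stepU φ u v) (A.stepV φ u v) where
  cont_u := by
    refine (continuousOn_timeInterval_iff hT).2 ⟨?_, ?_⟩
    · have h1 : ContinuousOn (fun t => A.S t φ + A.J₁ u v t) (timeInterval T \ {0}) :=
        ((A.S_cont φ).mono fun t ht => timeInterval_sdiff_pos ht).add
          (A.D₁_smoothing.continuousOn_duhamel A.γ₁_lt A.β₁_lt (isOpen_timeInterval_sdiff T)
            (fun t ht => timeInterval_sdiff_pos ht) (fun t ht => timeInterval_sdiff_Ioc_subset ht)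
            h.cont_N₁ fun τ hτ => A.N₁_power.norm_le_mul (timeInterval_sdiff_pos hτ)
              (h.mem_W τ hτ) hR hε (hb τ hτ).1 (hb τ hτ).2)
      exact h1.congr fun t ht => stepU_of_pos φ (timeInterval_sdiff_pos ht)
    · rw [stepU_zero]
      have h1 := (A.S_tendsto φ).add (h.tendsto_J₁ hT)
      rw [add_zero] at h1
      refine h1.congr' ?_
      filter_upwards [self_mem_nhdsWithin] with t ht using (stepU_of_pos φ ht).symm
  cont_v := ((A.SP_smoothing.continuousOn φ).mono fun t ht => timeInterval_sdiff_pos ht).add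
    (A.D₂_smoothing.continuousOn_duhamel A.γ₂_lt A.β₂_lt (isOpen_timeInterval_sdiff T)
      (fun t ht => timeInterval_sdiff_pos ht) (fun t ht => timeInterval_sdiff_Ioc_subset ht)
      h.cont_N₂ fun τ hτ => A.N₂_power.norm_le_mul (timeInterval_sdiff_pos hτ)
        (h.mem_W τ hτ) hR hε (hb τ hτ).1 (hb τ hτ).2)
  tendsto_v := by
    have h1 := (A.SP_tendsto φ).add (h.tendsto_J₂ hT)
    rw [add_zero] at h1
    refine squeeze_zero' ?_ ?_ h1
    · filter_upwards [self_mem_nhdsWithin] with t ht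
      have : (0 : ℝ) < t := ht
      positivity
    · filter_upwards [self_mem_nhdsWithin] with t ht
      have : (0 : ℝ) < t := ht
      rw [← mul_add]
      exact mul_le_mul_of_nonneg_left (norm_add_le _ _) (by positivity)
  mem_W t ht := by
    rw [stepU_of_pos φ (timeInterval_sdiff_pos ht)]
    exact A.W.add_mem (A.S_mem t (timeInterval_sdiff_pos ht) φ) (h.J_mem hb hR hε ht)

end MildSystem

/-! ### Contraction and existence -/

namespace MildSystem

variable {X P F₁ F₂ : Type*} [NormedAddCommGroup X] [NormedSpace ℝ X]
  [NormedAddCommGroup P] [NormedSpace ℝ P] [NormedAddCommGroup F₁] [NormedSpace ℝ F₁]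
  [NormedAddCommGroup F₂] [NormedSpace ℝ F₂] {A : MildSystem X P F₁ F₂}
  {T : ℝ≥0∞} {u u' : ℝ → X} {v v' : ℝ → P} {R ε : ℝ}

/-- `(u, v)` is a bounded curve that solves the integral equation on `[0, T)` with datum `φ`. -/
structure IsSolution (A : MildSystem X P F₁ F₂) (φ : X) (T : ℝ≥0∞) (u : ℝ → X) (v : ℝ → P) :
    Prop extends A.IsCurve T u v where
  init : u 0 = φ
  bdd : ∃ R ε : ℝ, 0 ≤ R ∧ 0 ≤ ε ∧ A.IsBdd T R ε u v
  eq : ∀ t ∈ timeInterval T \ {0}, u t = A.S t φ + A.J₁ u v t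

theorem eq_of_mem_W {x : X} {y y' : P} (h : (x, y) ∈ A.W) (h' : (x, y') ∈ A.W) : y = y' := by
  have := A.W.sub_mem h h'
  rw [Prod.mk_sub_mk, sub_self] at this
  exact sub_eq_zero.1 (A.eq_zero_of_mem _ this)

/-- The linear part uses up `R` and `ε`. The Duhamel part, compared with the zero curve at relative
distance `d = 2`, adds at most twice `R / 2` and twice `ε / 2`. -/
theorem IsCurve.isBdd_step {φ : X} {Θ : ℝ} (h : A.IsCurve T u v)
    (hb : A.IsBdd T R ε u v) (hR : 0 ≤ R) (hε : 0 ≤ ε)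
    (hφR : ∀ t ∈ timeInterval T \ {0}, ‖A.S t φ‖ ≤ R)
    (hφε : ∀ t ∈ timeInterval T \ {0}, t ^ A.μ * ‖A.SP t φ‖ ≤ ε)
    (hΘ : ∀ t ∈ timeInterval T \ {0}, t ^ A.ω ≤ Θ)
    (h₁ : A.K₁ * (R ^ (1 - A.θ₁) * ε ^ A.θ₁) ^ (A.b + 1) * Θ ≤ R / 2)
    (h₂ : A.K₂ * (R ^ (1 - A.θ₂) * ε ^ A.θ₂) ^ (A.b + 1) * Θ ≤ ε / 2) :
    A.IsBdd T R ε (A.stepU φ u v) (A.stepV φ u v) := by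
  intro t ht
  have ht0 := timeInterval_sdiff_pos ht
  have hs : ∀ τ ∈ Ioo 0 t, ‖u τ - 0‖ ≤ 2 * R ∧ τ ^ A.μ * ‖v τ - 0‖ ≤ 2 * ε := by
    intro τ hτ
    simpa using hb τ (timeInterval_sdiff_Ioc_subset ht ⟨hτ.1, hτ.2.le⟩)
  have a1 := h.norm_J₁_sub_le isCurve_zero hb (isBdd_zero hR hε) hR hε zero_le_two ht hs
  have a2 := h.norm_J₂_sub_le isCurve_zero hb (isBdd_zero hR hε) hR hε zero_le_two ht hs
  rw [J₁_zero, sub_zero] at a1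
  rw [J₂_zero, sub_zero] at a2
  have q1 : 0 ≤ A.K₁ * (R ^ (1 - A.θ₁) * ε ^ A.θ₁) ^ (A.b + 1) := mul_nonneg K₁_nonneg (by positivity)
  have q2 : 0 ≤ A.K₂ * (R ^ (1 - A.θ₂) * ε ^ A.θ₂) ^ (A.b + 1) := mul_nonneg K₂_nonneg (by positivity)
  have b1 := mul_le_mul_of_nonneg_left (hΘ t ht) q1
  have b2 := mul_le_mul_of_nonneg_left (hΘ t ht) q2
  constructor
  · rw [stepU_of_pos φ ht0]
    have := norm_add_le (A.S t φ) (A.J₁ u v t)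
    have := hφR t ht
    linarith
  · have c1 := mul_le_mul_of_nonneg_left (norm_add_le (A.SP t φ) (A.J₂ u v t))
      (Real.rpow_nonneg ht0.le A.μ)
    have := hφε t ht
    rw [stepV]
    linarith

/-- The linear parts cancel and the Duhamel parts contract with factor `1/2`, simultaneously in both
norms. -/
theorem IsCurve.step_sub_le {φ : X} {Θ d : ℝ} (h : A.IsCurve T u v) (h' : A.IsCurve T u' v')
    (hb : A.IsBdd T R ε u v) (hb' : A.IsBdd T R ε u' v') (hR : 0 ≤ R) (hε : 0 ≤ ε) (hd0 : 0 ≤ d)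
    (hΘ : ∀ t ∈ timeInterval T \ {0}, t ^ A.ω ≤ Θ)
    (h₁ : A.K₁ * (R ^ (1 - A.θ₁) * ε ^ A.θ₁) ^ (A.b + 1) * Θ ≤ R / 2)
    (h₂ : A.K₂ * (R ^ (1 - A.θ₂) * ε ^ A.θ₂) ^ (A.b + 1) * Θ ≤ ε / 2)
    (hd : ∀ τ ∈ timeInterval T \ {0}, ‖u τ - u' τ‖ ≤ d * R ∧ τ ^ A.μ * ‖v τ - v' τ‖ ≤ d * ε) :
    ∀ τ ∈ timeInterval T \ {0}, ‖A.stepU φ u v τ - A.stepU φ u' v' τ‖ ≤ d / 2 * R ∧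
      τ ^ A.μ * ‖A.stepV φ u v τ - A.stepV φ u' v' τ‖ ≤ d / 2 * ε := by
  intro t ht
  have ht0 := timeInterval_sdiff_pos ht
  have hs := fun τ (hτ : τ ∈ Ioo 0 t) => hd τ (timeInterval_sdiff_Ioc_subset ht ⟨hτ.1, hτ.2.le⟩)
  have a1 := h.norm_J₁_sub_le h' hb hb' hR hε hd0 ht hs
  have a2 := h.norm_J₂_sub_le h' hb hb' hR hε hd0 ht hs
  have q1 : 0 ≤ A.K₁ * (R ^ (1 - A.θ₁) * ε ^ A.θ₁) ^ (A.b + 1) := mul_nonneg K₁_nonneg (by positivity)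
  have q2 : 0 ≤ A.K₂ * (R ^ (1 - A.θ₂) * ε ^ A.θ₂) ^ (A.b + 1) := mul_nonneg K₂_nonneg (by positivity)
  have b1 := mul_le_mul_of_nonneg_right
    ((mul_le_mul_of_nonneg_left (hΘ t ht) q1).trans h₁) hd0
  have b2 := mul_le_mul_of_nonneg_right
    ((mul_le_mul_of_nonneg_left (hΘ t ht) q2).trans h₂) hd0
  constructor
  · rw [stepU_of_pos φ ht0, stepU_of_pos φ ht0, add_sub_add_left_eq_sub]
    linarith
  · rw [stepV, stepV, add_sub_add_left_eq_sub]
    linarith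

/-- Banach's iteration, done by hand on curves: successive differences decay geometrically,
uniformly in `t` in `X` and uniformly in the weighted norm in `P`, so the limit inherits continuity,
the limit at `0` and membership in `W`. -/
theorem exists_isSolution [CompleteSpace X] [CompleteSpace P] {φ : X} {Θ : ℝ} (hT : 0 < T)
    (hR : 0 ≤ R) (hε : 0 ≤ ε)
    (hφR : ∀ t ∈ timeInterval T \ {0}, ‖A.S t φ‖ ≤ R)
    (hφε : ∀ t ∈ timeInterval T \ {0}, t ^ A.μ * ‖A.SP t φ‖ ≤ ε)
    (hΘ : ∀ t ∈ timeInterval T \ {0}, t ^ A.ω ≤ Θ)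
    (h₁ : A.K₁ * (R ^ (1 - A.θ₁) * ε ^ A.θ₁) ^ (A.b + 1) * Θ ≤ R / 2)
    (h₂ : A.K₂ * (R ^ (1 - A.θ₂) * ε ^ A.θ₂) ^ (A.b + 1) * Θ ≤ ε / 2) :
    ∃ u v, A.IsSolution φ T u v := by
  let step : (ℝ → X) × (ℝ → P) → (ℝ → X) × (ℝ → P) := fun z =>
    (A.stepU φ z.1 z.2, A.stepV φ z.1 z.2)
  -- The iteration starts from the image of the zero curve, which already has the initial value `φ`.
  let z : ℕ → (ℝ → X) × (ℝ → P) := fun k => step^[k] (step (fun _ => 0, fun _ => 0))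
  have zsucc : ∀ k, z (k + 1) = step (z k) := fun k => Function.iterate_succ_apply' _ _ _
  have hz : ∀ k, A.IsCurve T (z k).1 (z k).2 ∧ A.IsBdd T R ε (z k).1 (z k).2 ∧ (z k).1 0 = φ := by
    intro k
    induction k with
    | zero => exact ⟨isCurve_zero.step (isBdd_zero hR hε) hR hε hT φ,
        isCurve_zero.isBdd_step (isBdd_zero hR hε) hR hε hφR hφε hΘ h₁ h₂, stepU_zero φ⟩
    | succ k ih =>
      rw [zsucc]
      exact ⟨ih.1.step ih.2.1 hR hε hT φ, ih.1.isBdd_step ih.2.1 hR hε hφR hφε hΘ h₁ h₂,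
        stepU_zero φ⟩
  have hdiff : ∀ k, ∀ τ ∈ timeInterval T \ {0},
      ‖(z (k + 1)).1 τ - (z k).1 τ‖ ≤ 4 * (1 / 2) ^ k * R ∧
      τ ^ A.μ * ‖(z (k + 1)).2 τ - (z k).2 τ‖ ≤ 4 * (1 / 2) ^ k * ε := by
    intro k
    induction k with
    | zero =>
      intro τ hτ
      have a := (hz 1).2.1 τ hτ
      have b := (hz 0).2.1 τ hτ
      have := norm_sub_le ((z (0 + 1)).1 τ) ((z 0).1 τ)
      have c := mul_le_mul_of_nonneg_left (norm_sub_le ((z (0 + 1)).2 τ) ((z 0).2 τ))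
        (Real.rpow_nonneg (timeInterval_sdiff_pos hτ).le A.μ)
      norm_num at *
      constructor <;> linarith
    | succ k ih =>
      have := (hz (k + 1)).1.step_sub_le (φ := φ) (hz k).1 (hz (k + 1)).2.1 (hz k).2.1 hR hε
        (by positivity) hΘ h₁ h₂ ih
      rw [zsucc (k + 1)]
      nth_rw 2 [zsucc k]
      nth_rw 3 [zsucc k]
      convert this using 4 <;> (rw [pow_succ]; ring)
  have hdu : ∀ t ∈ timeInterval T \ {0}, ∀ k,
      dist ((z k).1 t) ((z (k + 1)).1 t) ≤ (4 * R) * (1 / 2) ^ k := by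
    intro t ht k
    rw [dist_comm, dist_eq_norm]
    linarith [(hdiff k t ht).1]
  have hdv : ∀ t ∈ timeInterval T \ {0}, ∀ k,
      dist ((z k).2 t) ((z (k + 1)).2 t) ≤ (4 * ε / t ^ A.μ) * (1 / 2) ^ k := by
    intro t ht k
    have : 0 < t ^ A.μ := Real.rpow_pos_of_pos (timeInterval_sdiff_pos ht) _
    rw [dist_comm, dist_eq_norm, div_mul_eq_mul_div, le_div_iff₀ this]
    linarith [(hdiff k t ht).2]
  -- Outside the open interval the limit is assigned the value `φ`; this fixes the initial value at
  -- `t = 0`.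
  have hlim : ∀ t, ∃ w : X × P, (t ∈ timeInterval T \ {0} →
      Tendsto (fun k => (z k).1 t) atTop (𝓝 w.1) ∧ Tendsto (fun k => (z k).2 t) atTop (𝓝 w.2)) ∧
      (t ∉ timeInterval T \ {0} → w.1 = φ) := by
    intro t
    by_cases ht : t ∈ timeInterval T \ {0}
    · obtain ⟨x, hx⟩ := cauchySeq_tendsto_of_complete
        (cauchySeq_of_le_geometric _ _ (by norm_num) (hdu t ht))
      obtain ⟨y, hy⟩ := cauchySeq_tendsto_of_complete
        (cauchySeq_of_le_geometric _ _ (by norm_num) (hdv t ht))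
      exact ⟨(x, y), fun _ => ⟨hx, hy⟩, fun h => absurd ht h⟩
    · exact ⟨(φ, 0), fun h => absurd h ht, fun _ => rfl⟩
  choose w hw hw0 using hlim
  set U : ℝ → X := fun t => (w t).1 with hU
  set V : ℝ → P := fun t => (w t).2 with hV
  have hUk : ∀ k, ∀ t ∈ timeInterval T \ {0}, ‖(z k).1 t - U t‖ ≤ 8 * (1 / 2) ^ k * R := by
    intro k t ht
    have := dist_le_of_le_geometric_of_tendsto _ _ (by norm_num) (hdu t ht) (hw t ht).1 k
    rw [dist_eq_norm] at this
    refine this.trans (le_of_eq ?_)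
    ring
  have hVk : ∀ k, ∀ t ∈ timeInterval T \ {0},
      t ^ A.μ * ‖(z k).2 t - V t‖ ≤ 8 * (1 / 2) ^ k * ε := by
    intro k t ht
    have := dist_le_of_le_geometric_of_tendsto _ _ (by norm_num) (hdv t ht) (hw t ht).2 k
    rw [dist_eq_norm] at this
    have h0 : 0 < t ^ A.μ := Real.rpow_pos_of_pos (timeInterval_sdiff_pos ht) _
    refine (mul_le_mul_of_nonneg_left this h0.le).trans (le_of_eq ?_)
    field_simp
    ring
  have hgeom : ∀ c : ℝ, Tendsto (fun k : ℕ => 8 * (1 / 2 : ℝ) ^ k * c) atTop (𝓝 0) := by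
    intro c
    simpa using ((tendsto_pow_atTop_nhds_zero_of_lt_one (r := (1 / 2 : ℝ)) (by norm_num)
      (by norm_num)).const_mul 8).mul_const c
  have hU0 : U 0 = φ := hw0 0 (by simp)
  have huI : TendstoUniformlyOn (fun k => (z k).1) U atTop (timeInterval T) := by
    rw [Metric.tendstoUniformlyOn_iff]
    intro δ hδ
    filter_upwards [(hgeom R).eventually (gt_mem_nhds hδ)] with k hk t ht
    by_cases h0 : t = 0
    · rw [h0, hU0, (hz k).2.2, dist_self]; exact hδ
    · rw [dist_comm, dist_eq_norm]; exact (hUk k t ⟨ht, h0⟩).trans_lt hk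
  -- Convergence in `P` is uniform only after multiplication by the weight, which is divided out
  -- again to get continuity for positive times.
  have hvI : TendstoUniformlyOn (fun k t => t ^ A.μ • (z k).2 t) (fun t => t ^ A.μ • V t) atTop
      (timeInterval T \ {0}) := by
    rw [Metric.tendstoUniformlyOn_iff]
    intro δ hδ
    filter_upwards [(hgeom ε).eventually (gt_mem_nhds hδ)] with k hk t ht
    rw [dist_comm, dist_eq_norm, ← smul_sub, norm_smul, Real.norm_of_nonneg
      (Real.rpow_nonneg (timeInterval_sdiff_pos ht).le _)]
    exact (hVk k t ht).trans_lt hk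
  have hpow : ∀ ν : ℝ, ContinuousOn (fun t : ℝ => t ^ ν) (timeInterval T \ {0}) := fun ν =>
    continuousOn_id.rpow_const fun t ht => Or.inl ht.2
  have hcurve : A.IsCurve T U V := by
    refine ⟨huI.continuousOn (Frequently.of_forall fun k => (hz k).1.cont_u), ?_, ?_, ?_⟩
    · have h1 : ContinuousOn (fun t => t ^ A.μ • V t) (timeInterval T \ {0}) :=
        hvI.continuousOn (Frequently.of_forall fun k => (hpow _).smul (hz k).1.cont_v)
      refine ((hpow (-A.μ)).smul h1).congr fun t ht => ?_
      have ht0 := timeInterval_sdiff_pos ht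
      change V t = t ^ (-A.μ) • t ^ A.μ • V t
      rw [smul_smul, ← Real.rpow_add ht0]
      simp
    · rw [Metric.tendsto_nhds]
      intro δ hδ
      obtain ⟨k, hk⟩ := ((hgeom ε).eventually (gt_mem_nhds (half_pos hδ))).exists
      have hm : ∀ᶠ t in 𝓝[>] (0 : ℝ), t ∈ timeInterval T \ {0} :=
        nhdsWithin_timeInterval_le hT self_mem_nhdsWithin
      filter_upwards [hm, (hz k).1.tendsto_v.eventually (gt_mem_nhds (half_pos hδ))] with t ht hlt
      have h0 := Real.rpow_nonneg (timeInterval_sdiff_pos ht).le A.μ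
      have h1 := mul_le_mul_of_nonneg_left (norm_sub_norm_le (V t) ((z k).2 t)) h0
      rw [norm_sub_rev] at h1
      have h2 := hVk k t ht
      rw [dist_zero_right, Real.norm_of_nonneg (by positivity)]
      linarith
    · intro t ht
      refine A.isClosed_W.mem_of_tendsto ((hw t ht).1.prodMk_nhds (hw t ht).2)
        (Eventually.of_forall fun k => (hz k).1.mem_W t ht)
  have hbdd : A.IsBdd T R ε U V := by
    intro t ht
    refine ⟨le_of_tendsto (hw t ht).1.norm (Eventually.of_forall fun k => ((hz k).2.1 t ht).1),
      le_of_tendsto ((hw t ht).2.norm.const_mul _)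
        (Eventually.of_forall fun k => ((hz k).2.1 t ht).2)⟩
  refine ⟨U, V, hcurve, hU0, ⟨R, ε, hR, hε, hbdd⟩, fun t ht => ?_⟩
  rw [← stepU_of_pos φ (timeInterval_sdiff_pos ht)]
  have a1 : Tendsto (fun k => (z (k + 1)).1 t) atTop (𝓝 (U t)) :=
    (hw t ht).1.comp (tendsto_add_atTop_nat 1)
  refine tendsto_nhds_unique a1 ?_
  rw [tendsto_iff_norm_sub_tendsto_zero]
  refine squeeze_zero (fun _ => norm_nonneg _) (fun k => ?_) (hgeom (R / 2))
  have := ((hz k).1.step_sub_le (φ := φ) hcurve (hz k).2.1 hbdd hR hε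
    (d := 8 * (1 / 2) ^ k) (by positivity) hΘ h₁ h₂ fun τ hτ => ⟨hUk k τ hτ, hVk k τ hτ⟩) t ht
  rw [zsucc]
  refine this.1.trans (le_of_eq ?_)
  ring

end MildSystem

/-- Iterating the implication brings the relative distance from `4` down to `4 / 2^k` for every `k`.
The initial `4` is what two curves bounded by `2R` and `2ε` provide. -/
theorem eq_of_halving {X P : Type*} [NormedAddCommGroup X] [NormedAddCommGroup P]
    {u u' : ℝ → X} {v v' : ℝ → P} {R ε μ : ℝ} {S : Set ℝ} (hS : S ⊆ Ioi 0)
    (h4 : ∀ τ ∈ S, ‖u τ - u' τ‖ ≤ 4 * R ∧ τ ^ μ * ‖v τ - v' τ‖ ≤ 4 * ε)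
    (hstep : ∀ d : ℝ, 0 ≤ d →
      (∀ τ ∈ S, ‖u τ - u' τ‖ ≤ d * R ∧ τ ^ μ * ‖v τ - v' τ‖ ≤ d * ε) →
      (∀ τ ∈ S, ‖u τ - u' τ‖ ≤ d / 2 * R ∧ τ ^ μ * ‖v τ - v' τ‖ ≤ d / 2 * ε)) :
    ∀ τ ∈ S, u τ = u' τ ∧ v τ = v' τ := by
  have key : ∀ k : ℕ, ∀ τ ∈ S, ‖u τ - u' τ‖ ≤ 4 * (1 / 2) ^ k * R ∧
      τ ^ μ * ‖v τ - v' τ‖ ≤ 4 * (1 / 2) ^ k * ε := by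
    intro k
    induction k with
    | zero => simpa using h4
    | succ k ih =>
      have := hstep _ (by positivity) ih
      have e : 4 * (1 / 2 : ℝ) ^ (k + 1) = 4 * (1 / 2) ^ k / 2 := by rw [pow_succ]; ring
      rwa [e]
  have hgeom : ∀ c : ℝ, Tendsto (fun k : ℕ => 4 * (1 / 2 : ℝ) ^ k * c) atTop (𝓝 0) := by
    intro c
    simpa using ((tendsto_pow_atTop_nhds_zero_of_lt_one (r := (1 / 2 : ℝ)) (by norm_num)
      (by norm_num)).const_mul 4).mul_const c
  intro τ hτ
  have a1 := ge_of_tendsto (hgeom R) (Eventually.of_forall fun k => (key k τ hτ).1)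
  have a2 := ge_of_tendsto (hgeom ε) (Eventually.of_forall fun k => (key k τ hτ).2)
  have hp : 0 < τ ^ μ := Real.rpow_pos_of_pos (hS hτ) _
  refine ⟨sub_eq_zero.1 (norm_le_zero_iff.1 a1), sub_eq_zero.1 (norm_le_zero_iff.1 ?_)⟩
  exact nonpos_of_mul_nonpos_right a2 hp

/-! ### Choice of a small radius, and uniqueness -/

namespace MildSystem

variable {X P F₁ F₂ : Type*} [NormedAddCommGroup X] [NormedSpace ℝ X]
  [NormedAddCommGroup P] [NormedSpace ℝ P] [NormedAddCommGroup F₁] [NormedSpace ℝ F₁]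
  [NormedAddCommGroup F₂] [NormedSpace ℝ F₂] {A : MildSystem X P F₁ F₂}
  {T : ℝ≥0∞} {u u' : ℝ → X} {v v' : ℝ → P} {R ε : ℝ} {φ : X}

/-- With `R` fixed, the first expression is of order `ε^{θ₁(b+1)}` and tends to `0`; the second,
divided by `ε`, is of order `ε^{θ₂(b+1)-1}`, a positive power by `lt_θ₂`. -/
theorem exists_small (A : MildSystem X P F₁ F₂) (hR : 0 < R) (Θ : ℝ) {η : ℝ} (hη : 0 < η) :
    ∃ ε, 0 < ε ∧ ε ≤ η ∧ A.K₁ * (R ^ (1 - A.θ₁) * ε ^ A.θ₁) ^ (A.b + 1) * Θ ≤ R / 2 ∧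
      A.K₂ * (R ^ (1 - A.θ₂) * ε ^ A.θ₂) ^ (A.b + 1) * Θ ≤ ε / 2 := by
  have hb := A.b_pos
  have hid : Tendsto (fun ε : ℝ => ε) (𝓝[>] 0) (𝓝 0) := nhdsWithin_le_nhds
  have l1 : Tendsto (fun ε : ℝ => A.K₁ * (R ^ (1 - A.θ₁) * ε ^ A.θ₁) ^ (A.b + 1) * Θ) (𝓝[>] 0)
      (𝓝 (A.K₁ * (R ^ (1 - A.θ₁) * 0 ^ A.θ₁) ^ (A.b + 1) * Θ)) :=
    ((((hid.rpow_const (Or.inr A.N₁_power.θ_pos.le)).const_mul _).rpow_const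
      (Or.inr (by linarith))).const_mul _).mul_const _
  rw [Real.zero_rpow A.N₁_power.θ_pos.ne', mul_zero, Real.zero_rpow (by linarith), mul_zero,
    zero_mul] at l1
  have l2 : Tendsto (fun ε : ℝ => A.K₂ * (R ^ (1 - A.θ₂)) ^ (A.b + 1) * Θ *
      ε ^ (A.θ₂ * (A.b + 1) - 1)) (𝓝[>] 0)
      (𝓝 (A.K₂ * (R ^ (1 - A.θ₂)) ^ (A.b + 1) * Θ * 0 ^ (A.θ₂ * (A.b + 1) - 1))) :=
    (hid.rpow_const (Or.inr (by linarith [A.lt_θ₂]))).const_mul _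
  rw [Real.zero_rpow (by linarith [A.lt_θ₂]), mul_zero] at l2
  obtain ⟨ε, h1, h2, h3⟩ := ((l1.eventually (gt_mem_nhds (half_pos hR))).and
    ((l2.eventually (gt_mem_nhds one_half_pos)).and (Ioo_mem_nhdsGT hη))).exists
  refine ⟨ε, h3.1, h3.2.le, h1.le, ?_⟩
  have e : A.K₂ * (R ^ (1 - A.θ₂) * ε ^ A.θ₂) ^ (A.b + 1) * Θ
      = A.K₂ * (R ^ (1 - A.θ₂)) ^ (A.b + 1) * Θ * ε ^ (A.θ₂ * (A.b + 1) - 1) * ε := by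
    rw [Real.mul_rpow (by positivity) (Real.rpow_nonneg h3.1.le _), ← Real.rpow_mul h3.1.le,
      mul_assoc _ _ ε, ← Real.rpow_add_one h3.1.ne', sub_add_cancel]
    ring
  rw [e]
  have := mul_le_mul_of_nonneg_right h2.le h3.1.le
  linarith

theorem IsBdd.diff_le (hb : A.IsBdd T R ε u v) (hb' : A.IsBdd T R ε u' v') :
    ∀ τ ∈ timeInterval T \ {0}, ‖u τ - u' τ‖ ≤ 4 * R ∧ τ ^ A.μ * ‖v τ - v' τ‖ ≤ 4 * ε := by
  intro τ hτ
  have := norm_sub_le (u τ) (u' τ)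
  have c := mul_le_mul_of_nonneg_left (norm_sub_le (v τ) (v' τ))
    (Real.rpow_nonneg (timeInterval_sdiff_pos hτ).le A.μ)
  have := hb τ hτ
  have := hb' τ hτ
  constructor <;> linarith

theorem IsBdd.mono_bound {R' ε' : ℝ} (hb : A.IsBdd T R ε u v) (hR : R ≤ R') (hε : ε ≤ ε') :
    A.IsBdd T R' ε' u v :=
  fun t ht => ⟨(hb t ht).1.trans (by linarith), (hb t ht).2.trans (by linarith)⟩

theorem IsBdd.mono {T' : ℝ≥0∞} (hb : A.IsBdd T R ε u v) (hT : T' ≤ T) : A.IsBdd T' R ε u v :=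
  fun t ht => hb t ⟨timeInterval_mono hT ht.1, ht.2⟩

/-- Only the equation in `X` is required of a solution. Both `v t` and the right-hand side in `P`
are partners of the same `u t` in `W`, hence equal. -/
theorem IsSolution.eq_v [CompleteSpace X] [CompleteSpace P] (h : A.IsSolution φ T u v) {t : ℝ}
    (ht : t ∈ timeInterval T \ {0}) : v t = A.SP t φ + A.J₂ u v t := by
  obtain ⟨R, ε, hR, hε, hb⟩ := h.bdd
  have h1 := A.W.add_mem (A.S_mem t (timeInterval_sdiff_pos ht) φ) (h.J_mem hb hR hε ht)
  rw [Prod.mk_add_mk, ← h.eq t ht] at h1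
  exact eq_of_mem_W (h.mem_W t ht) h1

theorem IsSolution.mono {T' : ℝ≥0∞} (h : A.IsSolution φ T u v) (hT : T' ≤ T) :
    A.IsSolution φ T' u v where
  toIsCurve := h.toIsCurve.mono hT
  init := h.init
  bdd := by
    obtain ⟨R, ε, hR, hε, hb⟩ := h.bdd
    exact ⟨R, ε, hR, hε, hb.mono hT⟩
  eq t ht := h.eq t ⟨timeInterval_mono hT ht.1, ht.2⟩

/-- The bounds on `t^μ ‖v‖` and `t^μ ‖v'‖` given by `bdd` may be large, but both quantities tend to
`0`. On a short interval they fall below `2ε` for the small `ε` at which the map contracts. -/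
theorem IsSolution.eq_near_zero [CompleteSpace X] [CompleteSpace P] (h : A.IsSolution φ T u v)
    (h' : A.IsSolution φ T u' v') (hT : 0 < T) :
    ∃ δ : ℝ, 0 < δ ∧ ∀ τ ∈ Ioc 0 δ, τ ∈ timeInterval T ∧ u τ = u' τ ∧ v τ = v' τ := by
  obtain ⟨R₁, ε₁, hR₁, hε₁, hb₁⟩ := h.bdd
  obtain ⟨R₂, ε₂, hR₂, hε₂, hb₂⟩ := h'.bdd
  set R := max R₁ R₂ + 1 with hR
  have hR0 : 0 < R := by positivity
  obtain ⟨ε, hε, -, hs₁, hs₂⟩ := A.exists_small hR0 1 one_pos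
  obtain ⟨δ₀, hδ₀, hsub⟩ := exists_Ioo_subset_timeInterval hT
  obtain ⟨δ₁, hδ₁, hsub₁⟩ := mem_nhdsGT_iff_exists_Ioo_subset.1
    ((h.tendsto_v.eventually (gt_mem_nhds (by positivity : 0 < 2 * ε))).and
      (h'.tendsto_v.eventually (gt_mem_nhds (by positivity : 0 < 2 * ε))))
  -- The bound by `1` ensures `t^ω ≤ 1`, so `Θ = 1` is admissible.
  set δ := min (min δ₀ δ₁) 1 with hδ
  have hδ0 : 0 < δ := lt_min (lt_min hδ₀ hδ₁) one_pos
  set T' := ENNReal.ofReal δ with hT'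
  have hmem : ∀ t, t ∈ timeInterval T' \ {0} ↔ t ∈ Ioo 0 δ := by
    intro t
    constructor
    · intro ht
      exact ⟨timeInterval_sdiff_pos ht, (ENNReal.ofReal_lt_ofReal_iff hδ0).1 ht.1.2⟩
    · intro ht
      exact ⟨⟨ht.1.le, (ENNReal.ofReal_lt_ofReal_iff hδ0).2 ht.2⟩, ht.1.ne'⟩
  have hTT : T' ≤ T := by
    refine le_of_not_gt fun hlt => ?_
    obtain ⟨s, hs0, hs1⟩ := ENNReal.lt_iff_exists_real_btwn.1 hlt
    have h1 : s < δ := (ENNReal.ofReal_lt_ofReal_iff hδ0).1 hs1.2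
    have h2 : 0 ≤ s := by
      by_contra hn
      rw [ENNReal.ofReal_of_nonpos (by linarith)] at hs1
      exact absurd hs1.1 (by simp)
    exact absurd (hsub ⟨h2, h1.trans_le ((min_le_left _ _).trans (min_le_left _ _))⟩).2
      (not_lt.2 hs1.1.le)
  have hB : A.IsBdd T' R ε u v ∧ A.IsBdd T' R ε u' v' := by
    constructor <;> intro t ht <;>
    have ht' := (hmem t).1 ht <;>
    have h3 := hsub₁ ⟨ht'.1, ht'.2.trans_le ((min_le_left _ _).trans (min_le_right _ _))⟩ <;>
    have htT : t ∈ timeInterval T \ {0} := ⟨timeInterval_mono hTT ht.1, ht.2⟩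
    · refine ⟨(hb₁ t htT).1.trans ?_, h3.1.le⟩
      linarith [le_max_left R₁ R₂]
    · refine ⟨(hb₂ t htT).1.trans ?_, h3.2.le⟩
      linarith [le_max_right R₁ R₂]
  have hg := h.mono hTT
  have hg' := h'.mono hTT
  have key : ∀ τ ∈ timeInterval T' \ {0}, u τ = u' τ ∧ v τ = v' τ := by
    refine eq_of_halving (fun t ht => timeInterval_sdiff_pos ht) (hB.1.diff_le hB.2)
      fun d hd hdd τ hτ => ?_
    have h5 := hg.step_sub_le (φ := φ) (Θ := 1) hg'.toIsCurve hB.1 hB.2 hR0.le hε.le hd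
      (fun t ht => Real.rpow_le_one (timeInterval_sdiff_pos ht).le
        (((hmem t).1 ht).2.le.trans (min_le_right _ _)) A.ω_nonneg) hs₁ hs₂ hdd τ hτ
    rwa [stepU_of_pos φ (timeInterval_sdiff_pos hτ), stepU_of_pos φ (timeInterval_sdiff_pos hτ),
      ← hg.eq τ hτ, ← hg'.eq τ hτ, stepV, stepV, ← hg.eq_v hτ, ← hg'.eq_v hτ] at h5
  refine ⟨δ / 2, by positivity, fun τ hτ => ?_⟩
  have hτ' : τ ∈ timeInterval T' \ {0} := (hmem τ).2 ⟨hτ.1, by linarith [hτ.2]⟩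
  exact ⟨timeInterval_mono hTT hτ'.1, key τ hτ'⟩

theorem exists_pos_rpow_le (L : ℝ) {κ η : ℝ} (hκ : 0 < κ) (hη : 0 < η) :
    ∀ᶠ h in 𝓝[>] (0 : ℝ), L * h ^ κ ≤ η := by
  have hid : Tendsto (fun ε : ℝ => ε) (𝓝[>] 0) (𝓝 0) := nhdsWithin_le_nhds
  have l := (hid.rpow_const (p := κ) (Or.inr hκ.le)).const_mul L
  rw [Real.zero_rpow hκ.ne', mul_zero] at l
  filter_upwards [l.eventually (gt_mem_nhds hη)] with h hh using hh.le

/-- Beyond `t₀` the weight `τ^{-β}` is at most `t₀^{-β}`, so large radii do no harm: the difference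
of the Duhamel terms starts at `s` and carries the factor `(t - s)^{1-γ}`. The step length `η`
depends on the bounds, `t₀` and `T₁`, but not on `s`. -/
theorem IsSolution.exists_step [CompleteSpace X] [CompleteSpace P] (h : A.IsSolution φ T u v)
    (h' : A.IsSolution φ T u' v') {t₀ T₁ : ℝ} (ht₀ : 0 < t₀) (hT₁ : T₁ ∈ timeInterval T \ {0}) :
    ∃ η : ℝ, 0 < η ∧ ∀ s, t₀ ≤ s → s ≤ T₁ → (∀ τ ∈ Ioc 0 s, u τ = u' τ ∧ v τ = v' τ) →
      ∀ τ ∈ Ioc 0 (min (s + η) T₁), u τ = u' τ ∧ v τ = v' τ := by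
  obtain ⟨R₁, ε₁, hR₁, hε₁, hb₁⟩ := h.bdd
  obtain ⟨R₂, ε₂, hR₂, hε₂, hb₂⟩ := h'.bdd
  set R := max R₁ R₂ + 1 with hR
  set ε := max ε₁ ε₂ + 1 with hε
  have hR0 : 0 < R := by positivity
  have hε0 : 0 < ε := by positivity
  have hb : A.IsBdd T R ε u v := hb₁.mono_bound (by linarith [le_max_left R₁ R₂])
    (by linarith [le_max_left ε₁ ε₂])
  have hb' : A.IsBdd T R ε u' v' := hb₂.mono_bound (by linarith [le_max_right R₁ R₂])
    (by linarith [le_max_right ε₁ ε₂])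
  have hbp := A.b_pos
  have hμ := A.μ_pos
  have hθ₁ := A.N₁_power.θ_pos
  have hθ₂ := A.N₂_power.θ_pos
  have hc₁ := A.N₁_power.nonneg
  have hc₂ := A.N₂_power.nonneg
  have hT0 : 0 < T₁ := timeInterval_sdiff_pos hT₁
  set β₁ := A.μ * A.θ₁ * (A.b + 1) with hβ₁
  set β₂ := A.μ * A.θ₂ * (A.b + 1) with hβ₂
  set Q₁ := A.c₁ * 4 ^ A.b * (R ^ (1 - A.θ₁) * ε ^ A.θ₁) ^ (A.b + 1) with hQ₁
  set Q₂ := A.c₂ * 4 ^ A.b * (R ^ (1 - A.θ₂) * ε ^ A.θ₂) ^ (A.b + 1) with hQ₂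
  have hQ₁0 : 0 ≤ Q₁ := by positivity
  have hQ₂0 : 0 ≤ Q₂ := by positivity
  have g₁ : 0 < 1 - A.γ₁ := by linarith [A.γ₁_lt]
  have g₂ : 0 < 1 - A.γ₂ := by linarith [A.γ₂_lt]
  -- The step is so short that the difference map halves `d`; in the weighted estimate `t^μ` is
  -- simply replaced by `T₁^μ`.
  obtain ⟨η, hη₁, hη₂, hη⟩ := ((exists_pos_rpow_le (A.C₁ * (Q₁ * t₀ ^ (-β₁)) / (1 - A.γ₁)) g₁
    (half_pos hR0)).and ((exists_pos_rpow_le (T₁ ^ A.μ * (A.C₂ * (Q₂ * t₀ ^ (-β₂)) / (1 - A.γ₂))) g₂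
    (half_pos hε0)).and self_mem_nhdsWithin)).exists
  have hη : 0 < η := hη
  refine ⟨η, hη, fun s hs hsT heq => ?_⟩
  have hs0 : 0 < s := ht₀.trans_le hs
  have hsub : Ioc 0 T₁ ⊆ timeInterval T \ {0} := timeInterval_sdiff_Ioc_subset hT₁
  have key : ∀ τ ∈ Ioc s (min (s + η) T₁), u τ = u' τ ∧ v τ = v' τ := by
    refine eq_of_halving (R := R) (ε := ε) (μ := A.μ) (fun t ht => hs0.trans ht.1)
      (fun τ hτ => hb.diff_le hb' τ (hsub ⟨hs0.trans hτ.1, hτ.2.trans (min_le_right _ _)⟩))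
      fun d hd hdd t ht => ?_
    have htT : t ≤ T₁ := ht.2.trans (min_le_right _ _)
    have htη : t - s ≤ η := by linarith [ht.2.trans (min_le_left _ _)]
    have ht0 : 0 < t := hs0.trans ht.1
    have htI := hsub ⟨ht0, htT⟩
    have hNle : ∀ {β Q d τ : ℝ}, 0 ≤ β → 0 ≤ Q → 0 ≤ d → s < τ →
        Q * d * τ ^ (-β) ≤ Q * t₀ ^ (-β) * d := by
      intro β Q d τ hβ hQ hd hτ
      have : τ ^ (-β) ≤ t₀ ^ (-β) :=
        Real.rpow_le_rpow_of_nonpos ht₀ (hs.trans hτ.le) (by linarith)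
      calc _ ≤ Q * d * t₀ ^ (-β) := mul_le_mul_of_nonneg_left this (by positivity)
        _ = _ := by ring
    have hτI : ∀ τ ∈ Ioo s t, τ ∈ timeInterval T \ {0} := fun τ hτ =>
      hsub ⟨hs0.trans hτ.1, hτ.2.le.trans htT⟩
    have hτd : ∀ τ ∈ Ioo s t, ‖u τ - u' τ‖ ≤ d * R ∧ τ ^ A.μ * ‖v τ - v' τ‖ ≤ d * ε :=
      fun τ hτ => hdd τ ⟨hτ.1, hτ.2.le.trans ht.2⟩
    have e₁ := A.D₁_smoothing.norm_duhamel_le_of_eq_zero A.γ₁_lt hs0.le ht.1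
      (G := fun τ => A.N₁ (u τ, v τ) - A.N₁ (u' τ, v' τ)) (H := Q₁ * t₀ ^ (-β₁) * d)
      (fun τ hτ => by simp [heq τ hτ]) (fun τ hτ =>
        (A.N₁_power.norm_sub_le_mul (hs0.trans hτ.1) (h.mem_W τ (hτI τ hτ))
        (h'.mem_W τ (hτI τ hτ)) hd hR0.le hε0.le (hb τ (hτI τ hτ)).1 (hb τ (hτI τ hτ)).2
        (hb' τ (hτI τ hτ)).1 (hb' τ (hτI τ hτ)).2 (hτd τ hτ).1 (hτd τ hτ).2).trans
        (hNle (by positivity) hQ₁0 hd hτ.1))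
    have e₂ := A.D₂_smoothing.norm_duhamel_le_of_eq_zero A.γ₂_lt hs0.le ht.1
      (G := fun τ => A.N₂ (u τ, v τ) - A.N₂ (u' τ, v' τ)) (H := Q₂ * t₀ ^ (-β₂) * d)
      (fun τ hτ => by simp [heq τ hτ]) (fun τ hτ =>
        (A.N₂_power.norm_sub_le_mul (hs0.trans hτ.1) (h.mem_W τ (hτI τ hτ))
        (h'.mem_W τ (hτI τ hτ)) hd hR0.le hε0.le (hb τ (hτI τ hτ)).1 (hb τ (hτI τ hτ)).2
        (hb' τ (hτI τ hτ)).1 (hb' τ (hτI τ hτ)).2 (hτd τ hτ).1 (hτd τ hτ).2).trans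
        (hNle (by positivity) hQ₂0 hd hτ.1))
    rw [← h.J₁_sub h'.toIsCurve hb hb' hR0.le hε0.le htI] at e₁
    rw [← h.J₂_sub h'.toIsCurve hb hb' hR0.le hε0.le htI] at e₂
    have hC₁ := A.D₁_smoothing.nonneg
    have hC₂ := A.D₂_smoothing.nonneg
    have hts : 0 ≤ t - s := by linarith [ht.1]
    constructor
    · rw [h.eq t htI, h'.eq t htI, add_sub_add_left_eq_sub]
      calc _ ≤ A.C₁ * (Q₁ * t₀ ^ (-β₁) * d) * ((t - s) ^ (1 - A.γ₁) / (1 - A.γ₁)) := e₁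
        _ ≤ A.C₁ * (Q₁ * t₀ ^ (-β₁) * d) * (η ^ (1 - A.γ₁) / (1 - A.γ₁)) := by gcongr
        _ = d * (A.C₁ * (Q₁ * t₀ ^ (-β₁)) / (1 - A.γ₁) * η ^ (1 - A.γ₁)) := by ring
        _ ≤ d * (R / 2) := mul_le_mul_of_nonneg_left hη₁ hd
        _ = _ := by ring
    · rw [h.eq_v htI, h'.eq_v htI, add_sub_add_left_eq_sub]
      calc _ ≤ T₁ ^ A.μ *
            (A.C₂ * (Q₂ * t₀ ^ (-β₂) * d) * ((t - s) ^ (1 - A.γ₂) / (1 - A.γ₂))) := by gcongr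
        _ ≤ T₁ ^ A.μ * (A.C₂ * (Q₂ * t₀ ^ (-β₂) * d) * (η ^ (1 - A.γ₂) / (1 - A.γ₂))) := by gcongr
        _ = d * (T₁ ^ A.μ * (A.C₂ * (Q₂ * t₀ ^ (-β₂)) / (1 - A.γ₂)) * η ^ (1 - A.γ₂)) := by ring
        _ ≤ d * (ε / 2) := mul_le_mul_of_nonneg_left hη₂ hd
        _ = _ := by ring
  intro τ hτ
  by_cases hτs : τ ≤ s
  · exact heq τ ⟨hτ.1, hτs⟩
  · exact key τ ⟨not_le.1 hτs, hτ.2⟩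

/-- Agreement near `0` provides a start, and finitely many steps of the fixed length `η` reach any
given time. -/
theorem IsSolution.unique [CompleteSpace X] [CompleteSpace P] (h : A.IsSolution φ T u v)
    (h' : A.IsSolution φ T u' v') : EqOn u u' (timeInterval T) := by
  intro t ht
  by_cases h0 : t = 0
  · rw [h0, h.init, h'.init]
  have hT : 0 < T := lt_of_le_of_lt zero_le ht.2
  have htI : t ∈ timeInterval T \ {0} := ⟨ht, h0⟩
  have htp := timeInterval_sdiff_pos htI
  obtain ⟨δ, hδ, hδ'⟩ := h.eq_near_zero h' hT
  obtain ⟨η, hη, hstep⟩ := h.exists_step h' (t₀ := min δ t) (lt_min hδ htp) htI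
  have key : ∀ k : ℕ, ∀ τ ∈ Ioc 0 (min (min δ t + k * η) t), u τ = u' τ ∧ v τ = v' τ := by
    intro k
    induction k with
    | zero =>
      intro τ hτ
      refine (hδ' τ ⟨hτ.1, hτ.2.trans ?_⟩).2
      simp
    | succ k ih =>
      have hk : 0 ≤ (k : ℝ) * η := by positivity
      have := hstep _ (le_min (by linarith) (min_le_right _ _)) (min_le_right _ _) ih
      intro τ hτ
      refine this τ ⟨hτ.1, hτ.2.trans ?_⟩
      refine le_min ?_ (min_le_right _ _)
      rw [← min_add_add_right (min δ t + k * η)]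
      refine le_min ((min_le_left _ _).trans (le_of_eq ?_))
        ((min_le_right _ _).trans (by linarith))
      push_cast; ring
  obtain ⟨k, hk⟩ := exists_nat_ge (t / η)
  refine (key k t ⟨htp, le_min ?_ le_rfl⟩).1
  rw [div_le_iff₀ hη] at hk
  have : 0 < min δ t := lt_min hδ htp
  linarith

end MildSystem

theorem add_mem_timeInterval {T : ℝ≥0∞} {s t : ℝ} (hs : 0 ≤ s) (ht : 0 ≤ t) :
    s + t ∈ timeInterval T ↔ t ∈ timeInterval (T - ENNReal.ofReal s) := by
  simp only [timeInterval, mem_ofPred_eq, ht, add_nonneg hs ht, true_and,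
    ENNReal.ofReal_add hs ht]
  exact lt_tsub_iff_left.symm

/-! ### Restarting and gluing solutions -/

namespace MildSystem

variable {X P F₁ F₂ : Type*} [NormedAddCommGroup X] [NormedSpace ℝ X]
  [NormedAddCommGroup P] [NormedSpace ℝ P] [NormedAddCommGroup F₁] [NormedSpace ℝ F₁]
  [NormedAddCommGroup F₂] [NormedSpace ℝ F₂] {A : MildSystem X P F₁ F₂}
  {T : ℝ≥0∞} {u u' : ℝ → X} {v v' : ℝ → P} {R ε : ℝ} {φ : X}

theorem J₁_congr {t : ℝ} (ht : 0 ≤ t) (hu : ∀ τ ∈ Ioo 0 t, u τ = u' τ)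
    (hv : ∀ τ ∈ Ioo 0 t, v τ = v' τ) : A.J₁ u v t = A.J₁ u' v' t := by
  rw [J₁, J₁, duhamel, duhamel, intervalIntegral.integral_of_le ht,
    intervalIntegral.integral_of_le ht, integral_Ioc_eq_integral_Ioo,
    integral_Ioc_eq_integral_Ioo]
  refine setIntegral_congr_fun measurableSet_Ioo fun τ hτ => ?_
  simp only [hu τ hτ, hv τ hτ]

/-- Split the integral at `s`. Before `s` the law `D₁ (t + (s - τ)) = S t ∘ D₁ (s - τ)` takes `S t`
out of the integral; after `s`, translate. -/
theorem IsCurve.J₁_add [CompleteSpace X] (h : A.IsCurve T u v) (hb : A.IsBdd T R ε u v)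
    (hR : 0 ≤ R) (hε : 0 ≤ ε) {s t : ℝ} (hs : 0 < s) (ht : 0 < t)
    (hst : s + t ∈ timeInterval T \ {0}) :
    A.J₁ u v (s + t)
      = A.S t (A.J₁ u v s) + A.J₁ (fun τ => u (s + τ)) (fun τ => v (s + τ)) t := by
  have hsI : s ∈ timeInterval T \ {0} :=
    timeInterval_sdiff_Ioc_subset hst ⟨hs, by linarith⟩
  have i0 := h.integrable₁ hb hR hε hst
  have is := h.integrable₁ hb hR hε hsI
  have hsub : uIcc 0 s ⊆ uIcc 0 (s + t) := by
    rw [uIcc_of_le hs.le, uIcc_of_le (by linarith)]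
    exact Icc_subset_Icc_right (by linarith)
  have hsub' : uIcc s (s + t) ⊆ uIcc 0 (s + t) := by
    rw [uIcc_of_le (by linarith), uIcc_of_le (by linarith)]
    exact Icc_subset_Icc_left hs.le
  have e := intervalIntegral.integral_add_adjacent_intervals (i0.mono_set hsub)
    (i0.mono_set hsub')
  rw [J₁, duhamel, ← e]
  congr 1
  · rw [J₁, duhamel, ← ContinuousLinearMap.intervalIntegral_comp_comm _ is,
      intervalIntegral.integral_of_le hs.le, intervalIntegral.integral_of_le hs.le,
      integral_Ioc_eq_integral_Ioo, integral_Ioc_eq_integral_Ioo]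
    refine setIntegral_congr_fun measurableSet_Ioo fun τ hτ => ?_
    have : s + t - τ = t + (s - τ) := by ring
    simp only [this]
    exact A.D_add t (s - τ) ht (sub_pos.2 hτ.2) _
  · have := intervalIntegral.integral_comp_add_left (a := 0) (b := t)
      (fun τ => A.D₁ (s + t - τ) (A.N₁ (u τ, v τ))) s
    rw [add_zero] at this
    rw [J₁, duhamel, ← this]
    refine intervalIntegral.integral_congr fun τ _ => ?_
    simp only [add_sub_add_left_eq_sub]

/-- After a restart at `s > 0` the weighted norm vanishes at the new origin because `v` is
continuous at `s`. -/
theorem IsSolution.shift [CompleteSpace X] (h : A.IsSolution φ T u v) {s : ℝ} (hs : 0 < s)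
    (hsT : s ∈ timeInterval T) :
    A.IsSolution (u s) (T - ENNReal.ofReal s) (fun t => u (s + t)) (fun t => v (s + t)) := by
  obtain ⟨R, ε, hR, hε, hb⟩ := h.bdd
  have hI : ∀ t ∈ timeInterval (T - ENNReal.ofReal s), s + t ∈ timeInterval T \ {0} := by
    intro t ht
    refine ⟨(add_mem_timeInterval hs.le ht.1).2 ht, ?_⟩
    have := ht.1
    exact ne_of_gt (by linarith)
  have hsI : s ∈ timeInterval T \ {0} := ⟨hsT, hs.ne'⟩
  have hca : Continuous fun t : ℝ => s + t := by fun_prop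
  have hvs : Tendsto (fun t => v (s + t)) (𝓝[>] 0) (𝓝 (v s)) := by
    have h1 : ContinuousAt v s := h.cont_v.continuousAt ((isOpen_timeInterval_sdiff T).mem_nhds hsI)
    have h2 : Tendsto (fun t : ℝ => s + t) (𝓝[>] 0) (𝓝 s) := by
      have := (hca.tendsto 0).mono_left (nhdsWithin_le_nhds (s := Ioi 0))
      simpa using this
    exact h1.tendsto.comp h2
  refine ⟨⟨?_, ?_, ?_, ?_⟩, by simp, ?_, ?_⟩
  · exact h.cont_u.comp hca.continuousOn fun t ht => (hI t ht).1
  · exact h.cont_v.comp hca.continuousOn fun t ht => hI t ht.1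
  · have h1 : Tendsto (fun t : ℝ => t ^ A.μ) (𝓝[>] 0) (𝓝 (0 ^ A.μ)) :=
      (tendsto_id.mono_left nhdsWithin_le_nhds).rpow_const (Or.inr A.μ_pos.le)
    rw [Real.zero_rpow A.μ_pos.ne'] at h1
    simpa using h1.mul hvs.norm
  · exact fun t ht => h.mem_W _ (hI t ht.1)
  · refine ⟨R, ε, hR, hε, fun t ht => ⟨(hb _ (hI t ht.1)).1, ?_⟩⟩
    refine le_trans (mul_le_mul_of_nonneg_right ?_ (norm_nonneg _)) (hb _ (hI t ht.1)).2
    exact Real.rpow_le_rpow ht.1.1 (by linarith) A.μ_pos.le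
  · intro t ht
    have ht0 := timeInterval_sdiff_pos ht
    rw [h.eq _ (hI t ht.1), h.toIsCurve.J₁_add hb hR hε hs ht0 (hI t ht.1), h.eq s hsI, map_add,
      add_comm s t, A.S_add t s ht0 hs]
    abel

theorem IsSolution.congr (h : A.IsSolution φ T u v) (hT : 0 < T)
    (hu : EqOn u' u (timeInterval T)) : A.IsSolution φ T u' v where
  cont_u := h.cont_u.congr hu
  cont_v := h.cont_v
  tendsto_v := h.tendsto_v
  mem_W t ht := by rw [hu ht.1]; exact h.mem_W t ht
  init := by rw [hu (zero_mem_timeInterval hT)]; exact h.init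
  bdd := by
    obtain ⟨R, ε, hR, hε, hb⟩ := h.bdd
    exact ⟨R, ε, hR, hε, fun t ht => by rw [hu ht.1]; exact hb t ht⟩
  eq t ht := by
    rw [hu ht.1, h.eq t ht]
    congr 1
    refine J₁_congr (timeInterval_sdiff_pos ht).le (fun τ hτ => (hu ?_).symm) fun _ _ => rfl
    exact (timeInterval_sdiff_Ioc_subset ht ⟨hτ.1, hτ.2.le⟩).1

theorem IsSolution.unique_v [CompleteSpace X] [CompleteSpace P] (h : A.IsSolution φ T u v)
    (h' : A.IsSolution φ T u' v') : EqOn v v' (timeInterval T \ {0}) := by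
  intro t ht
  have h1 := h.mem_W t ht
  rw [h.unique h' ht.1] at h1
  exact eq_of_mem_W h1 (h'.mem_W t ht)

/-- Continuity at the junction `s` comes from uniqueness: on the overlap the restarted solution
coincides with the translate of the old one, so near `s` the glued curve is just `u`. -/
theorem IsSolution.glue [CompleteSpace X] [CompleteSpace P] (h : A.IsSolution φ T u v) {s : ℝ}
    (hs : 0 < s) (hsT : s ∈ timeInterval T) {T' : ℝ≥0∞} (hT' : 0 < T')
    (h' : A.IsSolution (u s) T' u' v') :
    ∃ w z, A.IsSolution φ (ENNReal.ofReal s + T') w z := by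
  obtain ⟨R₁, ε₁, hR₁, hε₁, hb₁⟩ := h.bdd
  obtain ⟨R₂, ε₂, hR₂, hε₂, hb₂⟩ := h'.bdd
  set T₂ := ENNReal.ofReal s + T' with hT₂
  have hsI : s ∈ timeInterval T \ {0} := ⟨hsT, hs.ne'⟩
  have hsub : T₂ - ENNReal.ofReal s = T' := by
    rw [hT₂, ENNReal.add_sub_cancel_left ENNReal.ofReal_ne_top]
  have hmem' : ∀ t ∈ timeInterval T₂, s < t → t - s ∈ timeInterval T' \ {0} := by
    intro t ht hst
    have h1 := (add_mem_timeInterval (T := T₂) (t := t - s) hs.le (by linarith)).1 (by simpa using ht)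
    rw [hsub] at h1
    exact ⟨h1, (sub_pos.2 hst).ne'⟩
  set w : ℝ → X := fun t => if t ≤ s then u t else u' (t - s) with hw
  set z : ℝ → P := fun t => if t ≤ s then v t else v' (t - s) with hz
  -- On the common interval of existence the glued curve is the old solution, also after `s`.
  have hlo : ∀ t ∈ timeInterval T ∩ timeInterval T₂, w t = u t ∧ (t ≠ 0 → z t = v t) := by
    intro t ht
    by_cases hts : t ≤ s
    · simp [hw, hz, hts]
    · have hts' := not_le.1 hts
      have hm : t - s ∈ timeInterval (min (T - ENNReal.ofReal s) T') \ {0} := by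
        refine ⟨⟨by linarith, lt_min ?_ (hmem' t ht.2 hts').1.2⟩, (sub_pos.2 hts').ne'⟩
        exact ((add_mem_timeInterval hs.le (by linarith)).1 (by simpa using ht.1)).2
      have a := (h.shift hs hsT).mono (min_le_left _ T')
      have b := h'.mono (min_le_right (T - ENNReal.ofReal s) T')
      have c := a.unique b hm.1
      have d := a.unique_v b hm
      simp only [add_sub_cancel] at c d
      simp [hw, hz, hts, c, d]
  have hhi : ∀ t, s < t → w t = u' (t - s) ∧ z t = v' (t - s) := by
    intro t ht
    simp [hw, hz, not_le.2 ht]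
  have hsT₂ : s ∈ timeInterval T₂ := ⟨hs.le, ENNReal.lt_add_right ENNReal.ofReal_ne_top hT'.ne'⟩
  have hle : ∀ t ∈ timeInterval T₂ \ {0}, t ≤ s → t ∈ timeInterval T \ {0} := fun t ht hts =>
    timeInterval_sdiff_Ioc_subset hsI ⟨timeInterval_sdiff_pos ht, hts⟩
  have hloc : ∀ t ∈ timeInterval T₂ \ {0}, t ≤ s →
      ∀ᶠ x in 𝓝 t, x ∈ (timeInterval T ∩ timeInterval T₂) \ {0} := by
    intro t ht hts
    filter_upwards [(isOpen_timeInterval_sdiff T).mem_nhds (hle t ht hts),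
      (isOpen_timeInterval_sdiff T₂).mem_nhds ht] with x h1 h2 using ⟨⟨h1.1, h2.1⟩, h1.2⟩
  have hT₂0 : 0 < T₂ := lt_of_lt_of_le hT' le_add_self
  have h0s : ∀ᶠ t in 𝓝[>] (0 : ℝ), t ≤ s := by
    filter_upwards [Ioo_mem_nhdsGT hs] with t ht using ht.2.le
  have hT0 : 0 < T := lt_of_le_of_lt zero_le hsT.2
  have hcurve : A.IsCurve T₂ w z := by
    refine ⟨(continuousOn_timeInterval_iff hT₂0).2 ⟨?_, ?_⟩, ?_, ?_, ?_⟩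
    · intro t ht
      refine ContinuousAt.continuousWithinAt ?_
      by_cases hts : t ≤ s
      · have h1 : ContinuousAt u t := (h.cont_u.mono sdiff_subset).continuousAt
          ((isOpen_timeInterval_sdiff T).mem_nhds (hle t ht hts))
        refine h1.congr ?_
        filter_upwards [hloc t ht hts] with x hx using (hlo x hx.1).1.symm
      · have hts' := not_le.1 hts
        have h1 : ContinuousAt u' (t - s) := (h'.cont_u.mono sdiff_subset).continuousAt
          ((isOpen_timeInterval_sdiff T').mem_nhds (hmem' t ht.1 hts'))
        have h2 : ContinuousAt (fun x => u' (x - s)) t :=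
          h1.comp (f := fun x => x - s) (by fun_prop)
        refine h2.congr ?_
        filter_upwards [Ioi_mem_nhds hts'] with x hx using (hhi x hx).1.symm
    · have h1 := ((continuousOn_timeInterval_iff hT0).1 h.cont_u).2
      have : w 0 = u 0 := by simp [hw, hs.le]
      rw [this]
      refine h1.congr' ?_
      filter_upwards [h0s] with t ht
      simp [hw, ht]
    · intro t ht
      refine ContinuousAt.continuousWithinAt ?_
      by_cases hts : t ≤ s
      · have h1 : ContinuousAt v t := h.cont_v.continuousAt
          ((isOpen_timeInterval_sdiff T).mem_nhds (hle t ht hts))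
        refine h1.congr ?_
        filter_upwards [hloc t ht hts] with x hx using ((hlo x hx.1).2 hx.2).symm
      · have hts' := not_le.1 hts
        have h1 : ContinuousAt v' (t - s) := h'.cont_v.continuousAt
          ((isOpen_timeInterval_sdiff T').mem_nhds (hmem' t ht.1 hts'))
        have h2 : ContinuousAt (fun x => v' (x - s)) t :=
          h1.comp (f := fun x => x - s) (by fun_prop)
        refine h2.congr ?_
        filter_upwards [Ioi_mem_nhds hts'] with x hx using (hhi x hx).2.symm
    · refine h.tendsto_v.congr' ?_
      filter_upwards [h0s] with t ht
      simp [hz, ht]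
    · intro t ht
      by_cases hts : t ≤ s
      · simpa [hw, hz, hts] using h.mem_W t (hle t ht hts)
      · simpa [hw, hz, hts] using h'.mem_W (t - s) (hmem' t ht.1 (not_le.1 hts))
  -- The bound for `v'` has the weight `(t - s)^μ`, which is too weak near `s`. On `[s, s + δ]`
  -- compactness is used instead, and beyond it `t ≤ (s/δ + 1)(t - s)` compares the weights.
  obtain ⟨B, hB⟩ : ∃ B : ℝ, ∀ t ∈ timeInterval T₂ \ {0}, s < t → t ^ A.μ * ‖z t‖ ≤ B := by
    obtain ⟨δ, hδ, hsubδ⟩ : ∃ δ : ℝ, 0 < δ ∧ Icc s (s + δ) ⊆ timeInterval T₂ \ {0} := by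
      obtain ⟨δ, hδ, h1⟩ := Metric.isOpen_iff.1 (isOpen_timeInterval_sdiff T₂) s ⟨hsT₂, hs.ne'⟩
      refine ⟨δ / 2, by positivity, fun x hx => h1 ?_⟩
      rw [Metric.mem_ball, Real.dist_eq, abs_of_nonneg (by linarith [hx.1])]
      linarith [hx.2]
    obtain ⟨B₀, hB₀⟩ := (isCompact_Icc (a := s) (b := s + δ)).exists_bound_of_continuousOn
      (hcurve.cont_v.mono hsubδ)
    refine ⟨max ((s + δ) ^ A.μ * B₀) ((s / δ + 1) ^ A.μ * (2 * ε₂)), fun t ht hst => ?_⟩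
    have ht0 := timeInterval_sdiff_pos ht
    by_cases h2 : t ≤ s + δ
    · refine le_max_of_le_left ?_
      have := hB₀ t ⟨hst.le, h2⟩
      have hB0 : 0 ≤ B₀ := (norm_nonneg _).trans this
      exact mul_le_mul (Real.rpow_le_rpow ht0.le h2 A.μ_pos.le) this (norm_nonneg _)
        (by positivity)
    · refine le_max_of_le_right ?_
      have h3 := (hb₂ _ (hmem' t ht.1 hst)).2
      rw [(hhi t hst).2]
      have h4 : t ^ A.μ ≤ (s / δ + 1) ^ A.μ * (t - s) ^ A.μ := by
        rw [← Real.mul_rpow (by positivity) (by linarith)]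
        refine Real.rpow_le_rpow ht0.le ?_ A.μ_pos.le
        have : s ≤ s / δ * (t - s) := by
          rw [div_mul_eq_mul_div, le_div_iff₀ hδ]
          exact mul_le_mul_of_nonneg_left (by linarith) hs.le
        linarith
      calc _ ≤ (s / δ + 1) ^ A.μ * (t - s) ^ A.μ * ‖v' (t - s)‖ := by gcongr
        _ ≤ _ := by rw [mul_assoc]; gcongr
  have hbdd : A.IsBdd T₂ (max R₁ R₂) (max ε₁ B) w z := by
    intro t ht
    have m1 := le_max_left R₁ R₂
    have m2 := le_max_right R₁ R₂
    have m3 := le_max_left ε₁ B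
    have m4 := le_max_right ε₁ B
    by_cases hts : t ≤ s
    · have h1 := hb₁ t (hle t ht hts)
      simp only [hw, hz, hts, if_true]
      exact ⟨h1.1.trans (by linarith), h1.2.trans (by linarith)⟩
    · have hts' := not_le.1 hts
      have h2 := hB t ht hts'
      refine ⟨?_, h2.trans (by linarith)⟩
      rw [(hhi t hts').1]
      exact (hb₂ _ (hmem' t ht.1 hts')).1.trans (by linarith)
  have hRm : 0 ≤ max R₁ R₂ := le_max_of_le_left hR₁
  have hεm : 0 ≤ max ε₁ B := le_max_of_le_left hε₁
  have hJs : ∀ t, 0 < t → t ≤ s → A.J₁ w z t = A.J₁ u v t := fun t h0 hts =>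
    J₁_congr h0.le (fun τ hτ => by simp [hw, hτ.2.le.trans hts])
      fun τ hτ => by simp [hz, hτ.2.le.trans hts]
  refine ⟨w, z, hcurve, by simp [hw, hs.le, h.init], ⟨_, _, hRm, hεm, hbdd⟩, fun t ht => ?_⟩
  have ht0 := timeInterval_sdiff_pos ht
  by_cases hts : t ≤ s
  · rw [hJs t ht0 hts, ← h.eq t (hle t ht hts)]
    simp [hw, hts]
  · have hts' := not_le.1 hts
    have hp : 0 < t - s := sub_pos.2 hts'
    have e1 := hcurve.J₁_add hbdd hRm hεm hs hp (by simpa using ht)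
    rw [add_sub_cancel] at e1
    have e2 : A.J₁ (fun τ => w (s + τ)) (fun τ => z (s + τ)) (t - s) = A.J₁ u' v' (t - s) :=
      J₁_congr hp.le (fun τ hτ => by rw [(hhi (s + τ) (by linarith [hτ.1])).1, add_sub_cancel_left])
        fun τ hτ => by rw [(hhi (s + τ) (by linarith [hτ.1])).2, add_sub_cancel_left]
    have e3 : A.S t φ = A.S (t - s) (A.S s φ) := by
      rw [← A.S_add _ _ hp hs, sub_add_cancel]
    rw [(hhi t hts').1, h'.eq _ (hmem' t ht.1 hts'), e1, e2, e3, hJs s hs le_rfl, h.eq s hsI,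
      map_add]
    abel

end MildSystem

/-! ### Existence times, maximal solutions and the lower bound -/

namespace MildSystem

variable {X P F₁ F₂ : Type*} [NormedAddCommGroup X] [NormedSpace ℝ X]
  [NormedAddCommGroup P] [NormedSpace ℝ P] [NormedAddCommGroup F₁] [NormedSpace ℝ F₁]
  [NormedAddCommGroup F₂] [NormedSpace ℝ F₂] {A : MildSystem X P F₁ F₂}
  {T : ℝ≥0∞} {u u' : ℝ → X} {φ : X}

/-- `u` solves the integral equation on `[0, T)` with datum `φ`. -/
def Solves (A : MildSystem X P F₁ F₂) (φ : X) (T : ℝ≥0∞) (u : ℝ → X) : Prop :=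
  ∃ v, A.IsSolution φ T u v

theorem Solves.mono {T' : ℝ≥0∞} (h : A.Solves φ T u) (hT : T' ≤ T) : A.Solves φ T' u :=
  let ⟨v, hv⟩ := h
  ⟨v, hv.mono hT⟩

theorem Solves.congr (h : A.Solves φ T u) (hT : 0 < T) (hu : EqOn u' u (timeInterval T)) :
    A.Solves φ T u' :=
  let ⟨v, hv⟩ := h
  ⟨v, hv.congr hT hu⟩

variable [CompleteSpace X] [CompleteSpace P]

theorem Solves.unique (h : A.Solves φ T u) (h' : A.Solves φ T u') :
    EqOn u u' (timeInterval T) :=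
  let ⟨_, hv⟩ := h
  let ⟨_, hv'⟩ := h'
  hv.unique hv'

theorem rpow_mul_rpow_self {R θ : ℝ} (hR : 0 ≤ R) (hθ : 0 ≤ θ) (hθ1 : θ ≤ 1) :
    R ^ (1 - θ) * R ^ θ = R := by
  rw [← Real.rpow_add_of_nonneg hR (by linarith) hθ]; simp

/-- Take `R = ε = C ‖φ‖`, which the linear part respects for all times. The mixed quantity `R^{1-θ}
ε^θ` is then `R`, and the contraction conditions reduce to smallness of `R^b Θ`. -/
theorem exists_solves_of_small (A : MildSystem X P F₁ F₂) :
    ∃ δ : ℝ, 0 < δ ∧ ∀ (φ : X) (T : ℝ≥0∞) (Θ : ℝ), 0 < T →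
      (∀ t ∈ timeInterval T \ {0}, t ^ A.ω ≤ Θ) → 0 ≤ Θ → ‖φ‖ ^ A.b * Θ ≤ δ →
      ∃ u, A.Solves φ T u := by
  set K := A.K₁ + A.K₂ with hK
  have h1 : 0 ≤ A.K₁ := K₁_nonneg
  have h2 : 0 ≤ A.K₂ := K₂_nonneg
  have hC : 0 < A.C := one_pos.trans_le A.one_le_C
  have hb := A.b_pos
  -- The threshold turns `(K + 1) R^b Θ` into at most `1/2`; using `K + 1` keeps the denominator
  -- positive when `K = 0`.
  refine ⟨1 / (2 * (K + 1) * A.C ^ A.b), by positivity, fun φ T Θ hT hΘ hΘ0 hle => ?_⟩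
  set R := A.C * ‖φ‖ with hR
  have hR0 : 0 ≤ R := by positivity
  have hKR : (K + 1) * R ^ (A.b + 1) * Θ ≤ R / 2 := by
    have e : (K + 1) * R ^ (A.b + 1) * Θ = (K + 1) * A.C ^ A.b * (‖φ‖ ^ A.b * Θ) * R := by
      rw [Real.rpow_add_one' hR0 (by linarith)]
      nth_rw 1 [hR]
      rw [Real.mul_rpow hC.le (norm_nonneg _)]
      ring
    rw [e]
    have : (K + 1) * A.C ^ A.b * (‖φ‖ ^ A.b * Θ) ≤ 1 / 2 := by
      calc _ ≤ (K + 1) * A.C ^ A.b * (1 / (2 * (K + 1) * A.C ^ A.b)) := by gcongr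
        _ = 1 / 2 := by
          have : K + 1 ≠ 0 := by positivity
          field_simp
    calc _ ≤ 1 / 2 * R := by gcongr
      _ = _ := by ring
  have hle' : ∀ K', 0 ≤ K' → K' ≤ K → K' * R ^ (A.b + 1) * Θ ≤ R / 2 := by
    intro K' _ hK'
    refine le_trans ?_ hKR
    gcongr
    linarith
  obtain ⟨u, v, h⟩ := A.exists_isSolution (φ := φ) hT hR0 hR0
    (fun t ht => A.S_bound t (timeInterval_sdiff_pos ht) φ) (fun t ht => by
      have ht0 := timeInterval_sdiff_pos ht
      have hp : 0 < t ^ A.μ := Real.rpow_pos_of_pos ht0 _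
      have := mul_le_mul_of_nonneg_left (A.SP_smoothing.norm_le t ht0 φ) hp.le
      refine this.trans (le_of_eq ?_)
      rw [Real.rpow_neg ht0.le, hR, ← mul_assoc, mul_left_comm, mul_inv_cancel₀ hp.ne', mul_one]) hΘ
    (by
      rw [rpow_mul_rpow_self hR0 A.N₁_power.θ_pos.le A.N₁_power.θ_le]
      exact hle' _ h1 (by linarith))
    (by
      rw [rpow_mul_rpow_self hR0 A.N₂_power.θ_pos.le A.N₂_power.θ_le]
      exact hle' _ h2 (by linarith))
  exact ⟨u, v, h⟩

theorem mem_timeInterval_ofReal {T t : ℝ} (hT : 0 < T) :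
    t ∈ timeInterval (ENNReal.ofReal T) ↔ 0 ≤ t ∧ t < T := by
  rw [timeInterval, mem_ofPred_eq, ENNReal.ofReal_lt_ofReal_iff hT]

/-- Subcritical and critical local existence with a quantitative existence time. -/
theorem exists_solves_of_mul_rpow_le (A : MildSystem X P F₁ F₂) :
    ∃ δ : ℝ, 0 < δ ∧ ∀ (φ : X) (T : ℝ), 0 < T → ‖φ‖ * T ^ (A.ω / A.b) ≤ δ →
      ∃ u, A.Solves φ (ENNReal.ofReal T) u := by
  obtain ⟨δ, hδ, h⟩ := A.exists_solves_of_small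
  have hb := A.b_pos
  refine ⟨δ ^ (1 / A.b), by positivity, fun φ T hT hle => ?_⟩
  refine h φ (ENNReal.ofReal T) (T ^ A.ω) (by simpa using hT) (fun t ht => ?_) (by positivity) ?_
  · exact Real.rpow_le_rpow ht.1.1 ((mem_timeInterval_ofReal hT).1 ht.1).2.le A.ω_nonneg
  · have := Real.rpow_le_rpow (by positivity) hle hb.le
    rw [Real.mul_rpow (norm_nonneg _) (by positivity), ← Real.rpow_mul hT.le,
      ← Real.rpow_mul hδ.le, one_div_mul_cancel hb.ne', div_mul_cancel₀ _ hb.ne',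
      Real.rpow_one] at this
    exact this

theorem exists_solves_top (A : MildSystem X P F₁ F₂) (hω : A.ω = 0) :
    ∃ δ : ℝ, 0 < δ ∧ ∀ φ : X, ‖φ‖ ≤ δ → ∃ u, A.Solves φ ∞ u := by
  obtain ⟨δ, hδ, h⟩ := A.exists_solves_of_small
  have hb := A.b_pos
  refine ⟨δ ^ (1 / A.b), by positivity, fun φ hle => ?_⟩
  refine h φ ∞ 1 ENNReal.zero_lt_top (fun t _ => by rw [hω, Real.rpow_zero]) zero_le_one ?_
  have := Real.rpow_le_rpow (by positivity) hle hb.le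
  rw [← Real.rpow_mul hδ.le, one_div_mul_cancel hb.ne', Real.rpow_one] at this
  simpa using this

/-- No smallness of the datum is needed: `R` is fixed by `‖φ‖`, `ε` is then chosen small, and the
interval is shortened until `t^μ ‖SP t φ‖ < ε`. How short it must be depends on `φ` itself. -/
theorem exists_solves (A : MildSystem X P F₁ F₂) (φ : X) :
    ∃ T : ℝ, 0 < T ∧ ∃ u, A.Solves φ (ENNReal.ofReal T) u := by
  have hC : 0 < A.C := one_pos.trans_le A.one_le_C
  set R := A.C * ‖φ‖ + 1 with hR
  have hR0 : 0 < R := by positivity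
  obtain ⟨ε, hε, -, h1, h2⟩ := A.exists_small hR0 1 one_pos
  obtain ⟨δ, hδ, hsub⟩ := mem_nhdsGT_iff_exists_Ioo_subset.1
    ((A.SP_tendsto φ).eventually (gt_mem_nhds hε))
  have hδ : (0 : ℝ) < δ := hδ
  have hT : 0 < min δ 1 := lt_min hδ one_pos
  refine ⟨min δ 1, hT, ?_⟩
  have hlt : ∀ t ∈ timeInterval (ENNReal.ofReal (min δ 1)) \ {0}, t < δ ∧ t < 1 := fun t ht =>
    lt_min_iff.1 ((mem_timeInterval_ofReal hT).1 ht.1).2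
  obtain ⟨u, v, h⟩ := A.exists_isSolution (φ := φ) (T := ENNReal.ofReal (min δ 1))
    (by simpa using hδ) hR0.le hε.le
    (fun t ht => (A.S_bound t (timeInterval_sdiff_pos ht) φ).trans (by linarith))
    (fun t ht => (hsub ⟨timeInterval_sdiff_pos ht, (hlt t ht).1⟩ : t ^ A.μ * ‖A.SP t φ‖ < ε).le)
    (fun t ht => Real.rpow_le_one ht.1.1 (hlt t ht).2.le A.ω_nonneg) h1 h2
  exact ⟨u, v, h⟩

/-- Uniqueness lets all local solutions be patched into one function, and the supremum of their
times of existence is maximal. In fact no solution with this datum exists beyond it, whether or not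
it extends the patched one. -/
theorem exists_maximal (A : MildSystem X P F₁ F₂) (φ : X) :
    ∃ (Tmax : ℝ≥0∞) (u : ℝ → X), 0 < Tmax ∧ (∀ T, 0 < T → T < Tmax → A.Solves φ T u) ∧
      ∀ T u', Tmax < T → ¬ A.Solves φ T u' := by
  set 𝒯 : Set ℝ≥0∞ := {T | ∃ u, A.Solves φ T u} with h𝒯
  have hex : ∀ t : ℝ, ∃ x : X, ∀ T u, A.Solves φ T u → t ∈ timeInterval T → u t = x := by
    intro t
    by_cases h : ∃ T u, A.Solves φ T u ∧ t ∈ timeInterval T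
    · obtain ⟨T, u, hu, ht⟩ := h
      refine ⟨u t, fun T' u' hu' ht' => ?_⟩
      exact (hu'.mono (min_le_right T T')).unique (hu.mono (min_le_left T T'))
        ⟨ht.1, lt_min ht.2 ht'.2⟩
    · push Not at h
      exact ⟨0, fun T u hu ht => absurd ht (h T u hu)⟩
  choose U hU using hex
  refine ⟨sSup 𝒯, U, ?_, fun T hT0 hT => ?_, fun T u' hT h => ?_⟩
  · obtain ⟨T, hT, u, hu⟩ := A.exists_solves φ
    exact lt_of_lt_of_le (ENNReal.ofReal_pos.2 hT) (le_sSup ⟨u, hu⟩)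
  · obtain ⟨T', ⟨u, hu⟩, hTT'⟩ := lt_sSup_iff.1 hT
    exact (hu.mono hTT'.le).congr hT0 fun t ht =>
      (hU t T' u hu (timeInterval_mono hTT'.le ht)).symm
  · exact absurd hT (not_lt.2 (le_sSup ⟨u', h⟩))

/-- The constant is the threshold `δ` of `exists_solves_of_mul_rpow_le`: a datum `u s` below the
claimed bound would have a solution living longer than `Tmax - s`. -/
theorem lower_bound_of_maximal (A : MildSystem X P F₁ F₂) :
    ∃ C : ℝ, 0 < C ∧ ∀ (φ : X) (Tmax : ℝ) (u : ℝ → X),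
      (∀ T, 0 < T → T < ENNReal.ofReal Tmax → A.Solves φ T u) →
      (∀ T u', ENNReal.ofReal Tmax < T → A.Solves φ T u' →
        ¬ EqOn u' u (timeInterval (ENNReal.ofReal Tmax))) →
      ∀ s, 0 ≤ s → s < Tmax → C / (Tmax - s) ^ (A.ω / A.b) ≤ ‖u s‖ := by
  obtain ⟨δ, hδ, hex⟩ := A.exists_solves_of_mul_rpow_le
  refine ⟨δ, hδ, fun φ Tmax u hsol hmax s hs hsT => ?_⟩
  by_contra hlt
  have hp : 0 < Tmax - s := sub_pos.2 hsT
  have hTm : 0 < Tmax := hs.trans_lt hsT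
  rw [not_le, lt_div_iff₀ (by positivity)] at hlt
  -- The failure of the bound is strict, so by continuity the smallness condition survives for some
  -- `T'` strictly larger than `Tmax - s`.
  have hcont : ContinuousAt (fun T : ℝ => ‖u s‖ * T ^ (A.ω / A.b)) (Tmax - s) :=
    (continuousAt_id.rpow_const (Or.inl hp.ne')).const_mul _
  obtain ⟨T', hT'1, hT'2⟩ : ∃ T', ‖u s‖ * T' ^ (A.ω / A.b) < δ ∧ Tmax - s < T' :=
    (((hcont.eventually (gt_mem_nhds hlt)).filter_mono nhdsWithin_le_nhds).and
      (self_mem_nhdsWithin (a := Tmax - s) (s := Ioi (Tmax - s)))).exists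
  have hT'0 : 0 < T' := hp.trans hT'2
  obtain ⟨w, hw⟩ := hex (u s) T' hT'0 hT'1.le
  -- Solvability is known only for times strictly below `Tmax`; the midpoint is one that lies beyond
  -- `s`.
  have hmid : 0 < (s + Tmax) / 2 := by linarith
  have hsolmid : A.Solves φ (ENNReal.ofReal ((s + Tmax) / 2)) u :=
    hsol _ (ENNReal.ofReal_pos.2 hmid) ((ENNReal.ofReal_lt_ofReal_iff hTm).2 (by linarith))
  obtain ⟨T₂, w₂, hT₂, hw₂⟩ : ∃ T₂ w₂, ENNReal.ofReal Tmax < T₂ ∧ A.Solves φ T₂ w₂ := by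
    rcases hs.eq_or_lt with h0 | h0
    · obtain ⟨v, hv⟩ := hsolmid
      rw [← h0, hv.init] at hw
      exact ⟨_, w, (ENNReal.ofReal_lt_ofReal_iff hT'0).2 (by linarith), hw⟩
    · obtain ⟨v, hv⟩ := hsolmid
      obtain ⟨w', hw'⟩ := hw
      obtain ⟨y, z, hyz⟩ := hv.glue h0 ((mem_timeInterval_ofReal hmid).2 ⟨hs, by linarith⟩)
        (ENNReal.ofReal_pos.2 hT'0) hw'
      refine ⟨_, y, ?_, z, hyz⟩
      rw [← ENNReal.ofReal_add hs hT'0.le]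
      exact (ENNReal.ofReal_lt_ofReal_iff (by linarith)).2 (by linarith)
  -- The longer solution agrees with `u` on `[0, Tmax)` by uniqueness on each shorter interval,
  -- which contradicts maximality.
  refine hmax T₂ w₂ hT₂ hw₂ fun t ht => ?_
  have ht' := (mem_timeInterval_ofReal hTm).1 ht
  have hm : 0 < (t + Tmax) / 2 := by linarith
  have hlt2 : ENNReal.ofReal ((t + Tmax) / 2) < ENNReal.ofReal Tmax :=
    (ENNReal.ofReal_lt_ofReal_iff hTm).2 (by linarith)
  exact (hw₂.mono (hlt2.le.trans hT₂.le)).unique (hsol _ (ENNReal.ofReal_pos.2 hm) hlt2)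
    ((mem_timeInterval_ofReal hm).2 ⟨ht'.1, by linarith⟩)

end MildSystem

/-! ### `L¹` bounds for inverse Fourier transforms -/

section FourierL1

variable {V : Type*} [NormedAddCommGroup V] [InnerProductSpace ℝ V]

theorem norm_iteratedFDeriv_comp_prodMk_le {E : Type*} [NormedAddCommGroup E] [NormedSpace ℝ E]
    {H : ℝ × V → E} {n : ℕ} (hH : ContDiff ℝ n H) (δ : ℝ) (ξ : V) :
    ‖iteratedFDeriv ℝ n (fun ξ => H (δ, ξ)) ξ‖ ≤ ‖iteratedFDeriv ℝ n H (δ, ξ)‖ := by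
  have e : (fun ξ : V => H (δ, ξ)) =
      (fun y => H ((δ, 0) + y)) ∘ (ContinuousLinearMap.inr ℝ ℝ V) := by
    funext ξ; simp
  have h1 : ContDiff ℝ n (fun y => H ((δ, 0) + y)) := hH.comp (by fun_prop)
  rw [e, ContinuousLinearMap.iteratedFDeriv_comp_right _ h1 _ le_rfl,
    iteratedFDeriv_comp_add_left]
  refine (ContinuousMultilinearMap.norm_compContinuousLinearMap_le _ _).trans ?_
  have h2 : ‖ContinuousLinearMap.inr ℝ ℝ V‖ ≤ 1 :=
    ContinuousLinearMap.opNorm_le_bound _ zero_le_one fun x => by simp [Prod.norm_def]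
  rw [Finset.prod_const]
  have h4 : ((δ, 0) : ℝ × V) + ContinuousLinearMap.inr ℝ ℝ V ξ = (δ, ξ) := by simp
  rw [h4]
  exact mul_le_of_le_one_right (norm_nonneg _) (pow_le_one₀ (norm_nonneg _) h2)

theorem continuous_neg_innerₗ : Continuous fun p : V × V => (-innerₗ V) p.1 p.2 :=
  (continuous_inner.neg : Continuous fun p : V × V => -inner ℝ p.1 p.2)

variable [FiniteDimensional ℝ V] [MeasurableSpace V] [BorelSpace V]

/-- The inverse Fourier transforms of a smooth family of smooth functions with supports in a
common ball are bounded in `L¹`. -/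
theorem exists_lintegral_fourierInv_le {H : ℝ × V → ℂ} (hH : ∀ n : ℕ, ContDiff ℝ n H) {ρ : ℝ}
    (hρ : ∀ δ ξ, ρ ≤ ‖ξ‖ → H (δ, ξ) = 0) :
    ∃ C : ℝ, 0 ≤ C ∧ ∀ δ ∈ Icc (0 : ℝ) 1,
      ∫⁻ x, ‖𝓕⁻ (fun ξ => H (δ, ξ)) x‖ₑ ≤ ENNReal.ofReal C := by
  -- Decay of order `dim V + 1` is integrable. It comes from `d` derivatives of the symbol, which
  -- are bounded uniformly on the compact set of parameters and frequencies.
  set d := Module.finrank ℝ V + 1 with hd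
  set Bρ := Metric.closedBall (0 : V) ρ with hBρ
  have hK : IsCompact (Icc (0 : ℝ) 1 ×ˢ Bρ) := isCompact_Icc.prod (isCompact_closedBall _ _)
  have hM : ∀ n : ℕ, ∃ M : ℝ, ∀ p ∈ Icc (0 : ℝ) 1 ×ˢ Bρ, ‖iteratedFDeriv ℝ n H p‖ ≤ M := fun n =>
    hK.exists_bound_of_continuousOn ((hH n).continuous_iteratedFDeriv le_rfl).continuousOn
  choose M hM using hM
  have hcs : ∀ δ, HasCompactSupport fun ξ => H (δ, ξ) := fun δ =>
    HasCompactSupport.intro (isCompact_closedBall (0 : V) ρ) fun ξ hξ =>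
      hρ δ ξ (by simpa using (not_le.1 (fun h => hξ (by simpa using h))).le)
  have hcd : ∀ δ (n : ℕ), ContDiff ℝ n fun ξ => H (δ, ξ) := fun δ n =>
    (hH n).comp (contDiff_const.prodMk contDiff_id)
  have hts : ∀ δ, tsupport (fun ξ => H (δ, ξ)) ⊆ Bρ := fun δ =>
    closure_minimal (fun ξ hξ => by
      by_contra hn
      exact hξ (hρ δ ξ (by simpa [hBρ] using (not_le.1 (fun h => hn (by simpa [hBρ] using h))).le)))
      Metric.isClosed_closedBall
  have hint : ∀ δ (n : ℕ), Integrable (fun ξ => iteratedFDeriv ℝ n (fun ξ => H (δ, ξ)) ξ) :=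
    fun δ n => ((hcd δ n).continuous_iteratedFDeriv le_rfl).integrable_of_hasCompactSupport
      ((hcs δ).iteratedFDeriv n)
  have hbd : ∀ δ ∈ Icc (0 : ℝ) 1, ∀ n : ℕ,
      ∫ ξ, ‖iteratedFDeriv ℝ n (fun ξ => H (δ, ξ)) ξ‖ ≤ max (M n) 0 * volume.real Bρ := by
    intro δ hδ n
    have h1 : ∀ ξ, ‖iteratedFDeriv ℝ n (fun ξ => H (δ, ξ)) ξ‖
        ≤ Bρ.indicator (fun _ => max (M n) 0) ξ := by
      intro ξ
      by_cases hξ : ξ ∈ Bρ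
      · rw [indicator_of_mem hξ]
        exact (norm_iteratedFDeriv_comp_prodMk_le (hH n) δ ξ).trans
          ((hM n (δ, ξ) ⟨hδ, hξ⟩).trans (le_max_left _ _))
      · rw [indicator_of_notMem hξ]
        have : ξ ∉ Function.support (iteratedFDeriv ℝ n fun ξ => H (δ, ξ)) := fun h =>
          hξ (hts δ (support_iteratedFDeriv_subset n h))
        rw [Function.notMem_support.1 this, norm_zero]
    refine (integral_mono (hint δ n).norm ?_ h1).trans (le_of_eq ?_)
    · exact (integrable_indicator_iff Metric.isClosed_closedBall.measurableSet).2
        (integrableOn_const (measure_closedBall_lt_top.ne))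
    · rw [integral_indicator Metric.isClosed_closedBall.measurableSet, setIntegral_const, mul_comm]
      rfl
  set S : ℕ → ℝ := fun n => (2 : ℝ) ^ n *
    ∑ p ∈ Finset.range 1 ×ˢ Finset.range (n + 1), max (M p.2) 0 * volume.real Bρ with hS
  have hS0 : ∀ n, 0 ≤ S n := fun n => by positivity
  have hdecay : ∀ δ ∈ Icc (0 : ℝ) 1, ∀ n : ℕ, ∀ w, ‖w‖ ^ n * ‖𝓕 (fun ξ => H (δ, ξ)) w‖ ≤ S n := by
    intro δ hδ n w
    have h1 := Real.pow_mul_norm_iteratedFDeriv_fourier_le (K := 0) (N := n)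
      (f := fun ξ => H (δ, ξ)) (by simpa using hcd δ n) (fun k m hk _ => by
        have hk0 : k = 0 := by simpa using hk
        simpa [hk0] using (hint δ m).norm) (k := 0) (n := n) (by simp) le_rfl w
    rw [norm_iteratedFDeriv_zero] at h1
    refine h1.trans ?_
    simp only [hS, pow_zero, one_mul, Nat.cast_zero, mul_zero, zero_add]
    gcongr with p hp
    have hp1 : p.1 = 0 := by
      have := (Finset.mem_product.1 hp).1
      simpa using this
    simpa [hp1] using hbd δ hδ p.2
  have hJ : Integrable (fun x : V => (1 + ‖x‖) ^ (-(d : ℝ))) :=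
    integrable_one_add_norm (by simp [hd])
  set C := 2 ^ d * (S 0 + S d) with hC
  have hC0 : 0 ≤ C := by have := hS0 0; have := hS0 d; positivity
  refine ⟨C * ∫ x : V, (1 + ‖x‖) ^ (-(d : ℝ)), by positivity, fun δ hδ => ?_⟩
  have hpt : ∀ x, ‖𝓕⁻ (fun ξ => H (δ, ξ)) x‖ ≤ C * (1 + ‖x‖) ^ (-(d : ℝ)) := by
    intro x
    rw [Real.fourierInv_eq_fourier_neg]
    have h0 := hdecay δ hδ 0 (-x)
    have h1 := hdecay δ hδ d (-x)
    rw [norm_neg] at h0 h1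
    rw [pow_zero, one_mul] at h0
    have hx : 0 < 1 + ‖x‖ := by positivity
    rw [Real.rpow_neg hx.le, Real.rpow_natCast, ← div_eq_mul_inv, le_div_iff₀ (by positivity)]
    have h2 : (1 + ‖x‖) ^ d ≤ 2 ^ d * (1 + ‖x‖ ^ d) := by
      rcases le_total 1 ‖x‖ with h | h
      · calc (1 + ‖x‖) ^ d ≤ (2 * ‖x‖) ^ d := by gcongr; linarith
          _ = 2 ^ d * ‖x‖ ^ d := mul_pow _ _ _
          _ ≤ _ := by gcongr; linarith
      · calc (1 + ‖x‖) ^ d ≤ 2 ^ d := by gcongr; linarith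
          _ ≤ _ := le_mul_of_one_le_right (by positivity) (by simp)
    calc _ ≤ ‖𝓕 (fun ξ => H (δ, ξ)) (-x)‖ * (2 ^ d * (1 + ‖x‖ ^ d)) := by gcongr
      _ = 2 ^ d * (‖𝓕 (fun ξ => H (δ, ξ)) (-x)‖ + ‖x‖ ^ d * ‖𝓕 (fun ξ => H (δ, ξ)) (-x)‖) := by ring
      _ ≤ C := by rw [hC]; gcongr
  calc ∫⁻ x, ‖𝓕⁻ (fun ξ => H (δ, ξ)) x‖ₑ
      ≤ ∫⁻ x, ENNReal.ofReal (C * (1 + ‖x‖) ^ (-(d : ℝ))) := by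
        refine lintegral_mono fun x => ?_
        rw [← ofReal_norm]
        exact ENNReal.ofReal_le_ofReal (hpt x)
    _ = ENNReal.ofReal (∫ x : V, C * (1 + ‖x‖) ^ (-(d : ℝ))) := by
        rw [ofReal_integral_eq_lintegral_ofReal (hJ.const_mul C)
          (Eventually.of_forall fun x => by positivity)]
    _ = _ := by rw [integral_const_mul]

theorem fourierInv_comp_smul (f : V → ℂ) {c : ℝ} (hc : c ≠ 0) (x : V) :
    𝓕⁻ (fun ξ => f (c • ξ)) x = |(c ^ Module.finrank ℝ V)⁻¹| • 𝓕⁻ f (c⁻¹ • x) := by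
  rw [Real.fourierInv_eq, Real.fourierInv_eq, ← Measure.integral_comp_smul]
  congr 1
  funext ξ
  rw [real_inner_smul_left, real_inner_smul_right, mul_inv_cancel_left₀ hc]

/-- Because of this invariance every dyadic piece can be rescaled to one fixed annulus. -/
theorem lintegral_fourierInv_comp_smul (f : V → ℂ) {c : ℝ} (hc : c ≠ 0) :
    ∫⁻ x, ‖𝓕⁻ (fun ξ => f (c • ξ)) x‖ₑ = ∫⁻ x, ‖𝓕⁻ f x‖ₑ := by
  have hd : |(c ^ Module.finrank ℝ V)⁻¹| ≠ 0 := by positivity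
  have h1 : ∀ x, ‖𝓕⁻ (fun ξ => f (c • ξ)) x‖ₑ
      = ENNReal.ofReal |(c ^ Module.finrank ℝ V)⁻¹| * ‖𝓕⁻ f (c⁻¹ • x)‖ₑ := by
    intro x
    rw [fourierInv_comp_smul f hc, enorm_smul, Real.enorm_eq_ofReal_abs, abs_abs]
  simp_rw [h1]
  rw [lintegral_const_mul' _ _ ENNReal.ofReal_ne_top]
  have hmap := Measure.map_addHaar_smul (volume : Measure V) (inv_ne_zero hc)
  have h2 := (MeasurableEquiv.smul₀ c⁻¹ (inv_ne_zero hc)).measurableEmbedding.lintegral_map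
    (μ := (volume : Measure V)) (fun x => ‖𝓕⁻ f x‖ₑ)
  have h3 : ∫⁻ x, ‖𝓕⁻ f (c⁻¹ • x)‖ₑ
      = ENNReal.ofReal |((c⁻¹) ^ Module.finrank ℝ V)⁻¹| * ∫⁻ x, ‖𝓕⁻ f x‖ₑ := by
    rw [← smul_eq_mul, ← lintegral_smul_measure, ← hmap]
    exact h2.symm
  rw [h3, ← mul_assoc, ← ENNReal.ofReal_mul (abs_nonneg _), ← abs_mul]
  rw [inv_pow, inv_inv, inv_mul_cancel₀ (pow_ne_zero _ hc), abs_one, ENNReal.ofReal_one, one_mul]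

theorem continuous_fourierInv {f : V → ℂ} (hf : Integrable f) : Continuous (𝓕⁻ f) :=
  VectorFourier.fourierIntegral_continuous Real.continuous_fourierChar
    continuous_neg_innerₗ hf

theorem integrable_fourierChar_smul {f : V → ℂ} (hf : Integrable f) (x : V) :
    Integrable fun ξ => Real.fourierChar (inner ℝ ξ x) • f ξ := by
  simpa using (Real.fourierIntegral_convergent_iff (μ := volume) (-x)).2 hf

theorem fourierInv_add {f g : V → ℂ} (hf : Integrable f) (hg : Integrable g) :
    𝓕⁻ (fun ξ => f ξ + g ξ) = fun x => 𝓕⁻ f x + 𝓕⁻ g x := by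
  funext x
  simp only [Real.fourierInv_eq, smul_add]
  exact integral_add (integrable_fourierChar_smul hf x) (integrable_fourierChar_smul hg x)

theorem lintegral_fourierInv_add_le {f g : V → ℂ} (hf : Integrable f) (hg : Integrable g) :
    ∫⁻ x, ‖𝓕⁻ (fun ξ => f ξ + g ξ) x‖ₑ ≤ (∫⁻ x, ‖𝓕⁻ f x‖ₑ) + ∫⁻ x, ‖𝓕⁻ g x‖ₑ := by
  rw [fourierInv_add hf hg, ← lintegral_add_left (continuous_fourierInv hf).enorm.measurable]
  exact lintegral_mono fun x => enorm_add_le _ _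

/-- If `f_N → h` dominatedly and the inverse Fourier transforms of the `f_N` are bounded in `L¹`,
then that of `h` is integrable. -/
theorem integrable_fourierInv_of_tendsto {f : ℕ → V → ℂ} {h : V → ℂ} {g : V → ℝ}
    (hg : Integrable g) (hf : ∀ N, AEStronglyMeasurable (f N)) (hfg : ∀ N ξ, ‖f N ξ‖ ≤ g ξ)
    (hlim : ∀ᵐ ξ, Tendsto (fun N => f N ξ) atTop (𝓝 (h ξ))) {C : ℝ≥0∞} (hC : C ≠ ∞)
    (hbd : ∀ N, ∫⁻ x, ‖𝓕⁻ (f N) x‖ₑ ≤ C) : Integrable (𝓕⁻ h) := by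
  have hfi : ∀ N, Integrable (f N) := fun N => hg.mono' (hf N) (Eventually.of_forall (hfg N))
  have hconv : ∀ x, Tendsto (fun N => 𝓕⁻ (f N) x) atTop (𝓝 (𝓕⁻ h x)) := by
    intro x
    simp only [Real.fourierInv_eq]
    refine tendsto_integral_of_dominated_convergence g (fun N => ?_) hg (fun N => ?_) ?_
    · exact (integrable_fourierChar_smul (hfi N) x).aestronglyMeasurable
    · exact Eventually.of_forall fun ξ => by simpa using hfg N ξ
    · filter_upwards [hlim] with ξ hξ
      exact (continuous_const_smul _).continuousAt.tendsto.comp hξ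
  have hcont := fun N => continuous_fourierInv (hfi N)
  have hle : ∫⁻ x, ‖𝓕⁻ h x‖ₑ ≤ C :=
    calc ∫⁻ x, ‖𝓕⁻ h x‖ₑ = ∫⁻ x, liminf (fun N => ‖𝓕⁻ (f N) x‖ₑ) atTop :=
          lintegral_congr fun x => ((hconv x).enorm.liminf_eq).symm
      _ ≤ liminf (fun N => ∫⁻ x, ‖𝓕⁻ (f N) x‖ₑ) atTop :=
          lintegral_liminf_le fun N => (hcont N).enorm.measurable
      _ ≤ C := liminf_le_of_le (by isBoundedDefault) fun b hb => by
          obtain ⟨N, hN⟩ := hb.exists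
          exact hN.trans (hbd N)
  exact ⟨aestronglyMeasurable_of_tendsto_ae _ (fun N => (hcont N).aestronglyMeasurable)
    (Eventually.of_forall hconv), lt_of_le_of_lt hle hC.lt_top⟩

end FourierL1

/-! ### Dyadic decomposition in frequency -/

section Dyadic

variable {V : Type*} [NormedAddCommGroup V] [InnerProductSpace ℝ V] [FiniteDimensional ℝ V]

variable (V) in
/-- A smooth cutoff function that equals `1` on the unit ball and is supported in the ball of
radius `2`. -/
def cutoff : ContDiffBump (0 : V) := ⟨1, 2, one_pos, one_lt_two⟩

/-- The dyadic annulus function `χ(ξ/2) - χ(ξ)`. -/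
def annulus (ξ : V) : ℝ := cutoff V ((2 : ℝ)⁻¹ • ξ) - cutoff V ξ

theorem cutoff_eq_one {ξ : V} (h : ‖ξ‖ ≤ 1) : cutoff V ξ = 1 :=
  (cutoff V).one_of_mem_closedBall (by simpa [cutoff] using h)

theorem cutoff_eq_zero {ξ : V} (h : 2 ≤ ‖ξ‖) : cutoff V ξ = 0 :=
  (cutoff V).zero_of_le_dist (by simpa [cutoff] using h)

theorem norm_cutoff_le (ξ : V) : ‖cutoff V ξ‖ ≤ 1 := by
  rw [Real.norm_of_nonneg (cutoff V).nonneg]; exact (cutoff V).le_one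

theorem contDiff_cutoff (n : ℕ) : ContDiff ℝ n (cutoff V) := (cutoff V).contDiff

theorem contDiff_annulus (n : ℕ) : ContDiff ℝ n (annulus : V → ℝ) :=
  ((contDiff_cutoff n).comp (contDiff_const_smul _)).sub (contDiff_cutoff n)

theorem annulus_eq_zero_of_norm_le {ξ : V} (h : ‖ξ‖ ≤ 1) : annulus ξ = 0 := by
  rw [annulus, cutoff_eq_one h, cutoff_eq_one, sub_self]
  rw [norm_smul]; norm_num; linarith

theorem annulus_eq_zero_of_le_norm {ξ : V} (h : 4 ≤ ‖ξ‖) : annulus ξ = 0 := by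
  rw [annulus, cutoff_eq_zero (ξ := ξ) (by linarith), cutoff_eq_zero (ξ := (2 : ℝ)⁻¹ • ξ), sub_self]
  rw [norm_smul]; norm_num; linarith

/-- The annulus function vanishes near `ξ = 0`, so smoothness of `F` is needed only away from that
point. -/
theorem contDiff_annulus_mul {F : ℝ × V → ℂ} {n : ℕ}
    (hF : ∀ p : ℝ × V, p.2 ≠ 0 → ContDiffAt ℝ n F p) :
    ContDiff ℝ n (fun p : ℝ × V => (annulus p.2 : ℂ) * F p) := by
  have hψ : ContDiff ℝ n (fun p : ℝ × V => (annulus p.2 : ℂ)) :=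
    (Complex.ofRealCLM.contDiff.comp (contDiff_annulus n)).comp contDiff_snd
  rw [contDiff_iff_contDiffAt]
  intro p
  by_cases hp : p.2 = 0
  · have h0 : (fun p : ℝ × V => (annulus p.2 : ℂ) * F p) =ᶠ[𝓝 p] fun _ => 0 := by
      have : ∀ᶠ y : ℝ × V in 𝓝 p, ‖y.2‖ < 1 :=
        (continuous_snd.norm.tendsto p).eventually (gt_mem_nhds (by simp [hp]))
      filter_upwards [this] with y hy
      rw [annulus_eq_zero_of_norm_le hy.le]; simp
    exact contDiffAt_const.congr_of_eventuallyEq h0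
  · exact hψ.contDiffAt.mul (hF p hp)

variable [MeasurableSpace V] [BorelSpace V]

theorem exists_lintegral_fourierInv_annulus_le {F : ℝ × V → ℂ}
    (hF : ∀ n : ℕ, ∀ p : ℝ × V, p.2 ≠ 0 → ContDiffAt ℝ n F p) :
    ∃ C : ℝ, 0 ≤ C ∧ ∀ δ ∈ Icc (0 : ℝ) 1,
      ∫⁻ x, ‖𝓕⁻ (fun ξ => (annulus ξ : ℂ) * F (δ, ξ)) x‖ₑ ≤ ENNReal.ofReal C :=
  exists_lintegral_fourierInv_le (H := fun p => (annulus p.2 : ℂ) * F p)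
    (fun n => contDiff_annulus_mul (hF n)) (ρ := 4)
    fun δ ξ h => by simp [annulus_eq_zero_of_le_norm h]

theorem lintegral_fourierInv_const_mul (f : V → ℂ) (c : ℂ) :
    ∫⁻ x, ‖𝓕⁻ (fun ξ => c * f ξ) x‖ₑ = ‖c‖ₑ * ∫⁻ x, ‖𝓕⁻ f x‖ₑ := by
  rw [← lintegral_const_mul' _ _ (by simp)]
  refine lintegral_congr fun x => ?_
  rw [← enorm_mul, Real.fourierInv_eq, Real.fourierInv_eq, ← integral_const_mul]
  congr 2
  funext ξ
  rw [mul_smul_comm]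

/-- The symbol is approximated by functions that are cut off at frequency `2^N` and frozen at the
value `h 0` below frequency `2^{-N}`. Consecutive approximations differ by two annular pieces; by
`hhi` and `hlo` these are summable in `L¹` on the space side, and Fatou's lemma passes to the limit.
-/
theorem integrable_fourierInv_of_dyadic {h : V → ℂ} (hh : Integrable h) (hc : Continuous h)
    {C : ℝ} (hC : 0 ≤ C)
    (hhi : ∀ N : ℕ, ∫⁻ x, ‖𝓕⁻ (fun ξ => (annulus ξ : ℂ) * h ((2 : ℝ) ^ N • ξ)) x‖ₑ
      ≤ ENNReal.ofReal (C * (1 / 2) ^ N))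
    (hlo : ∀ N : ℕ, ∫⁻ x, ‖𝓕⁻ (fun ξ => (annulus ξ : ℂ) *
      (h (((2 : ℝ) ^ (N + 1))⁻¹ • ξ) - h 0)) x‖ₑ ≤ ENNReal.ofReal (C * (1 / 2) ^ N)) :
    Integrable (𝓕⁻ h) := by
  set χ : V → ℂ := fun ξ => (cutoff V ξ : ℂ) with hχ
  have hχc : Continuous χ := Complex.continuous_ofReal.comp (contDiff_cutoff 0).continuous
  have hχ1 : ∀ ξ, ‖χ ξ‖ ≤ 1 := fun ξ => by simpa [hχ] using norm_cutoff_le ξ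
  -- The second summand replaces `h` by the constant `h 0` near the origin, which removes its
  -- possible lack of smoothness there. In particular `f 0` is a smooth cutoff times `h 0`.
  set f : ℕ → V → ℂ := fun N ξ =>
    χ (((2 : ℝ) ^ N)⁻¹ • ξ) * h ξ + χ ((2 : ℝ) ^ N • ξ) * (h 0 - h ξ) with hf
  set a : ℕ → V → ℂ := fun N ξ =>
    (annulus (((2 : ℝ) ^ N)⁻¹ • ξ) : ℂ) * h ξ with ha
  set c : ℕ → V → ℂ := fun N ξ =>
    (annulus ((2 : ℝ) ^ (N + 1) • ξ) : ℂ) * (h ξ - h 0) with hcdef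
  have hfc : ∀ N, Continuous (f N) := fun N => by fun_prop
  have hac : ∀ N, Continuous (a N) := fun N =>
    (Complex.continuous_ofReal.comp ((contDiff_annulus 0).continuous.comp (by fun_prop))).mul hc
  have hcc : ∀ N, Continuous (c N) := fun N =>
    (Complex.continuous_ofReal.comp ((contDiff_annulus 0).continuous.comp (by fun_prop))).mul
      (hc.sub continuous_const)
  have hfsucc : ∀ N, f (N + 1) = fun ξ => f N ξ + (a N ξ + c N ξ) := by
    intro N
    funext ξ
    have e1 : (2 : ℝ)⁻¹ • ((2 : ℝ) ^ N)⁻¹ • ξ = ((2 : ℝ) ^ (N + 1))⁻¹ • ξ := by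
      rw [smul_smul, pow_succ, mul_inv, mul_comm]
    have e2 : (2 : ℝ)⁻¹ • (2 : ℝ) ^ (N + 1) • ξ = (2 : ℝ) ^ N • ξ := by
      rw [smul_smul, pow_succ]; congr 1; ring
    simp only [hf, ha, hcdef, hχ, annulus, e1, e2, Complex.ofReal_sub]
    ring
  set g : V → ℝ := fun ξ =>
    2 * ‖h ξ‖ + (Metric.closedBall (0 : V) 2).indicator (fun _ => ‖h 0‖) ξ with hg
  have hgi : Integrable g := (hh.norm.const_mul 2).add
    ((integrable_indicator_iff Metric.isClosed_closedBall.measurableSet).2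
      (integrableOn_const measure_closedBall_lt_top.ne))
  have hfg : ∀ N ξ, ‖f N ξ‖ ≤ g ξ := by
    intro N ξ
    have h1 : ‖χ (((2 : ℝ) ^ N)⁻¹ • ξ) * h ξ‖ ≤ ‖h ξ‖ := by
      rw [norm_mul]; exact mul_le_of_le_one_left (norm_nonneg _) (hχ1 _)
    have h2 : ‖χ ((2 : ℝ) ^ N • ξ) * (h 0 - h ξ)‖
        ≤ ‖h ξ‖ + (Metric.closedBall (0 : V) 2).indicator (fun _ => ‖h 0‖) ξ := by
      rw [norm_mul]
      by_cases hξ : ξ ∈ Metric.closedBall (0 : V) 2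
      · rw [indicator_of_mem hξ]
        refine (mul_le_of_le_one_left (norm_nonneg _) (hχ1 _)).trans ?_
        linarith [norm_sub_le (h 0) (h ξ)]
      · have h3 : 2 < ‖ξ‖ := by simpa using hξ
        have h4 : χ ((2 : ℝ) ^ N • ξ) = 0 := by
          rw [hχ]
          simp only [Complex.ofReal_eq_zero]
          refine cutoff_eq_zero ?_
          rw [norm_smul, Real.norm_of_nonneg (by positivity)]
          exact h3.le.trans (le_mul_of_one_le_left (norm_nonneg _) (one_le_pow₀ one_le_two))
        rw [h4, norm_zero, zero_mul, indicator_of_notMem hξ, add_zero]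
        exact norm_nonneg _
    exact (norm_add_le _ _).trans (by simp only [hg]; linarith)
  have hfi : ∀ N, Integrable (f N) := fun N =>
    hgi.mono' (hfc N).aestronglyMeasurable (Eventually.of_forall (hfg N))
  have hdi : ∀ N, Integrable (fun ξ => a N ξ + c N ξ) := fun N => by
    have := (hfi (N + 1)).sub (hfi N)
    rw [hfsucc N] at this
    refine this.congr (Eventually.of_forall fun ξ => ?_)
    simp
  have hann : ∀ ξ : V, ‖(annulus ξ : ℂ)‖ ≤ 2 := fun ξ => by
    rw [Complex.norm_real, annulus]
    exact (norm_sub_le _ _).trans (by linarith [norm_cutoff_le ((2 : ℝ)⁻¹ • ξ), norm_cutoff_le ξ])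
  have hai : ∀ N, Integrable (a N) := fun N => by
    refine (hh.norm.const_mul 2).mono' (hac N).aestronglyMeasurable (Eventually.of_forall fun ξ => ?_)
    rw [ha, norm_mul]
    exact mul_le_mul_of_nonneg_right (hann _) (norm_nonneg _)
  have hci : ∀ N, Integrable (c N) := fun N => by
    refine ((hdi N).sub (hai N)).congr (Eventually.of_forall fun ξ => ?_)
    simp
  have hlim : ∀ᵐ ξ, Tendsto (fun N => f N ξ) atTop (𝓝 (h ξ)) := by
    refine Eventually.of_forall fun ξ => ?_
    by_cases h0 : ξ = 0
    · have : ∀ N, f N ξ = h ξ := fun N => by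
        simp [hf, h0, hχ, cutoff_eq_one (V := V) (ξ := 0) (by simp)]
      simp [this]
    · have hpow : Tendsto (fun N : ℕ => (2 : ℝ) ^ N) atTop atTop :=
        tendsto_pow_atTop_atTop_of_one_lt one_lt_two
      have h1 : ∀ᶠ N : ℕ in atTop, max (2 / ‖ξ‖) ‖ξ‖ ≤ (2 : ℝ) ^ N := hpow.eventually_ge_atTop _
      refine tendsto_const_nhds.congr' ?_
      filter_upwards [h1] with N hN
      have hp : (0 : ℝ) < 2 ^ N := by positivity
      have e1 : χ (((2 : ℝ) ^ N)⁻¹ • ξ) = 1 := by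
        rw [hχ]
        simp only [Complex.ofReal_eq_one]
        refine cutoff_eq_one ?_
        rw [norm_smul, Real.norm_of_nonneg (by positivity), inv_mul_le_iff₀ hp, mul_one]
        exact (le_max_right _ _).trans hN
      have e2 : χ ((2 : ℝ) ^ N • ξ) = 0 := by
        rw [hχ]
        simp only [Complex.ofReal_eq_zero]
        refine cutoff_eq_zero ?_
        rw [norm_smul, Real.norm_of_nonneg hp.le, ← div_le_iff₀ (norm_pos_iff.2 h0)]
        exact (le_max_left _ _).trans hN
      simp [hf, e1, e2]
  have hA : ∀ N, ∫⁻ x, ‖𝓕⁻ (a N) x‖ₑ ≤ ENNReal.ofReal (C * (1 / 2) ^ N) := fun N => by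
    have hp : ((2 : ℝ) ^ N) ≠ 0 := by positivity
    have := lintegral_fourierInv_comp_smul
      (fun ξ => (annulus ξ : ℂ) * h ((2 : ℝ) ^ N • ξ)) (inv_ne_zero hp)
    simp only [smul_inv_smul₀ hp] at this
    rw [ha, this]
    exact hhi N
  have hCc : ∀ N, ∫⁻ x, ‖𝓕⁻ (c N) x‖ₑ ≤ ENNReal.ofReal (C * (1 / 2) ^ N) := fun N => by
    have hp : ((2 : ℝ) ^ (N + 1)) ≠ 0 := by positivity
    have := lintegral_fourierInv_comp_smul
      (fun ξ => (annulus ξ : ℂ) * (h (((2 : ℝ) ^ (N + 1))⁻¹ • ξ) - h 0)) hp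
    simp only [inv_smul_smul₀ hp] at this
    rw [hcdef, this]
    exact hlo N
  obtain ⟨C₀, hC₀, hf0⟩ : ∃ C₀ : ℝ, 0 ≤ C₀ ∧ ∫⁻ x, ‖𝓕⁻ (f 0) x‖ₑ ≤ ENNReal.ofReal C₀ := by
    obtain ⟨C₀, hC₀, h1⟩ := exists_lintegral_fourierInv_le
      (H := fun p : ℝ × V => (cutoff V p.2 : ℂ) * h 0)
      (fun n => ((Complex.ofRealCLM.contDiff.comp (contDiff_cutoff n)).comp contDiff_snd).mul
        contDiff_const) (ρ := 2) fun δ ξ hξ => by simp [cutoff_eq_zero hξ]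
    refine ⟨C₀, hC₀, ?_⟩
    have e : f 0 = fun ξ => (cutoff V ξ : ℂ) * h 0 := by
      funext ξ; simp [hf, hχ]; ring
    rw [e]
    exact h1 0 (by simp)
  -- Step `N` adds at most `2 C / 2^N`, and these numbers sum to `4 C (1 - 2^{-N})`.
  have hsum : ∀ N, ∫⁻ x, ‖𝓕⁻ (f N) x‖ₑ
      ≤ ENNReal.ofReal (C₀ + 4 * C * (1 - (1 / 2) ^ N)) := by
    intro N
    induction N with
    | zero => simpa using hf0
    | succ N ih =>
      rw [hfsucc]
      have hq : (1 / 2 : ℝ) ^ N ≤ 1 := pow_le_one₀ (by norm_num) (by norm_num)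
      calc _ ≤ (∫⁻ x, ‖𝓕⁻ (f N) x‖ₑ) + ∫⁻ x, ‖𝓕⁻ (fun ξ => a N ξ + c N ξ) x‖ₑ :=
            lintegral_fourierInv_add_le (hfi N) (hdi N)
        _ ≤ ENNReal.ofReal (C₀ + 4 * C * (1 - (1 / 2) ^ N)) +
            (ENNReal.ofReal (C * (1 / 2) ^ N) + ENNReal.ofReal (C * (1 / 2) ^ N)) :=
            add_le_add ih ((lintegral_fourierInv_add_le (hai N) (hci N)).trans
              (add_le_add (hA N) (hCc N)))
        _ = _ := by
            have : 0 ≤ C₀ + 4 * C * (1 - (1 / 2) ^ N) := by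
              have : 0 ≤ 1 - (1 / 2 : ℝ) ^ N := by linarith
              positivity
            rw [← ENNReal.ofReal_add (by positivity) (by positivity),
              ← ENNReal.ofReal_add this (by positivity)]
            congr 1
            rw [pow_succ]; ring
  refine integrable_fourierInv_of_tendsto hgi (fun N => (hfc N).aestronglyMeasurable) hfg hlim
    (C := ENNReal.ofReal (C₀ + 4 * C)) ENNReal.ofReal_ne_top fun N => (hsum N).trans
      (ENNReal.ofReal_le_ofReal ?_)
  have : 0 ≤ (1 / 2 : ℝ) ^ N := by positivity
  nlinarith

end Dyadic

/-! ### Integrability of the kernels at time one -/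

section FractionalSymbol

variable {V : Type*} [NormedAddCommGroup V] [InnerProductSpace ℝ V]

/-- The symbol `exp (-t (2π|ξ|)^β)` of the semigroup generated by `-(-Δ)^(β/2)`. -/
def fracSymbol (β t : ℝ) (ξ : V) : ℂ :=
  ((Real.exp (-t * (2 * Real.pi * ‖ξ‖) ^ β) : ℝ) : ℂ)

theorem continuous_fracSymbol {β : ℝ} (hβ : 0 ≤ β) (t : ℝ) :
    Continuous (fracSymbol β t : V → ℂ) := by
  unfold fracSymbol
  have : Continuous fun ξ : V => (2 * Real.pi * ‖ξ‖) ^ β :=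
    (continuous_const.mul continuous_norm).rpow_const fun _ => Or.inr hβ
  fun_prop

theorem norm_fracSymbol (β t : ℝ) (ξ : V) :
    ‖fracSymbol β t ξ‖ = Real.exp (-t * (2 * Real.pi * ‖ξ‖) ^ β) := by
  rw [fracSymbol, Complex.norm_real, Real.norm_of_nonneg (Real.exp_pos _).le]

theorem fracSymbol_neg (β t : ℝ) (ξ : V) : fracSymbol β t (-ξ) = fracSymbol β t ξ := by
  rw [fracSymbol, fracSymbol, norm_neg]

theorem fracSymbol_zero {β : ℝ} (hβ : β ≠ 0) (t : ℝ) : fracSymbol β t (0 : V) = 1 := by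
  simp [fracSymbol, Real.zero_rpow hβ]

theorem fracSymbol_add (β s t : ℝ) (ξ : V) :
    fracSymbol β (s + t) ξ = fracSymbol β s ξ * fracSymbol β t ξ := by
  rw [fracSymbol, fracSymbol, fracSymbol, ← Complex.ofReal_mul, ← Real.exp_add]
  congr 2; ring

theorem fracSymbol_smul (β t : ℝ) {c : ℝ} (hc : 0 ≤ c) (ξ : V) :
    fracSymbol β t (c • ξ) = fracSymbol β (c ^ β * t) ξ := by
  rw [fracSymbol, fracSymbol, norm_smul, Real.norm_of_nonneg hc,
    show 2 * Real.pi * (c * ‖ξ‖) = c * (2 * Real.pi * ‖ξ‖) by ring,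
    Real.mul_rpow hc (by positivity)]
  congr 2; ring

theorem exp_neg_rpow_le {β : ℝ} (hβ : 1 ≤ β) {x : ℝ} (hx : 0 ≤ x) :
    Real.exp (-(2 * Real.pi * x) ^ β) ≤ Real.exp 1 * Real.exp (-x) := by
  rw [← Real.exp_add]
  refine Real.exp_le_exp.2 ?_
  have hpi : 1 ≤ 2 * Real.pi := by linarith [Real.pi_gt_three]
  rcases le_total x 1 with h | h
  · have : 0 ≤ (2 * Real.pi * x) ^ β := by positivity
    linarith
  · have h1 : x ≤ 2 * Real.pi * x := le_mul_of_one_le_left hx hpi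
    have := Real.self_le_rpow_of_one_le (h.trans h1) hβ
    linarith

variable [FiniteDimensional ℝ V] [MeasurableSpace V] [BorelSpace V]

theorem integrable_pow_mul_exp_neg (k : ℕ) :
    Integrable fun ξ : V => ‖ξ‖ ^ k * Real.exp (-‖ξ‖) := by
  set d := Module.finrank ℝ V + 1 with hd
  have hJ : Integrable (fun x : V => (1 + ‖x‖) ^ (-(d : ℝ))) :=
    integrable_one_add_norm (by simp [hd])
  refine (hJ.const_mul (Real.exp 1 * (k + d).factorial)).mono' (by fun_prop)
    (Eventually.of_forall fun ξ => ?_)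
  have h1 : (1 + ‖ξ‖) ^ (k + d) / (k + d).factorial ≤ Real.exp (1 + ‖ξ‖) :=
    Real.pow_div_factorial_le_exp (x := 1 + ‖ξ‖) (by positivity) (k + d)
  have hx : 0 < 1 + ‖ξ‖ := by positivity
  rw [Real.norm_of_nonneg (by positivity), Real.rpow_neg hx.le, Real.rpow_natCast,
    ← div_eq_mul_inv, le_div_iff₀ (by positivity)]
  have hf : (0 : ℝ) < (k + d).factorial := by positivity
  rw [div_le_iff₀ hf] at h1
  calc ‖ξ‖ ^ k * Real.exp (-‖ξ‖) * (1 + ‖ξ‖) ^ d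
      ≤ (1 + ‖ξ‖) ^ k * Real.exp (-‖ξ‖) * (1 + ‖ξ‖) ^ d := by gcongr; linarith
    _ = (1 + ‖ξ‖) ^ (k + d) * Real.exp (-‖ξ‖) := by ring
    _ ≤ (Real.exp (1 + ‖ξ‖) * (k + d).factorial) * Real.exp (-‖ξ‖) := by gcongr
    _ = Real.exp 1 * (k + d).factorial := by
      rw [Real.exp_add]
      have := Real.exp_pos ‖ξ‖
      rw [Real.exp_neg]; field_simp

theorem integrable_pow_mul_fracSymbol {β : ℝ} (hβ : 1 ≤ β) (k : ℕ) {t : ℝ} (ht : 0 < t) :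
    Integrable fun ξ : V => ‖ξ‖ ^ k * ‖fracSymbol β t ξ‖ := by
  have h1 : Integrable fun ξ : V => ‖ξ‖ ^ k * ‖fracSymbol β 1 ξ‖ := by
    refine ((integrable_pow_mul_exp_neg k).const_mul (Real.exp 1)).mono' ?_
      (Eventually.of_forall fun ξ => ?_)
    · exact ((continuous_norm.pow k).mul
        (continuous_fracSymbol (zero_le_one.trans hβ) 1).norm).aestronglyMeasurable
    · rw [norm_mul, norm_norm, norm_pow, norm_norm, norm_fracSymbol, neg_one_mul]
      calc _ ≤ ‖ξ‖ ^ k * (Real.exp 1 * Real.exp (-‖ξ‖)) := by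
            gcongr; exact exp_neg_rpow_le hβ (norm_nonneg _)
        _ = _ := by ring
  have hc : 0 < t ^ β⁻¹ := Real.rpow_pos_of_pos ht _
  have h2 := (h1.comp_smul hc.ne').const_mul ((t ^ β⁻¹) ^ k)⁻¹
  refine h2.congr (Eventually.of_forall fun ξ => ?_)
  simp only
  rw [fracSymbol_smul _ _ hc.le, ← Real.rpow_mul ht.le, inv_mul_cancel₀ (by linarith),
    Real.rpow_one, mul_one, norm_smul, Real.norm_of_nonneg hc.le, mul_pow]
  field_simp

theorem integrable_fracSymbol {β : ℝ} (hβ : 1 ≤ β) {t : ℝ} (ht : 0 < t) :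
    Integrable (fracSymbol β t : V → ℂ) := by
  have h := integrable_pow_mul_fracSymbol (V := V) hβ 0 ht
  simp only [pow_zero, one_mul] at h
  exact (integrable_norm_iff
    (continuous_fracSymbol (zero_le_one.trans hβ) t).aestronglyMeasurable).1 h

theorem integrable_inner_mul_fracSymbol {β : ℝ} (hβ : 1 ≤ β) {t : ℝ} (ht : 0 < t) (a : V) :
    Integrable fun ξ : V => ((inner ℝ ξ a : ℝ) : ℂ) * fracSymbol β t ξ := by
  refine ((integrable_pow_mul_fracSymbol (V := V) hβ 1 ht).const_mul ‖a‖).mono' ?_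
    (Eventually.of_forall fun ξ => ?_)
  · have := continuous_fracSymbol (V := V) (zero_le_one.trans hβ) t
    fun_prop
  · rw [norm_mul, Complex.norm_real, pow_one, ← mul_assoc]
    gcongr
    rw [mul_comm]
    exact norm_inner_le_norm ξ a

/-- The rescaled pieces are members of two fixed families, smooth for `ξ ≠ 0`, with parameter `δ N`
in the compact interval `[0, 1]`. Their `L¹` bounds are therefore uniform, and the geometric decay
sits in the scalars `c N` and `d N`. -/
theorem integrable_fourierInv_of_factor {h : V → ℂ} (hh : Integrable h) (hc : Continuous h)
    {F G : ℝ × V → ℂ} (hF : ∀ n : ℕ, ∀ p : ℝ × V, p.2 ≠ 0 → ContDiffAt ℝ n F p)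
    (hG : ∀ n : ℕ, ∀ p : ℝ × V, p.2 ≠ 0 → ContDiffAt ℝ n G p) {δ c d : ℕ → ℝ}
    (hδ : ∀ N, δ N ∈ Icc (0 : ℝ) 1) (hcN : ∀ N, |c N| ≤ (1 / 2) ^ N)
    (hdN : ∀ N, |d N| ≤ (1 / 2) ^ N)
    (hhi : ∀ N ξ, ξ ≠ 0 → h ((2 : ℝ) ^ N • ξ) = c N * F (δ N, ξ))
    (hlo : ∀ N ξ, ξ ≠ 0 → h (((2 : ℝ) ^ (N + 1))⁻¹ • ξ) - h 0 = d N * G (δ (N + 1), ξ)) :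
    Integrable (𝓕⁻ h) := by
  obtain ⟨A, hA0, hA⟩ := exists_lintegral_fourierInv_annulus_le hF
  obtain ⟨B, hB0, hB⟩ := exists_lintegral_fourierInv_annulus_le hG
  have key : ∀ (H : ℝ × V → ℂ) (k : V → ℂ) (x y M : ℝ) (N : ℕ), 0 ≤ M → |y| ≤ (1 / 2) ^ N →
      (∫⁻ w, ‖𝓕⁻ (fun ξ => (annulus ξ : ℂ) * H (x, ξ)) w‖ₑ ≤ ENNReal.ofReal M) → M ≤ A + B →
      (∀ ξ, ξ ≠ 0 → k ξ = y * H (x, ξ)) →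
      ∫⁻ w, ‖𝓕⁻ (fun ξ => (annulus ξ : ℂ) * k ξ) w‖ₑ
        ≤ ENNReal.ofReal ((A + B) * (1 / 2) ^ N) := by
    intro H k x y M N hM hy hle hMAB hk
    have e : (fun ξ => (annulus ξ : ℂ) * k ξ)
        = fun ξ => (y : ℂ) * ((annulus ξ : ℂ) * H (x, ξ)) := by
      funext ξ
      rcases eq_or_ne ξ 0 with rfl | hξ
      · rw [annulus_eq_zero_of_norm_le (by simp)]; simp
      · rw [hk ξ hξ]; ring
    rw [e, lintegral_fourierInv_const_mul, mul_comm (A + B), ENNReal.ofReal_mul (by positivity)]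
    refine mul_le_mul' ?_ (hle.trans (ENNReal.ofReal_le_ofReal hMAB))
    rw [← ofReal_norm, Complex.norm_real]
    exact ENNReal.ofReal_le_ofReal hy
  refine integrable_fourierInv_of_dyadic hh hc (add_nonneg hA0 hB0) (fun N => ?_) fun N => ?_
  · exact key F _ _ _ A N hA0 (hcN N) (hA _ (hδ N)) (by linarith) (hhi N)
  · exact key G _ _ _ B N hB0 (hdN N) (hB _ (hδ (N + 1))) (by linarith) (hlo N)

/-- A smooth function with `x ^ 2 * sqInvGlue x = exp (-1/x)` for `x > 0`. -/
def sqInvGlue (x : ℝ) : ℝ := (Polynomial.X ^ 2 : Polynomial ℝ).eval x⁻¹ * expNegInvGlue x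

theorem contDiff_sqInvGlue (n : ℕ) : ContDiff ℝ n sqInvGlue :=
  expNegInvGlue.contDiff_polynomial_eval_inv_mul (n := (n : ℕ∞)) (Polynomial.X ^ 2)

theorem sq_mul_sqInvGlue {x : ℝ} (hx : 0 < x) : x ^ 2 * sqInvGlue x = Real.exp (-x⁻¹) := by
  rw [sqInvGlue, expNegInvGlue, if_neg hx.not_ge]
  simp only [Polynomial.eval_pow, Polynomial.eval_X]
  field_simp

/-- The entire function `(exp z - 1) / z`. -/
def expSlope (z : ℂ) : ℂ := dslope Complex.exp 0 z

theorem contDiff_expSlope (n : ℕ) : ContDiff ℝ n expSlope := by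
  have h : DifferentiableOn ℂ (dslope Complex.exp 0) univ :=
    (Complex.differentiableOn_dslope univ_mem).2 Complex.differentiable_exp.differentiableOn
  exact ((differentiableOn_univ.1 h).contDiff (n := n)).restrict_scalars ℝ

theorem mul_expSlope (z : ℂ) : z * expSlope z = Complex.exp z - 1 := by
  simpa [expSlope] using sub_smul_dslope Complex.exp 0 z

theorem contDiffAt_rpow_norm (β : ℝ) (n : ℕ) {p : ℝ × V} (hp : p.2 ≠ 0) :
    ContDiffAt ℝ n (fun p : ℝ × V => (2 * Real.pi * ‖p.2‖) ^ β) p := by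
  refine ContDiffAt.rpow_const_of_ne ?_ (by positivity)
  exact contDiffAt_const.mul ((contDiffAt_norm ℝ hp).comp p contDiffAt_snd)

theorem contDiffAt_ofReal {f : ℝ × V → ℝ} {n : ℕ} {p : ℝ × V} (hf : ContDiffAt ℝ n f p) :
    ContDiffAt ℝ n (fun p => (f p : ℂ)) p :=
  Complex.ofRealCLM.contDiff.contDiffAt.comp p hf

theorem pow_rpow_inv_mem {β : ℝ} (hβ : 1 ≤ β) (N : ℕ) :
    0 < (((2 : ℝ) ^ N) ^ β)⁻¹ ∧ (((2 : ℝ) ^ N) ^ β)⁻¹ ≤ (1 / 2) ^ N := by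
  have h1 : (1 : ℝ) ≤ 2 ^ N := one_le_pow₀ one_le_two
  refine ⟨by positivity, ?_⟩
  rw [one_div, inv_pow]
  exact inv_anti₀ (by positivity) (Real.self_le_rpow_of_one_le h1 hβ)

/-- With `Y = (2π|ξ|)^β` and `δ = 2^{-Nβ}`, the value is `exp(-1/x)` for `x = δ / Y`. Writing it as
`x²` times a smooth function of `x` extracts decay `δ²` and leaves a family that is smooth up to `δ
= 0`; one factor `δ` is spent later against the `2^N` of the gradient symbol. -/
theorem fracSymbol_two_pow_smul (β : ℝ) (N : ℕ) {ξ : V} (hξ : ξ ≠ 0) :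
    fracSymbol β 1 ((2 : ℝ) ^ N • ξ) = (((((2 : ℝ) ^ N) ^ β)⁻¹ ^ 2 : ℝ) : ℂ) *
      ((((2 * Real.pi * ‖ξ‖) ^ β)⁻¹ ^ 2 *
        sqInvGlue ((((2 : ℝ) ^ N) ^ β)⁻¹ * ((2 * Real.pi * ‖ξ‖) ^ β)⁻¹) : ℝ) : ℂ) := by
  have hY : 0 < (2 * Real.pi * ‖ξ‖) ^ β := by positivity
  have h2 : 0 < ((2 : ℝ) ^ N) ^ β := by positivity
  rw [fracSymbol_smul _ _ (by positivity), mul_one, fracSymbol, ← Complex.ofReal_mul]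
  congr 1
  rw [← mul_assoc, ← mul_pow, sq_mul_sqInvGlue (by positivity), mul_inv, inv_inv, inv_inv, neg_mul]

/-- The inverse Fourier transform of `exp (-(2π|ξ|)^β)` is integrable. -/
theorem integrable_fourierInv_fracSymbol {β : ℝ} (hβ : 1 ≤ β) :
    Integrable (𝓕⁻ (fracSymbol β 1 : V → ℂ)) := by
  have hY := fun (n : ℕ) (p : ℝ × V) (hp : p.2 ≠ 0) => contDiffAt_rpow_norm β n hp
  refine integrable_fourierInv_of_factor (integrable_fracSymbol hβ one_pos)
    (continuous_fracSymbol (by linarith) 1)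
    (F := fun p => ((((2 * Real.pi * ‖p.2‖) ^ β)⁻¹ ^ 2 *
        sqInvGlue (p.1 * ((2 * Real.pi * ‖p.2‖) ^ β)⁻¹) : ℝ) : ℂ))
    -- Low frequencies: `exp(-δY) - 1 = δ · (-Y) · expSlope(-δY)`.
    (G := fun p => ((-(2 * Real.pi * ‖p.2‖) ^ β : ℝ) : ℂ) *
      expSlope ((p.1 * -(2 * Real.pi * ‖p.2‖) ^ β : ℝ) : ℂ))
    (δ := fun N => (((2 : ℝ) ^ N) ^ β)⁻¹) (c := fun N => (((2 : ℝ) ^ N) ^ β)⁻¹ ^ 2)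
    (d := fun N => (((2 : ℝ) ^ (N + 1)) ^ β)⁻¹) ?_ ?_ ?_ ?_ ?_ ?_ ?_
  · intro n p hp
    have h1 := (hY n p hp).inv (by positivity)
    exact contDiffAt_ofReal ((h1.pow 2).mul
      ((contDiff_sqInvGlue n).contDiffAt.comp p (contDiffAt_fst.mul h1)))
  · intro n p hp
    exact (contDiffAt_ofReal (hY n p hp).neg).mul ((contDiff_expSlope n).contDiffAt.comp p
      (contDiffAt_ofReal (contDiffAt_fst.mul (hY n p hp).neg)))
  · intro N
    have := pow_rpow_inv_mem hβ N
    exact ⟨this.1.le, this.2.trans (pow_le_one₀ (by norm_num) (by norm_num))⟩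
  · intro N
    have := pow_rpow_inv_mem hβ N
    have h1 : ((1 : ℝ) / 2) ^ N ≤ 1 := pow_le_one₀ (by norm_num) (by norm_num)
    rw [abs_of_nonneg (by positivity)]
    nlinarith [this.1, this.2]
  · intro N
    have := pow_rpow_inv_mem hβ (N + 1)
    rw [abs_of_pos this.1]
    exact this.2.trans (pow_le_pow_of_le_one (by norm_num) (by norm_num) (Nat.le_succ N))
  · intro N ξ hξ
    exact fracSymbol_two_pow_smul β N hξ
  · intro N ξ hξ
    simp only
    rw [fracSymbol_zero (by linarith), fracSymbol_smul _ _ (by positivity), mul_one,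
      ← mul_assoc, ← Complex.ofReal_mul, mul_expSlope, fracSymbol, Complex.ofReal_exp,
      Real.inv_rpow (by positivity)]
    congr 3
    ring

/-- The inverse Fourier transform of `⟨ξ, a⟩ exp (-(2π|ξ|)^β)` is integrable. -/
theorem integrable_fourierInv_inner_mul_fracSymbol {β : ℝ} (hβ : 1 ≤ β) (a : V) :
    Integrable (𝓕⁻ (fun ξ : V => ((inner ℝ ξ a : ℝ) : ℂ) * fracSymbol β 1 ξ)) := by
  have hY := fun (n : ℕ) (p : ℝ × V) (hp : p.2 ≠ 0) => contDiffAt_rpow_norm β n hp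
  have hI : ∀ (n : ℕ) (p : ℝ × V),
      ContDiffAt ℝ n (fun p : ℝ × V => ((inner ℝ p.2 a : ℝ) : ℂ)) p := fun n p =>
    contDiffAt_ofReal (contDiffAt_snd.inner ℝ contDiffAt_const)
  have hc := continuous_fracSymbol (V := V) (β := β) (by linarith) 1
  refine integrable_fourierInv_of_factor (integrable_inner_mul_fracSymbol hβ one_pos a)
    (by fun_prop)
    (F := fun p => ((inner ℝ p.2 a : ℝ) : ℂ) * ((((2 * Real.pi * ‖p.2‖) ^ β)⁻¹ ^ 2 *
        sqInvGlue (p.1 * ((2 * Real.pi * ‖p.2‖) ^ β)⁻¹) : ℝ) : ℂ))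
    (G := fun p => ((inner ℝ p.2 a : ℝ) : ℂ) *
      ((Real.exp (-(p.1 * (2 * Real.pi * ‖p.2‖) ^ β)) : ℝ) : ℂ))
    -- The linear factor `⟨ξ, a⟩` costs `2^N` at high frequencies; at low ones it makes the symbol
    -- vanish at `0` and supplies the decay `2^{-(N+1)}` by itself.
    (δ := fun N => (((2 : ℝ) ^ N) ^ β)⁻¹) (c := fun N => 2 ^ N * (((2 : ℝ) ^ N) ^ β)⁻¹ ^ 2)
    (d := fun N => ((2 : ℝ) ^ (N + 1))⁻¹) ?_ ?_ ?_ ?_ ?_ ?_ ?_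
  · intro n p hp
    have h1 := (hY n p hp).inv (by positivity)
    exact (hI n p).mul (contDiffAt_ofReal ((h1.pow 2).mul
      ((contDiff_sqInvGlue n).contDiffAt.comp p (contDiffAt_fst.mul h1))))
  · intro n p hp
    exact (hI n p).mul (contDiffAt_ofReal (contDiffAt_fst.mul (hY n p hp)).neg.exp)
  · intro N
    have := pow_rpow_inv_mem hβ N
    exact ⟨this.1.le, this.2.trans (pow_le_one₀ (by norm_num) (by norm_num))⟩
  · intro N
    have := pow_rpow_inv_mem hβ N
    rw [abs_of_nonneg (by positivity)]
    calc 2 ^ N * (((2 : ℝ) ^ N) ^ β)⁻¹ ^ 2 ≤ 2 ^ N * ((1 / 2) ^ N) ^ 2 := by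
          gcongr; exact this.2
      _ = (1 / 2) ^ N := by
          rw [sq, ← mul_assoc, ← mul_pow]; norm_num
  · intro N
    rw [abs_of_pos (by positivity), one_div, inv_pow]
    exact inv_anti₀ (by positivity) (pow_le_pow_right₀ one_le_two (Nat.le_succ N))
  · intro N ξ hξ
    simp only
    rw [fracSymbol_two_pow_smul β N hξ, real_inner_smul_left]
    push_cast
    ring
  · intro N ξ hξ
    simp only
    rw [inner_zero_left, fracSymbol_smul _ _ (by positivity), mul_one, real_inner_smul_left,
      fracSymbol, Real.inv_rpow (by positivity)]
    push_cast
    ring_nf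

end FractionalSymbol

/-! ### Real kernels: convolution, scaling, differentiation -/

section Kernels

variable {V : Type*} [NormedAddCommGroup V] [InnerProductSpace ℝ V] [FiniteDimensional ℝ V]
  [MeasurableSpace V] [BorelSpace V]

theorem fourier_comp_sub_left (k : V → ℂ) (x ξ : V) :
    𝓕 (fun y => k (x - y)) (-ξ) = Real.fourierChar (inner ℝ x ξ) • 𝓕 k ξ := by
  have hs : ∀ (c : Circle) (F : V → ℂ), c • ∫ y, F y = ∫ y, c • F y := fun c F => by
    simp only [Circle.smul_def, smul_eq_mul, integral_const_mul]
  rw [Real.fourier_eq, Real.fourier_eq, hs,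
    ← integral_sub_left_eq_self (fun y => Real.fourierChar (inner ℝ x ξ) •
      Real.fourierChar (-inner ℝ y ξ) • k y) volume x]
  congr 1
  funext y
  rw [smul_smul, ← AddChar.map_add_eq_mul, inner_neg_right, neg_neg, inner_sub_left]
  congr 3
  ring

/-- Fubini in the form that moves the Fourier transform from one factor of an integral to the other;
reflection of `k` by `y ↦ x - y` turns into the character `e^{2πi x·ξ}`. -/
theorem integral_mul_fourierInv {k h : V → ℂ} (hk : Integrable k) (hh : Integrable h) (x : V) :
    ∫ y, k (x - y) * 𝓕⁻ h y = 𝓕⁻ (fun ξ => 𝓕 k ξ * h ξ) x := by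
  have h1 := VectorFourier.integral_fourierIntegral_smul_eq_flip (μ := (volume : Measure V))
    (ν := (volume : Measure V)) (L := innerₗ V) (f := fun y => k (x - y)) (g := fun ξ => h (-ξ))
    Real.continuous_fourierChar continuous_inner (hk.comp_sub_left x) hh.comp_neg
  rw [flip_innerₗ] at h1
  have e : ∀ y, 𝓕⁻ h y = VectorFourier.fourierIntegral Real.fourierChar volume (innerₗ V)
      (fun ξ => h (-ξ)) y := fun y => by
    rw [Real.fourierInv_eq_fourier_comp_neg]; rfl
  simp_rw [e, ← smul_eq_mul]
  rw [← h1, ← integral_neg_eq_self, Real.fourierInv_eq]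
  congr 1
  funext ξ
  rw [neg_neg]
  have := fourier_comp_sub_left k x ξ
  change 𝓕 (fun y => k (x - y)) (-ξ) • h ξ = _
  rw [this, smul_assoc, real_inner_comm]

/-- A continuous integrable function on the frequency space whose inverse Fourier transform is
real and integrable. -/
structure IsKernelSymbol (f : V → ℂ) : Prop where
  continuous : Continuous f
  integrable : Integrable f
  conj_neg : ∀ ξ, (starRingEnd ℂ) (f (-ξ)) = f ξ
  integrable_fourierInv : Integrable (𝓕⁻ f)

/-- The real-valued kernel with a given symbol. -/
def kernelOf (f : V → ℂ) (x : V) : ℝ := (𝓕⁻ f x).re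

namespace IsKernelSymbol

variable {f g : V → ℂ}

/-- The symmetry `conj (f (-ξ)) = f ξ` makes the inverse transform equal to its own conjugate, so
taking the real part loses nothing. -/
theorem ofReal_kernelOf (hf : IsKernelSymbol f) (x : V) : (kernelOf f x : ℂ) = 𝓕⁻ f x := by
  rw [kernelOf, ← Complex.conj_eq_iff_re, Real.fourierInv_eq, ← integral_conj,
    ← integral_neg_eq_self]
  congr 1
  funext ξ
  rw [Circle.smul_def, smul_eq_mul, map_mul, hf.conj_neg, inner_neg_left, AddChar.map_neg_eq_inv,
    Circle.coe_inv_eq_conj, Complex.conj_conj, Circle.smul_def, smul_eq_mul]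

theorem continuous_kernelOf (hf : IsKernelSymbol f) : Continuous (kernelOf f) :=
  Complex.continuous_re.comp (continuous_fourierInv hf.integrable)

theorem integrable_kernelOf (hf : IsKernelSymbol f) : Integrable (kernelOf f) :=
  hf.integrable_fourierInv.re

theorem norm_kernelOf_le (x : V) : ‖kernelOf f x‖ ≤ ∫ ξ, ‖f ξ‖ := by
  refine (Complex.abs_re_le_norm _).trans ?_
  rw [Real.fourierInv_eq]
  refine (norm_integral_le_integral_norm _).trans (le_of_eq ?_)
  simp

theorem fourier_kernelOf (hf : IsKernelSymbol f) : 𝓕 (fun x => (kernelOf f x : ℂ)) = f := by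
  rw [show (fun x => (kernelOf f x : ℂ)) = 𝓕⁻ f from funext hf.ofReal_kernelOf]
  refine hf.continuous.fourier_fourierInv_eq hf.integrable ?_
  have := hf.integrable_fourierInv.comp_neg
  refine this.congr (Eventually.of_forall fun x => ?_)
  simp only
  rw [Real.fourierInv_eq_fourier_neg, neg_neg]

theorem integral_kernelOf (hf : IsKernelSymbol f) : ((∫ x, kernelOf f x : ℝ) : ℂ) = f 0 := by
  rw [← congrFun hf.fourier_kernelOf 0, Real.fourier_eq, ← integral_complex_ofReal]
  simp

theorem kernelOf_mul (hf : IsKernelSymbol f) (hg : IsKernelSymbol g) (x : V) :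
    kernelOf (fun ξ => f ξ * g ξ) x = ∫ y, kernelOf f (x - y) * kernelOf g y := by
  have h := integral_mul_fourierInv (k := fun x => (kernelOf f x : ℂ)) hf.integrable_kernelOf.ofReal
    hg.integrable x
  rw [hf.fourier_kernelOf] at h
  rw [kernelOf, ← h]
  simp_rw [← hg.ofReal_kernelOf, ← Complex.ofReal_mul]
  rw [integral_complex_ofReal, Complex.ofReal_re]

theorem kernelOf_comp_smul {c : ℝ} (hc : 0 < c) (x : V) :
    kernelOf (fun ξ => f (c • ξ)) x = (c ^ Module.finrank ℝ V)⁻¹ * kernelOf f (c⁻¹ • x) := by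
  rw [kernelOf, fourierInv_comp_smul f hc.ne', Complex.smul_re, abs_of_pos (by positivity),
    smul_eq_mul, kernelOf]

theorem comp_smul (hf : IsKernelSymbol f) {c : ℝ} (hc : 0 < c) :
    IsKernelSymbol fun ξ => f (c • ξ) where
  continuous := hf.continuous.comp (continuous_const_smul c)
  integrable := hf.integrable.comp_smul hc.ne'
  conj_neg ξ := by rw [smul_neg, hf.conj_neg]
  integrable_fourierInv := by
    refine ((hf.integrable_fourierInv.comp_smul (inv_ne_zero hc.ne')).smul
      |(c ^ Module.finrank ℝ V)⁻¹|).congr (Eventually.of_forall fun x => ?_)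
    exact (fourierInv_comp_smul f hc.ne' x).symm

theorem const_mul (hf : IsKernelSymbol f) (c : ℝ) : IsKernelSymbol fun ξ => (c : ℂ) * f ξ where
  continuous := continuous_const.mul hf.continuous
  integrable := hf.integrable.const_mul _
  conj_neg ξ := by rw [map_mul, hf.conj_neg, Complex.conj_ofReal]
  integrable_fourierInv := by
    refine (hf.integrable_fourierInv.const_mul (c : ℂ)).congr (Eventually.of_forall fun x => ?_)
    simp only
    rw [Real.fourierInv_eq, Real.fourierInv_eq, ← integral_const_mul]
    congr 1
    funext ξ
    rw [mul_smul_comm]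

theorem integral_norm_kernelOf_comp_smul {c : ℝ} (hc : 0 < c) :
    ∫ x, ‖kernelOf (fun ξ => f (c • ξ)) x‖ = ∫ x, ‖kernelOf f x‖ := by
  simp_rw [kernelOf_comp_smul hc, norm_mul]
  rw [integral_const_mul, Measure.integral_comp_smul volume (fun x => ‖kernelOf f x‖),
    Real.norm_of_nonneg (by positivity), smul_eq_mul, inv_pow, inv_inv,
    abs_of_pos (by positivity), inv_mul_cancel_left₀ (by positivity)]

theorem integral_norm_comp_smul {c : ℝ} (hc : 0 < c) :
    ∫ ξ, ‖f (c • ξ)‖ = (c ^ Module.finrank ℝ V)⁻¹ * ∫ ξ, ‖f ξ‖ := by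
  rw [Measure.integral_comp_smul volume (fun x => ‖f x‖), abs_of_pos (by positivity), smul_eq_mul]

end IsKernelSymbol

theorem kernelOf_const_mul (f : V → ℂ) (c : ℝ) (x : V) :
    kernelOf (fun ξ => (c : ℂ) * f ξ) x = c * kernelOf f x := by
  rw [kernelOf, kernelOf, Real.fourierInv_eq, Real.fourierInv_eq, ← Complex.re_ofReal_mul,
    ← integral_const_mul]
  congr 2
  funext ξ
  rw [mul_smul_comm]

/-- The symbol of `(a · ∇) exp (-t (-Δ)^(β/2))`. -/
def gradSymbol (β t : ℝ) (a ξ : V) : ℂ :=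
  2 * Real.pi * Complex.I * ((inner ℝ ξ a : ℝ) : ℂ) * fracSymbol β t ξ

theorem gradSymbol_add (β s t : ℝ) (a ξ : V) :
    gradSymbol β (s + t) a ξ = fracSymbol β s ξ * gradSymbol β t a ξ := by
  rw [gradSymbol, gradSymbol, fracSymbol_add]; ring

theorem fracSymbol_eq_comp_smul {β t : ℝ} (hβ : β ≠ 0) (ht : 0 < t) :
    (fracSymbol β t : V → ℂ) = fun ξ => fracSymbol β 1 (t ^ β⁻¹ • ξ) := by
  funext ξ
  rw [fracSymbol_smul _ _ (by positivity), ← Real.rpow_mul ht.le, inv_mul_cancel₀ hβ,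
    Real.rpow_one, mul_one]

theorem gradSymbol_eq_comp_smul {β t : ℝ} (hβ : β ≠ 0) (ht : 0 < t) (a : V) :
    (gradSymbol β t a : V → ℂ) =
      fun ξ => (((t ^ β⁻¹)⁻¹ : ℝ) : ℂ) * gradSymbol β 1 a (t ^ β⁻¹ • ξ) := by
  funext ξ
  have hc : 0 < t ^ β⁻¹ := by positivity
  have hc' : ((t ^ β⁻¹ : ℝ) : ℂ) ≠ 0 := by exact_mod_cast hc.ne'
  rw [gradSymbol, gradSymbol, fracSymbol_eq_comp_smul hβ ht, real_inner_smul_left]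
  generalize t ^ β⁻¹ = c at hc'
  push_cast
  field_simp

theorem isKernelSymbol_fracSymbol {β : ℝ} (hβ : 1 ≤ β) {t : ℝ} (ht : 0 < t) :
    IsKernelSymbol (fracSymbol β t : V → ℂ) := by
  rw [fracSymbol_eq_comp_smul (by linarith) ht]
  refine IsKernelSymbol.comp_smul ⟨continuous_fracSymbol (by linarith) 1,
    integrable_fracSymbol hβ one_pos, fun ξ => ?_, integrable_fourierInv_fracSymbol hβ⟩
      (by positivity)
  rw [fracSymbol_neg, fracSymbol, Complex.conj_ofReal]

theorem isKernelSymbol_gradSymbol {β : ℝ} (hβ : 1 ≤ β) {t : ℝ} (ht : 0 < t) (a : V) :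
    IsKernelSymbol (gradSymbol β t a : V → ℂ) := by
  rw [gradSymbol_eq_comp_smul (by linarith) ht]
  have hc := continuous_fracSymbol (V := V) (β := β) (by linarith) 1
  refine IsKernelSymbol.const_mul (f := fun ξ => gradSymbol β 1 a (t ^ β⁻¹ • ξ))
    (IsKernelSymbol.comp_smul ⟨?_, ?_, fun ξ => ?_, ?_⟩ (by positivity)) _
  · unfold gradSymbol; fun_prop
  · unfold gradSymbol
    simpa only [mul_assoc] using
      (integrable_inner_mul_fracSymbol hβ one_pos a).const_mul (2 * Real.pi * Complex.I)
  · simp only [gradSymbol, fracSymbol_neg, inner_neg_left, map_mul, Complex.conj_ofReal,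
      Complex.conj_I, map_ofNat, map_neg, Complex.ofReal_neg]
    rw [fracSymbol, Complex.conj_ofReal]
    ring
  · refine ((integrable_fourierInv_inner_mul_fracSymbol hβ a).const_mul
      (2 * Real.pi * Complex.I)).congr (Eventually.of_forall fun x => ?_)
    simp only
    rw [Real.fourierInv_eq, Real.fourierInv_eq, ← integral_const_mul]
    congr 1
    funext ξ
    rw [mul_smul_comm, gradSymbol, mul_assoc (2 * (Real.pi : ℂ) * Complex.I)]

/-- Differentiation under the integral sign, allowed because `|ξ|` times the symbol is integrable,
brings down the factor `2πi ⟨ξ, a⟩`. -/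
theorem fderiv_kernelOf_fracSymbol {β : ℝ} (hβ : 1 ≤ β) {t : ℝ} (ht : 0 < t) (x a : V) :
    fderiv ℝ (kernelOf (fracSymbol β t)) x a = kernelOf (gradSymbol β t a) x := by
  set m : V → ℂ := fracSymbol β t with hm
  have h1 : Integrable fun ξ => ‖ξ‖ * ‖m ξ‖ := by
    simpa using integrable_pow_mul_fracSymbol (V := V) hβ 1 ht
  have h0 : Integrable m := integrable_fracSymbol hβ ht
  have hd := Real.hasFDerivAt_fourier h0 h1 (-x)
  have hI : Integrable (VectorFourier.fourierSMulRight (innerSL ℝ) m) := by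
    refine (h1.const_mul (2 * Real.pi * ‖(innerSL ℝ : V →L[ℝ] V →L[ℝ] ℝ)‖)).mono'
      h0.1.fourierSMulRight (Eventually.of_forall fun ξ => ?_)
    refine (VectorFourier.norm_fourierSMulRight_le _ _ _).trans (le_of_eq (by ring))
  have hcomp : HasFDerivAt (kernelOf m)
      ((Complex.reCLM.comp (𝓕 (VectorFourier.fourierSMulRight (innerSL ℝ) m) (-x))).comp
        (-ContinuousLinearMap.id ℝ V)) x := by
    have h2 : kernelOf m = (Complex.reCLM ∘ 𝓕 m) ∘ fun y => -y := by
      funext y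
      simp [kernelOf, Real.fourierInv_eq_fourier_neg]
    rw [h2]
    exact (Complex.reCLM.hasFDerivAt.comp (-x) hd).comp x (hasFDerivAt_id x).neg
  rw [hcomp.fderiv]
  simp only [ContinuousLinearMap.comp_apply, neg_apply,
    ContinuousLinearMap.id_apply, map_neg, Complex.reCLM_apply]
  have hap : (𝓕 (VectorFourier.fourierSMulRight (innerSL ℝ) m) (-x)) a =
      𝓕 (fun ξ => VectorFourier.fourierSMulRight (innerSL ℝ) m ξ a) (-x) :=
    Real.fourier_continuousLinearMap_apply hI
  rw [hap, kernelOf, Real.fourierInv_eq_fourier_neg,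
    ← Complex.neg_re, Real.fourier_eq, Real.fourier_eq, ← integral_neg]
  congr 2
  funext ξ
  rw [VectorFourier.fourierSMulRight_apply, ← smul_neg, gradSymbol]
  congr 1
  simp only [hm, Complex.real_smul, smul_eq_mul, neg_mul, neg_neg]
  have hin : ((innerSL ℝ : V →L[ℝ] V →L[ℝ] ℝ) ξ) a = inner ℝ ξ a := rfl
  erw [hin]
  ring

/-- By scaling, the symbol at time `t` is the one at time `1` dilated by `t^{1/β}`: the `L¹` norm of
the kernel is invariant, and the sup bound by the `L¹` norm of the symbol picks up the Jacobian. -/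
theorem exists_integral_norm_fracSymbol_le {β : ℝ} (hβ : 1 ≤ β) :
    ∃ A : ℝ, 0 ≤ A ∧ ∀ t : ℝ, 0 < t → (∫ x : V, ‖kernelOf (fracSymbol β t) x‖) ≤ A ∧
      ∀ x : V, ‖kernelOf (fracSymbol β t) x‖ ≤ A * t ^ (-(Module.finrank ℝ V / β)) := by
  refine ⟨max (∫ x : V, ‖kernelOf (fracSymbol β 1) x‖) (∫ ξ : V, ‖fracSymbol β 1 ξ‖),
    le_max_of_le_left (by positivity), fun t ht => ⟨?_, fun x => ?_⟩⟩
  · rw [fracSymbol_eq_comp_smul (by linarith) ht,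
      IsKernelSymbol.integral_norm_kernelOf_comp_smul (by positivity)]
    exact le_max_left _ _
  · refine (IsKernelSymbol.norm_kernelOf_le x).trans ?_
    rw [fracSymbol_eq_comp_smul (by linarith) ht,
      IsKernelSymbol.integral_norm_comp_smul (by positivity), mul_comm, ← Real.rpow_natCast,
      ← Real.rpow_mul ht.le, ← Real.rpow_neg ht.le, inv_mul_eq_div]
    gcongr
    exact le_max_right _ _

theorem exists_integral_norm_gradSymbol_le {β : ℝ} (hβ : 1 ≤ β) (a : V) :
    ∃ A : ℝ, 0 ≤ A ∧ ∀ t : ℝ, 0 < t →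
      (∫ x : V, ‖kernelOf (gradSymbol β t a) x‖) ≤ A * t ^ (-(1 / β)) ∧
      ∀ x : V, ‖kernelOf (gradSymbol β t a) x‖
        ≤ A * t ^ (-(1 / β)) * t ^ (-(Module.finrank ℝ V / β)) := by
  refine ⟨max (∫ x : V, ‖kernelOf (gradSymbol β 1 a) x‖) (∫ ξ : V, ‖gradSymbol β 1 a ξ‖),
    le_max_of_le_left (by positivity), fun t ht => ?_⟩
  have hc : (t ^ β⁻¹)⁻¹ = t ^ (-(1 / β)) := by rw [← Real.rpow_neg ht.le, one_div]
  refine ⟨?_, fun x => ?_⟩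
  · rw [gradSymbol_eq_comp_smul (by linarith) ht]
    simp_rw [kernelOf_const_mul, norm_mul]
    rw [integral_const_mul, Real.norm_of_nonneg (by positivity), hc, mul_comm,
      IsKernelSymbol.integral_norm_kernelOf_comp_smul (f := gradSymbol β 1 a) (by positivity)]
    gcongr
    exact le_max_left _ _
  · refine (IsKernelSymbol.norm_kernelOf_le x).trans ?_
    rw [gradSymbol_eq_comp_smul (by linarith) ht]
    simp_rw [norm_mul, Complex.norm_real]
    rw [integral_const_mul, Real.norm_of_nonneg (by positivity), hc,
      IsKernelSymbol.integral_norm_comp_smul (f := gradSymbol β 1 a) (by positivity),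
      ← Real.rpow_natCast (t ^ β⁻¹),
      ← Real.rpow_mul ht.le β⁻¹, ← Real.rpow_neg ht.le, inv_mul_eq_div]
    calc _ = (∫ ξ : V, ‖gradSymbol β 1 a ξ‖) * t ^ (-(1 / β)) *
          t ^ (-(Module.finrank ℝ V / β)) := by ring
      _ ≤ _ := by gcongr; exact le_max_right _ _

end Kernels

/-! ### Convolution operators between Lebesgue spaces -/

section Convolution

variable {V : Type*} [NormedAddCommGroup V] [InnerProductSpace ℝ V] [FiniteDimensional ℝ V]
  [MeasurableSpace V] [BorelSpace V] {𝕜 : Type*} [RCLike 𝕜]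

/-- A continuous kernel with `L¹` norm at most `A` and sup norm at most `M`. -/
structure IsConvKernel (k : V → ℝ) (A M : ℝ) : Prop where
  continuous : Continuous k
  integrable : Integrable k
  integral_norm_le : ∫ x, ‖k x‖ ≤ A
  norm_le : ∀ x, ‖k x‖ ≤ M

/-- Convolution with a real kernel. -/
def convKernel (k : V → ℝ) (f : V → 𝕜) (x : V) : 𝕜 := ∫ y, k (x - y) • f y

theorem convKernel_congr_ae (k : V → ℝ) {f g : V → 𝕜} (h : f =ᵐ[volume] g) :
    convKernel k f = convKernel k g := by
  funext x
  exact integral_congr_ae (by filter_upwards [h] with y hy; rw [hy])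

namespace IsConvKernel

variable {k l : V → ℝ} {A M B N : ℝ}

theorem nonneg_left (hk : IsConvKernel k A M) : 0 ≤ A :=
  (integral_nonneg fun _ => norm_nonneg _).trans hk.integral_norm_le

theorem nonneg_right (hk : IsConvKernel k A M) : 0 ≤ M := (norm_nonneg _).trans (hk.norm_le 0)

theorem norm (hk : IsConvKernel k A M) : IsConvKernel (fun x => ‖k x‖) A M where
  continuous := hk.continuous.norm
  integrable := hk.integrable.norm
  integral_norm_le := by simpa using hk.integral_norm_le
  norm_le x := by simpa using hk.norm_le x

theorem lintegral_enorm_sub_le (hk : IsConvKernel k A M) (x : V) :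
    ∫⁻ y, ‖k (x - y)‖ₑ ≤ ENNReal.ofReal A := by
  rw [lintegral_sub_left_eq_self (fun y => ‖k y‖ₑ) x,
    ← ofReal_integral_norm_eq_lintegral_enorm hk.integrable]
  exact ENNReal.ofReal_le_ofReal hk.integral_norm_le

theorem lintegral_enorm_sub_right_le (hk : IsConvKernel k A M) (y : V) :
    ∫⁻ x, ‖k (x - y)‖ₑ ≤ ENNReal.ofReal A := by
  rw [lintegral_sub_right_eq_self (fun y => ‖k y‖ₑ) y,
    ← ofReal_integral_norm_eq_lintegral_enorm hk.integrable]
  exact ENNReal.ofReal_le_ofReal hk.integral_norm_le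

theorem enorm_le (hk : IsConvKernel k A M) (x : V) : ‖k x‖ₑ ≤ ENNReal.ofReal M := by
  rw [← ofReal_norm]; exact ENNReal.ofReal_le_ofReal (hk.norm_le x)

theorem measurable_enorm_sub (hk : IsConvKernel k A M) (x : V) :
    Measurable fun y => ‖k (x - y)‖ₑ := by
  have := hk.continuous
  exact (by fun_prop : Continuous fun y => ‖k (x - y)‖ₑ).measurable

/-- Hölder's inequality with `|k| |f| = (|k| |f|^s)^{1/s} · |k|^{1-1/s}`. -/
theorem lintegral_mul_le (hk : IsConvKernel k A M) {f : V → 𝕜} (hf : AEStronglyMeasurable f)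
    {s : ℝ} (hs : 1 ≤ s) (x : V) :
    ∫⁻ y, ‖k (x - y)‖ₑ * ‖f y‖ₑ ≤
      (∫⁻ y, ‖k (x - y)‖ₑ * ‖f y‖ₑ ^ s) ^ s⁻¹ * ENNReal.ofReal A ^ (1 - s⁻¹) := by
  have hs0 : 0 < s := by linarith
  have hs1 : 0 ≤ 1 - s⁻¹ := sub_nonneg.2 (inv_le_one_of_one_le₀ hs)
  have hm := hk.measurable_enorm_sub x
  calc ∫⁻ y, ‖k (x - y)‖ₑ * ‖f y‖ₑ
      = ∫⁻ y, (‖k (x - y)‖ₑ * ‖f y‖ₑ ^ s) ^ s⁻¹ * ‖k (x - y)‖ₑ ^ (1 - s⁻¹) := by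
        refine lintegral_congr fun y => ?_
        rw [ENNReal.mul_rpow_of_nonneg _ _ (by positivity), ENNReal.rpow_rpow_inv hs0.ne',
          mul_right_comm, ← ENNReal.rpow_add_of_nonneg _ _ (by positivity) hs1,
          add_sub_cancel, ENNReal.rpow_one]
    _ ≤ (∫⁻ y, ‖k (x - y)‖ₑ * ‖f y‖ₑ ^ s) ^ s⁻¹ * (∫⁻ y, ‖k (x - y)‖ₑ) ^ (1 - s⁻¹) :=
        ENNReal.lintegral_mul_norm_pow_le (hm.aemeasurable.mul (hf.enorm.pow_const s))
          hm.aemeasurable (by positivity) hs1 (by ring)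
    _ ≤ _ := by gcongr; exact hk.lintegral_enorm_sub_le x

theorem lintegral_lintegral_mul_le (hk : IsConvKernel k A M) {f : V → ℝ≥0∞} (hf : AEMeasurable f) :
    ∫⁻ x, ∫⁻ y, ‖k (x - y)‖ₑ * f y ≤ ENNReal.ofReal A * ∫⁻ y, f y := by
  have hm : Measurable fun z : V × V => ‖k (z.1 - z.2)‖ₑ := by
    have := hk.continuous
    exact (by fun_prop : Continuous fun z : V × V => ‖k (z.1 - z.2)‖ₑ).measurable
  rw [lintegral_lintegral_swap (hm.aemeasurable.mul
    (hf.comp_quasiMeasurePreserving Measure.quasiMeasurePreserving_snd)),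
    ← lintegral_const_mul'' _ hf]
  refine lintegral_mono fun y => ?_
  have hm' : Measurable fun x => ‖k (x - y)‖ₑ := hm.comp measurable_prodMk_right
  simp only
  rw [lintegral_mul_const _ hm']
  gcongr
  exact hk.lintegral_enorm_sub_right_le y

variable {s e : ℝ≥0∞}

theorem lintegral_mul_lt_top (hk : IsConvKernel k A M) {f : V → 𝕜} (hs : 1 ≤ s) (hs' : s ≠ ∞)
    (hf : MemLp f s) (x : V) : ∫⁻ y, ‖k (x - y)‖ₑ * ‖f y‖ₑ < ∞ := by
  have hs1 : 1 ≤ s.toReal := by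
    rw [← ENNReal.toReal_one]; exact ENNReal.toReal_mono hs' hs
  refine (hk.lintegral_mul_le hf.1 hs1 x).trans_lt (ENNReal.mul_lt_top ?_ ?_)
  · refine ENNReal.rpow_lt_top_of_nonneg (by positivity) (ne_of_lt ?_)
    calc ∫⁻ y, ‖k (x - y)‖ₑ * ‖f y‖ₑ ^ s.toReal
        ≤ ∫⁻ y, ENNReal.ofReal M * ‖f y‖ₑ ^ s.toReal := by
          gcongr with y; exact hk.enorm_le _
      _ = ENNReal.ofReal M * ∫⁻ y, ‖f y‖ₑ ^ s.toReal :=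
          lintegral_const_mul' _ _ ENNReal.ofReal_ne_top
      _ < ∞ := ENNReal.mul_lt_top ENNReal.ofReal_lt_top
          (lintegral_rpow_enorm_lt_top_of_eLpNorm_lt_top (by positivity) hs' hf.2)
  · exact ENNReal.rpow_lt_top_of_nonneg (sub_nonneg.2 (inv_le_one_of_one_le₀ hs1))
      ENNReal.ofReal_ne_top

theorem integrable_smul (hk : IsConvKernel k A M) {f : V → 𝕜} (hs : 1 ≤ s) (hs' : s ≠ ∞)
    (hf : MemLp f s) (x : V) : Integrable fun y => k (x - y) • f y := by
  have := hk.continuous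
  refine ⟨(by fun_prop : Continuous fun y => k (x - y)).aestronglyMeasurable.smul hf.1, ?_⟩
  refine lt_of_eq_of_lt (lintegral_congr fun y => ?_) (hk.lintegral_mul_lt_top hs hs' hf x)
  rw [enorm_smul]

theorem enorm_convKernel_le (f : V → 𝕜) (x : V) :
    ‖convKernel k f x‖ₑ ≤ ∫⁻ y, ‖k (x - y)‖ₑ * ‖f y‖ₑ := by
  refine (enorm_integral_le_lintegral_enorm _).trans (le_of_eq (lintegral_congr fun y => ?_))
  rw [enorm_smul]

theorem stronglyMeasurable_convKernel (hk : IsConvKernel k A M) {f : V → 𝕜}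
    (hf : AEStronglyMeasurable f) : StronglyMeasurable (convKernel k f) := by
  rw [convKernel_congr_ae k hf.ae_eq_mk]
  have := hk.continuous
  refine StronglyMeasurable.integral_prod_right (f := fun x y => k (x - y) • hf.mk f y) ?_
  exact (by fun_prop : Continuous fun z : V × V => k (z.1 - z.2)).stronglyMeasurable.smul
    (hf.stronglyMeasurable_mk.comp_measurable measurable_snd)

/-- **Young's convolution inequality**, with the norm of the kernel interpolated between `L¹`
and `L^∞`. -/
theorem eLpNorm_convKernel_le (hk : IsConvKernel k A M) {f : V → 𝕜} (hs : 1 ≤ s) (hse : s ≤ e)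
    (he : e ≠ ∞) (hf : MemLp f s) :
    eLpNorm (convKernel k f) e ≤ ENNReal.ofReal (A ^ (1 - (s.toReal⁻¹ - e.toReal⁻¹)) *
      M ^ (s.toReal⁻¹ - e.toReal⁻¹)) * eLpNorm f s := by
  have hs' : s ≠ ∞ := ne_top_of_le_ne_top he hse
  have hA := hk.nonneg_left
  have hM := hk.nonneg_right
  set s₀ := s.toReal with hs₀
  set e₀ := e.toReal with he₀
  have hs1 : 1 ≤ s₀ := by
    rw [← ENNReal.toReal_one]; exact ENNReal.toReal_mono hs' hs
  have hs0 : 0 < s₀ := by linarith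
  have hse0 : s₀ ≤ e₀ := ENNReal.toReal_mono he hse
  have he0 : 0 < e₀ := by linarith
  have hsi : 0 ≤ 1 - s₀⁻¹ := sub_nonneg.2 (inv_le_one_of_one_le₀ hs1)
  have hr : 0 ≤ e₀ * s₀⁻¹ - 1 := by
    rw [← div_eq_mul_inv, sub_nonneg, one_le_div hs0]; exact hse0
  have hδ : 0 ≤ s₀⁻¹ - e₀⁻¹ := sub_nonneg.2 (inv_anti₀ hs0 hse0)
  have hes : s ≠ 0 := (zero_lt_one.trans_le hs).ne'
  have hee : e ≠ 0 := (zero_lt_one.trans_le (hs.trans hse)).ne'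
  set L := ∫⁻ y, ‖f y‖ₑ ^ s₀ with hL
  set a := ENNReal.ofReal A with ha
  set m := ENNReal.ofReal M with hm
  have hfs : eLpNorm f s = L ^ s₀⁻¹ := by
    rw [eLpNorm_eq_lintegral_rpow_enorm_toReal hes hs', one_div]
  -- With `Φ = |k| * |f|^s`, the power `Φ^{e/s}` is split as `Φ^{e/s-1} · Φ`. The first factor is at
  -- most `(M ‖f‖_s^s)^{e/s-1}`, and the second is integrated by Tonelli at the cost of `A`.
  have hpt : ∀ x, ‖convKernel k f x‖ₑ ^ e₀ ≤
      (m * L) ^ (e₀ * s₀⁻¹ - 1) * a ^ (e₀ * (1 - s₀⁻¹)) *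
        ∫⁻ y, ‖k (x - y)‖ₑ * ‖f y‖ₑ ^ s₀ := by
    intro x
    set Φ := ∫⁻ y, ‖k (x - y)‖ₑ * ‖f y‖ₑ ^ s₀ with hΦ
    have hΦle : Φ ≤ m * L := by
      rw [hL, ← lintegral_const_mul' _ _ ENNReal.ofReal_ne_top]
      exact lintegral_mono fun y => mul_le_mul' (hk.enorm_le _) le_rfl
    calc ‖convKernel k f x‖ₑ ^ e₀ ≤ (Φ ^ s₀⁻¹ * a ^ (1 - s₀⁻¹)) ^ e₀ := by
          gcongr
          exact (enorm_convKernel_le f x).trans (hk.lintegral_mul_le hf.1 hs1 x)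
      _ = Φ ^ (e₀ * s₀⁻¹ - 1 + 1) * a ^ (e₀ * (1 - s₀⁻¹)) := by
          rw [ENNReal.mul_rpow_of_nonneg _ _ he0.le, ← ENNReal.rpow_mul, ← ENNReal.rpow_mul]
          congr 2 <;> ring
      _ = Φ ^ (e₀ * s₀⁻¹ - 1) * a ^ (e₀ * (1 - s₀⁻¹)) * Φ := by
          rw [ENNReal.rpow_add_of_nonneg _ _ hr zero_le_one, ENNReal.rpow_one]; ring
      _ ≤ _ := by gcongr
  rw [eLpNorm_eq_lintegral_rpow_enorm_toReal hee he, ← he₀, hfs, one_div]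
  have hLfin : L ≠ ∞ :=
    (lintegral_rpow_enorm_lt_top_of_eLpNorm_lt_top hes hs' hf.2).ne
  calc (∫⁻ x, ‖convKernel k f x‖ₑ ^ e₀) ^ e₀⁻¹
      ≤ ((m * L) ^ (e₀ * s₀⁻¹ - 1) * a ^ (e₀ * (1 - s₀⁻¹)) * (a * L)) ^ e₀⁻¹ := by
        gcongr
        refine (lintegral_mono hpt).trans ?_
        rw [lintegral_const_mul']
        · gcongr
          exact hk.lintegral_lintegral_mul_le (hf.1.enorm.pow_const s₀)
        · refine ENNReal.mul_ne_top (ENNReal.rpow_ne_top_of_nonneg hr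
            (ENNReal.mul_ne_top ENNReal.ofReal_ne_top hLfin))
            (ENNReal.rpow_ne_top_of_nonneg (by positivity) ENNReal.ofReal_ne_top)
    _ = ((a ^ (e₀ * (1 - s₀⁻¹)) * a ^ (1 : ℝ)) * m ^ (e₀ * s₀⁻¹ - 1) *
          (L ^ (e₀ * s₀⁻¹ - 1) * L ^ (1 : ℝ))) ^ e₀⁻¹ := by
        rw [ENNReal.mul_rpow_of_nonneg _ _ hr, ENNReal.rpow_one, ENNReal.rpow_one]
        congr 1; ring
    _ = a ^ (1 - (s₀⁻¹ - e₀⁻¹)) * m ^ (s₀⁻¹ - e₀⁻¹) * L ^ s₀⁻¹ := by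
        rw [← ENNReal.rpow_add_of_nonneg _ _ (by positivity) zero_le_one,
          ← ENNReal.rpow_add_of_nonneg _ _ hr zero_le_one,
          ENNReal.mul_rpow_of_nonneg _ _ (by positivity),
          ENNReal.mul_rpow_of_nonneg _ _ (by positivity), ← ENNReal.rpow_mul, ← ENNReal.rpow_mul,
          ← ENNReal.rpow_mul]
        congr 3 <;> field_simp <;> ring
    _ = _ := by
        have h1 : 0 ≤ 1 - (s₀⁻¹ - e₀⁻¹) := by
          have : 0 ≤ e₀⁻¹ := by positivity
          linarith
        rw [ENNReal.ofReal_mul (by positivity), ENNReal.ofReal_rpow_of_nonneg hA h1,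
          ENNReal.ofReal_rpow_of_nonneg hM hδ]

theorem memLp_convKernel (hk : IsConvKernel k A M) {f : V → 𝕜} (hs : 1 ≤ s) (hse : s ≤ e)
    (he : e ≠ ∞) (hf : MemLp f s) : MemLp (convKernel k f) e :=
  ⟨(hk.stronglyMeasurable_convKernel hf.1).aestronglyMeasurable,
    (hk.eLpNorm_convKernel_le hs hse he hf).trans_lt (ENNReal.mul_lt_top ENNReal.ofReal_lt_top hf.2)⟩

/-- Associativity of convolution. -/
theorem convKernel_convKernel (hk : IsConvKernel k A M) (hl : IsConvKernel l B N) {f : V → 𝕜}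
    (hs : 1 ≤ s) (hs' : s ≠ ∞) (hf : MemLp f s) (x : V) :
    convKernel k (convKernel l f) x =
      convKernel (fun z => ∫ y, k (z - y) * l y) f x := by
  have hkc := hk.continuous
  have hlc := hl.continuous
  have hmeas : AEStronglyMeasurable (fun z : V × V => k (x - z.1) • l (z.1 - z.2) • f z.2)
      (volume.prod volume) := by
    refine (by fun_prop : Continuous fun z : V × V => k (x - z.1)).aestronglyMeasurable.smul
      ((by fun_prop : Continuous fun z : V × V => l (z.1 - z.2)).aestronglyMeasurable.smul ?_)
    exact hf.1.comp_quasiMeasurePreserving Measure.quasiMeasurePreserving_snd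
  have hint : Integrable (fun z : V × V => k (x - z.1) • l (z.1 - z.2) • f z.2)
      (volume.prod volume) := by
    refine ⟨hmeas, ?_⟩
    rw [hasFiniteIntegral_iff_enorm, lintegral_prod _ hmeas.enorm]
    have hfn : MemLp (fun y => ‖f y‖) s := hf.norm
    have hg : MemLp (convKernel (𝕜 := ℝ) (fun z => ‖l z‖) fun y => ‖f y‖) s :=
      hl.norm.memLp_convKernel hs le_rfl hs' hfn
    refine lt_of_eq_of_lt (lintegral_congr fun y => ?_) (hk.lintegral_mul_lt_top hs hs' hg x)
    have h1 := hl.norm.integrable_smul hs hs' hfn y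
    rw [convKernel, ← ofReal_norm (∫ z, _), Real.norm_of_nonneg
      (integral_nonneg fun z => by positivity),
      ofReal_integral_eq_lintegral_ofReal h1 (Eventually.of_forall fun z => by positivity),
      ← lintegral_const_mul' _ _ (by simp)]
    refine lintegral_congr fun z => ?_
    rw [enorm_smul, enorm_smul, smul_eq_mul, ENNReal.ofReal_mul (norm_nonneg _), ofReal_norm,
      ofReal_norm]
  unfold convKernel
  have e1 : ∀ y, k (x - y) • ∫ z, l (y - z) • f z = ∫ z, k (x - y) • l (y - z) • f z :=
    fun y => (integral_smul _ _).symm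
  simp_rw [e1]
  rw [integral_integral_swap hint]
  refine integral_congr_ae (Eventually.of_forall fun z => ?_)
  simp only [smul_smul]
  rw [integral_smul_const]
  congr 1
  rw [← integral_sub_right_eq_self (fun y => k (x - z - y) * l y) z]
  congr 1
  funext y
  congr 2
  abel

end IsConvKernel

/-- Convolution with the kernel `k` as an operator from `L^s` to `L^e`, if there is one. -/
def convLp (k : V → ℝ) (s e : ℝ≥0∞) [Fact (1 ≤ s)] [Fact (1 ≤ e)] :
    Lp 𝕜 s (volume : Measure V) →L[ℝ] Lp 𝕜 e (volume : Measure V) :=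
  open scoped Classical in
  if h : ∃ L : Lp 𝕜 s (volume : Measure V) →L[ℝ] Lp 𝕜 e (volume : Measure V),
      ∀ f, L f =ᵐ[volume] convKernel k f then h.choose else 0

namespace IsConvKernel

variable {k l : V → ℝ} {A M B N : ℝ} {s e : ℝ≥0∞} [hs : Fact (1 ≤ s)] [Fact (1 ≤ e)]

theorem norm_toLp_convKernel_le (hk : IsConvKernel k A M) (hse : s ≤ e) (he : e ≠ ∞)
    (f : Lp 𝕜 s (volume : Measure V)) :
    ‖(hk.memLp_convKernel hs.out hse he (Lp.memLp f)).toLp _‖ ≤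
      A ^ (1 - (s.toReal⁻¹ - e.toReal⁻¹)) * M ^ (s.toReal⁻¹ - e.toReal⁻¹) * ‖f‖ := by
  have hA := hk.nonneg_left
  have hM := hk.nonneg_right
  rw [Lp.norm_toLp, Lp.norm_def]
  refine (ENNReal.toReal_mono ?_ (hk.eLpNorm_convKernel_le hs.out hse he (Lp.memLp f))).trans ?_
  · exact ENNReal.mul_ne_top ENNReal.ofReal_ne_top (Lp.eLpNorm_ne_top f)
  · rw [ENNReal.toReal_mul, ENNReal.toReal_ofReal (by positivity)]

theorem exists_convLp (hk : IsConvKernel k A M) (hse : s ≤ e) (he : e ≠ ∞) :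
    ∃ L : Lp 𝕜 s (volume : Measure V) →L[ℝ] Lp 𝕜 e (volume : Measure V),
      ∀ f, L f =ᵐ[volume] convKernel k f := by
  have hs' : s ≠ ∞ := ne_top_of_le_ne_top he hse
  have hmem := fun f : Lp 𝕜 s (volume : Measure V) =>
    hk.memLp_convKernel hs.out hse he (Lp.memLp f)
  have hi := fun (f : Lp 𝕜 s (volume : Measure V)) (x : V) =>
    hk.integrable_smul hs.out hs' (Lp.memLp f) x
  refine ⟨LinearMap.mkContinuous
    { toFun := fun f => (hmem f).toLp _
      map_add' := fun f g => ?_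
      map_smul' := fun c f => ?_ }
    (A ^ (1 - (s.toReal⁻¹ - e.toReal⁻¹)) * M ^ (s.toReal⁻¹ - e.toReal⁻¹))
    fun f => hk.norm_toLp_convKernel_le hse he f, fun f => (hmem f).coeFn_toLp⟩
  · have h1 : convKernel k ⇑(f + g) = convKernel k f + convKernel k g := by
      rw [convKernel_congr_ae k (Lp.coeFn_add f g)]
      funext x
      simp only [convKernel, Pi.add_apply, smul_add]
      exact integral_add (hi f x) (hi g x)
    rw [← MemLp.toLp_add]
    exact MemLp.toLp_congr _ _ (by rw [h1])
  · have h1 : convKernel k ⇑(c • f) = c • convKernel k f := by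
      rw [convKernel_congr_ae k (Lp.coeFn_smul c f)]
      funext x
      simp only [convKernel, Pi.smul_apply]
      rw [← integral_smul]
      simp_rw [smul_comm c]
    rw [RingHom.id_apply, ← MemLp.toLp_const_smul]
    exact MemLp.toLp_congr _ _ (by rw [h1])

theorem coeFn_convLp (hk : IsConvKernel k A M) (hse : s ≤ e) (he : e ≠ ∞)
    (f : Lp 𝕜 s (volume : Measure V)) : convLp (𝕜 := 𝕜) k s e f =ᵐ[volume] convKernel k f := by
  rw [convLp, dif_pos (hk.exists_convLp hse he)]
  exact (hk.exists_convLp hse he).choose_spec f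

theorem norm_convLp_le (hk : IsConvKernel k A M) (hse : s ≤ e) (he : e ≠ ∞)
    (f : Lp 𝕜 s (volume : Measure V)) :
    ‖convLp (𝕜 := 𝕜) k s e f‖ ≤
      A ^ (1 - (s.toReal⁻¹ - e.toReal⁻¹)) * M ^ (s.toReal⁻¹ - e.toReal⁻¹) * ‖f‖ := by
  have h : convLp (𝕜 := 𝕜) k s e f =
      (hk.memLp_convKernel hs.out hse he (Lp.memLp f)).toLp _ :=
    Lp.ext ((hk.coeFn_convLp hse he f).trans (MemLp.coeFn_toLp _).symm)
  rw [h]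
  exact hk.norm_toLp_convKernel_le hse he f

/-- Transfers a convolution identity between kernels, here the semigroup laws, to the operators on
Lebesgue classes. -/
theorem convLp_convLp (hk : IsConvKernel k A M) (hl : IsConvKernel l B N) {m : V → ℝ} {C K : ℝ}
    (hm : IsConvKernel m C K) (hmkl : ∀ x, m x = ∫ y, k (x - y) * l y) {e' : ℝ≥0∞}
    [Fact (1 ≤ e')] (hse : s ≤ e) (hee : e ≤ e') (he' : e' ≠ ∞)
    (f : Lp 𝕜 s (volume : Measure V)) :
    convLp (𝕜 := 𝕜) m s e' f = convLp (𝕜 := 𝕜) k e e' (convLp (𝕜 := 𝕜) l s e f) := by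
  have he : e ≠ ∞ := ne_top_of_le_ne_top he' hee
  refine Lp.ext ((hm.coeFn_convLp (hse.trans hee) he' f).trans
    (EventuallyEq.trans ?_ (hk.coeFn_convLp hee he' _).symm))
  rw [convKernel_congr_ae k (hl.coeFn_convLp hse he f)]
  refine Eventually.of_forall fun x => ?_
  rw [hk.convKernel_convKernel hl hs.out (ne_top_of_le_ne_top he hse) (Lp.memLp f) x, funext hmkl]

end IsConvKernel

end Convolution

/-! ### Strong continuity for positive times -/

section StrongContinuity

variable {E F : Type*} [NormedAddCommGroup E] [NormedSpace ℝ E] [NormedAddCommGroup F]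
  [NormedSpace ℝ F]

/-- Strong continuity for positive times of a family of operators on which a bounded, strongly
continuous semigroup acts. -/
theorem continuousOn_of_semigroup_action {S : ℝ → E →L[ℝ] E} {T : ℝ → F →L[ℝ] E} {C : ℝ}
    (hC : 0 ≤ C) (hS : ∀ t, 0 < t → ∀ x, ‖S t x‖ ≤ C * ‖x‖)
    (hS0 : ∀ x, Tendsto (fun t => S t x) (𝓝[>] 0) (𝓝 x))
    (hadd : ∀ s t, 0 < s → 0 < t → ∀ x, T (s + t) x = S s (T t x)) (x : F) :
    ContinuousOn (fun t => T t x) (Ioi 0) := by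
  have hSS : ∀ s t, 0 < s → 0 < t → ∀ t₀, 0 < t₀ →
      T (s + t + t₀) x = S s (S t (T t₀ x)) := fun s t hs ht t₀ ht₀ => by
    rw [add_assoc, hadd s _ hs (by positivity), hadd t _ ht ht₀]
  intro t ht
  have ht0 : (0 : ℝ) < t := ht
  refine ContinuousAt.continuousWithinAt (Metric.continuousAt_iff.2 fun ε hε => ?_)
  -- Both times are reached from the common time `t / 2`, and `T t₂ x - T t₁ x = S (t₁ - t/2) (S (t₂
  -- - t₁) y - y)`. Only continuity at `0` on the single vector `y` is needed.
  set y := T (t / 2) x with hy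
  have h1 := (Metric.tendsto_nhdsWithin_nhds.1 (hS0 y)) (ε / (C + 1)) (by positivity)
  obtain ⟨δ, hδ, h⟩ := h1
  have key : ∀ t₁ t₂, t / 2 < t₁ → t₁ < t₂ → t₂ - t₁ < δ → dist (T t₂ x) (T t₁ x) < ε := by
    intro t₁ t₂ h1 h2 h3
    have e1 : T t₁ x = S (t₁ - t / 2) y := by
      rw [hy, ← hadd _ _ (by linarith) (by linarith)]; congr 2; ring
    have e2 : T t₂ x = S (t₁ - t / 2) (S (t₂ - t₁) y) := by
      rw [hy, ← hSS _ _ (by linarith) (by linarith) _ (by linarith)]; congr 2; ring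
    have h4 := h (x := t₂ - t₁) (mem_Ioi.2 (by linarith))
      (by rw [Real.dist_eq, sub_zero, abs_of_pos (by linarith)]; exact h3)
    rw [dist_eq_norm] at h4
    rw [e1, e2, dist_eq_norm, ← map_sub]
    calc _ ≤ C * ‖S (t₂ - t₁) y - y‖ := hS _ (by linarith) _
      _ ≤ C * (ε / (C + 1)) := by gcongr
      _ < ε := by
        rw [mul_div_assoc', div_lt_iff₀ (by positivity)]; nlinarith
  refine ⟨min δ (t / 2), by positivity, fun {t'} ht' => ?_⟩
  rw [Real.dist_eq] at ht'
  have h5 := ht'.trans_le (min_le_left _ _)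
  have h6 := abs_lt.1 (ht'.trans_le (min_le_right _ _))
  rcases lt_trichotomy t' t with hlt | rfl | hlt
  · rw [dist_comm]
    rw [abs_sub_comm, abs_of_pos (by linarith)] at h5
    exact key t' t (by linarith) hlt h5
  · simpa using hε
  · rw [abs_of_pos (by linarith)] at h5
    exact key t t' (by linarith) hlt h5

end StrongContinuity

/-! ### The fractional heat semigroup on Lebesgue spaces -/

section HeatSemigroup

variable {V : Type*} [NormedAddCommGroup V] [InnerProductSpace ℝ V] [FiniteDimensional ℝ V]
  [MeasurableSpace V] [BorelSpace V] {𝕜 : Type*} [RCLike 𝕜]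

theorem exists_isConvKernel_fracSymbol (V : Type*) [NormedAddCommGroup V] [InnerProductSpace ℝ V]
    [FiniteDimensional ℝ V] [MeasurableSpace V] [BorelSpace V] {β : ℝ} (hβ : 1 ≤ β) :
    ∃ A : ℝ, 1 ≤ A ∧ ∀ t : ℝ, 0 < t → IsConvKernel (kernelOf (fracSymbol β t : V → ℂ)) A
      (A * t ^ (-(Module.finrank ℝ V / β))) := by
  obtain ⟨A, hA, h⟩ := exists_integral_norm_fracSymbol_le (V := V) hβ
  refine ⟨max A 1, le_max_right _ _, fun t ht => ?_⟩
  have hs := isKernelSymbol_fracSymbol (V := V) hβ ht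
  refine ⟨hs.continuous_kernelOf, hs.integrable_kernelOf, (h t ht).1.trans (le_max_left _ _),
    fun x => ((h t ht).2 x).trans ?_⟩
  gcongr
  exact le_max_left _ _

theorem exists_isConvKernel_gradSymbol {β : ℝ} (hβ : 1 ≤ β) (a : V) :
    ∃ A : ℝ, 0 ≤ A ∧ ∀ t : ℝ, 0 < t → IsConvKernel (kernelOf (gradSymbol β t a : V → ℂ))
      (A * t ^ (-(1 / β))) (A * t ^ (-(1 / β)) * t ^ (-(Module.finrank ℝ V / β))) := by
  obtain ⟨A, hA, h⟩ := exists_integral_norm_gradSymbol_le (V := V) hβ a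
  refine ⟨A, hA, fun t ht => ?_⟩
  have hs := isKernelSymbol_gradSymbol (V := V) hβ ht a
  exact ⟨hs.continuous_kernelOf, hs.integrable_kernelOf, (h t ht).1, (h t ht).2⟩

theorem kernelOf_fracSymbol_add {β : ℝ} (hβ : 1 ≤ β) {s t : ℝ} (hs : 0 < s) (ht : 0 < t) (x : V) :
    kernelOf (fracSymbol β (s + t)) x =
      ∫ y, kernelOf (fracSymbol β s) (x - y) * kernelOf (fracSymbol β t) y := by
  rw [← (isKernelSymbol_fracSymbol hβ hs).kernelOf_mul (isKernelSymbol_fracSymbol hβ ht)]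
  congr 1
  funext ξ
  exact fracSymbol_add β s t ξ

theorem kernelOf_gradSymbol_add {β : ℝ} (hβ : 1 ≤ β) {s t : ℝ} (hs : 0 < s) (ht : 0 < t)
    (a x : V) : kernelOf (gradSymbol β (s + t) a) x =
      ∫ y, kernelOf (fracSymbol β s) (x - y) * kernelOf (gradSymbol β t a) y := by
  rw [← (isKernelSymbol_fracSymbol hβ hs).kernelOf_mul (isKernelSymbol_gradSymbol hβ ht a)]
  congr 1
  funext ξ
  exact gradSymbol_add β s t a ξ

/-- The kernel has integral `1`, its symbol being `1` at `0`, and scaling moves the dependence on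
`t` from the kernel to the translation of `f`. -/
theorem convKernel_fracSymbol_sub {β : ℝ} (hβ : 1 ≤ β) {t : ℝ} (ht : 0 < t) {f : V → 𝕜}
    (hf : Continuous f) (hfc : HasCompactSupport f) (x : V) :
    convKernel (kernelOf (fracSymbol β t)) f x - f x =
      ∫ z, kernelOf (fracSymbol β 1) z • (f (x - t ^ β⁻¹ • z) - f x) := by
  set c := t ^ β⁻¹ with hc
  have hc0 : 0 < c := by positivity
  have hs := isKernelSymbol_fracSymbol (V := V) hβ one_pos
  set k : V → ℝ := kernelOf (fracSymbol β 1) with hk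
  have h1 : ∫ z, k z = 1 := by
    have := hs.integral_kernelOf
    rw [fracSymbol_zero (by linarith)] at this
    exact_mod_cast this
  have h2 : convKernel (kernelOf (fracSymbol β t)) f x = ∫ z, k z • f (x - c • z) := by
    have h3 := integral_sub_left_eq_self
      (fun y => kernelOf (fracSymbol β t) (x - y) • f y) volume x
    simp only [sub_sub_cancel] at h3
    have h4 : ∀ y : V, kernelOf (fracSymbol β t) y =
        (c ^ Module.finrank ℝ V)⁻¹ * k (c⁻¹ • y) := fun y => by
      rw [fracSymbol_eq_comp_smul (by linarith) ht]
      exact IsKernelSymbol.kernelOf_comp_smul hc0 y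
    rw [convKernel, ← h3]
    simp_rw [h4, mul_smul]
    rw [integral_smul]
    have := Measure.integral_comp_smul volume (fun z => k z • f (x - c • z)) c⁻¹
    simp_rw [smul_inv_smul₀ hc0.ne'] at this
    rw [this, smul_smul, inv_pow, inv_inv, abs_of_pos (by positivity),
      inv_mul_cancel₀ (by positivity), one_smul]
  obtain ⟨M, hM⟩ := hfc.exists_bound_of_continuous hf
  have hi : Integrable fun z => k z • f (x - c • z) := by
    refine (hs.integrable_kernelOf.norm.mul_const M).mono' ?_ (Eventually.of_forall fun z => ?_)
    · exact (hs.continuous_kernelOf.smul (by fun_prop)).aestronglyMeasurable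
    · rw [norm_smul]; gcongr; exact hM _
  have hi' : Integrable fun z => k z • f x := hs.integrable_kernelOf.smul_const _
  simp_rw [smul_sub]
  rw [integral_sub hi hi', integral_smul_const, h1, one_smul, h2]

/-- Approximate identity: where `|t^{1/β} z| < δ`, uniform continuity of `f` applies; the remaining
mass of the kernel is small for small `t` by dominated convergence. -/
theorem eventually_norm_convKernel_fracSymbol_sub_le {β : ℝ} (hβ : 1 ≤ β) {f : V → 𝕜}
    (hf : Continuous f) (hfc : HasCompactSupport f) {η : ℝ} (hη : 0 < η) :
    ∀ᶠ t in 𝓝[>] (0 : ℝ), ∀ x, ‖convKernel (kernelOf (fracSymbol β t)) f x - f x‖ ≤ η := by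
  obtain ⟨A, hA, hAk⟩ := exists_isConvKernel_fracSymbol V hβ
  have hk := hAk 1 one_pos
  set k : V → ℝ := kernelOf (fracSymbol β 1) with hkdef
  obtain ⟨M, hM⟩ := hfc.exists_bound_of_continuous hf
  have hM0 : 0 ≤ M := (norm_nonneg _).trans (hM 0)
  obtain ⟨δ, hδ, hfδ⟩ := Metric.uniformContinuous_iff.1
    (hf.uniformContinuous_of_tendsto_cocompact hfc.is_zero_at_infty) (η / (2 * A)) (by positivity)
  have hctend : Tendsto (fun t : ℝ => t ^ β⁻¹) (𝓝[>] 0) (𝓝 0) := by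
    have := (Real.continuousAt_rpow_const 0 β⁻¹ (Or.inr (by positivity))).tendsto
    rw [Real.zero_rpow (inv_ne_zero (by linarith))] at this
    exact this.mono_left nhdsWithin_le_nhds
  have htail : Tendsto (fun t : ℝ => ∫ z, {z : V | δ ≤ ‖t ^ β⁻¹ • z‖}.indicator (fun z => ‖k z‖) z)
      (𝓝[>] 0) (𝓝 (∫ _ : V, (0 : ℝ))) := by
    refine tendsto_integral_filter_of_dominated_convergence (fun z => ‖k z‖) ?_ ?_
      hk.integrable.norm ?_
    · exact Eventually.of_forall fun t => hk.continuous.norm.aestronglyMeasurable.indicator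
        (isClosed_le continuous_const (by fun_prop)).measurableSet
    · refine Eventually.of_forall fun t => Eventually.of_forall fun z => ?_
      refine (norm_indicator_le_norm_self _ _).trans ?_
      simp
    · refine Eventually.of_forall fun z => ?_
      have h1 : Tendsto (fun t : ℝ => ‖t ^ β⁻¹ • z‖) (𝓝[>] 0) (𝓝 0) := by
        simpa using (hctend.smul_const z).norm
      refine tendsto_const_nhds.congr' ?_
      filter_upwards [h1.eventually (gt_mem_nhds hδ)] with t ht
      rw [indicator_of_notMem]
      simpa using ht
  rw [integral_zero] at htail
  filter_upwards [htail.eventually (gt_mem_nhds (show (0 : ℝ) < η / (4 * (M + 1)) by positivity)),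
    self_mem_nhdsWithin] with t ht ht0 x
  rw [convKernel_fracSymbol_sub hβ ht0 hf hfc]
  set U := {z : V | δ ≤ ‖t ^ β⁻¹ • z‖} with hU
  have hUm : MeasurableSet U := (isClosed_le continuous_const (by fun_prop)).measurableSet
  have hint : Integrable (U.indicator fun z => ‖k z‖) := hk.integrable.norm.indicator hUm
  calc _ ≤ ∫ z, (η / (2 * A) * ‖k z‖ + 2 * M * U.indicator (fun z => ‖k z‖) z) := by
        refine norm_integral_le_of_norm_le ((hk.integrable.norm.const_mul _).add
          (hint.const_mul _)) (Eventually.of_forall fun z => ?_)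
        rw [norm_smul]
        by_cases hz : z ∈ U
        · rw [indicator_of_mem hz]
          have : ‖f (x - t ^ β⁻¹ • z) - f x‖ ≤ 2 * M := by
            refine (norm_sub_le _ _).trans ?_
            linarith [hM (x - t ^ β⁻¹ • z), hM x]
          have h0 : 0 ≤ η / (2 * A) * ‖k z‖ := by positivity
          nlinarith [norm_nonneg (k z)]
        · rw [indicator_of_notMem hz, mul_zero, add_zero, mul_comm]
          have hz' : ‖t ^ β⁻¹ • z‖ < δ := by simpa [hU] using hz
          have := hfδ (a := x - t ^ β⁻¹ • z) (b := x) (by simpa [dist_eq_norm] using hz')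
          rw [dist_eq_norm] at this
          gcongr
    _ = η / (2 * A) * (∫ z, ‖k z‖) + 2 * M * ∫ z, U.indicator (fun z => ‖k z‖) z := by
        rw [integral_add (hk.integrable.norm.const_mul _) (hint.const_mul _), integral_const_mul,
          integral_const_mul]
    _ ≤ η / (2 * A) * A + 2 * M * (η / (4 * (M + 1))) := by
        gcongr
        exact hk.integral_norm_le
    _ ≤ η / 2 + η / 2 := by
        gcongr
        · exact le_of_eq (by field_simp)
        · rw [mul_div_assoc', div_le_div_iff₀ (by positivity) (by positivity)]
          nlinarith
    _ = η := by ring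

/-- Interpolation between `L¹` and the sup norm, in the form `|f|^r ≤ η^{r-1} |f|`. -/
theorem eLpNorm_le_of_norm_le {f : V → 𝕜} {η : ℝ} (hη : 0 ≤ η) (hf : ∀ x, ‖f x‖ ≤ η) {r : ℝ≥0∞}
    (hr : 1 ≤ r) (hr' : r ≠ ∞) :
    eLpNorm f r ≤ ENNReal.ofReal (η ^ (1 - r.toReal⁻¹)) * eLpNorm f 1 ^ r.toReal⁻¹ := by
  have hr1 : 1 ≤ r.toReal := by
    rw [← ENNReal.toReal_one]; exact ENNReal.toReal_mono hr' hr
  have hr0 : 0 < r.toReal := by linarith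
  have h1 : 0 ≤ r.toReal - 1 := by linarith
  rw [eLpNorm_eq_lintegral_rpow_enorm_toReal (zero_lt_one.trans_le hr).ne' hr',
    eLpNorm_one_eq_lintegral_enorm, one_div]
  have hpt : ∀ x, ‖f x‖ₑ ^ r.toReal ≤ ENNReal.ofReal η ^ (r.toReal - 1) * ‖f x‖ₑ := by
    intro x
    have h2 : ‖f x‖ₑ ≤ ENNReal.ofReal η := by
      rw [← ofReal_norm]; exact ENNReal.ofReal_le_ofReal (hf x)
    calc ‖f x‖ₑ ^ r.toReal = ‖f x‖ₑ ^ (r.toReal - 1) * ‖f x‖ₑ ^ (1 : ℝ) := by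
          rw [← ENNReal.rpow_add_of_nonneg _ _ h1 zero_le_one, sub_add_cancel]
      _ ≤ _ := by rw [ENNReal.rpow_one]; gcongr
  calc (∫⁻ x, ‖f x‖ₑ ^ r.toReal) ^ r.toReal⁻¹
      ≤ (ENNReal.ofReal η ^ (r.toReal - 1) * ∫⁻ x, ‖f x‖ₑ) ^ r.toReal⁻¹ := by
        gcongr
        rw [← lintegral_const_mul' _ _ (ENNReal.rpow_ne_top_of_nonneg h1 ENNReal.ofReal_ne_top)]
        exact lintegral_mono hpt
    _ = _ := by
        rw [ENNReal.mul_rpow_of_nonneg _ _ (by positivity), ← ENNReal.rpow_mul,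
          ENNReal.ofReal_rpow_of_nonneg hη (mul_nonneg h1 (by positivity)), sub_mul,
          mul_inv_cancel₀ hr0.ne', one_mul]

theorem exists_dense_hasCompactSupport {r : ℝ≥0∞} [Fact (1 ≤ r)] (hr : r ≠ ∞)
    (φ : Lp 𝕜 r (volume : Measure V)) {ε : ℝ} (hε : 0 < ε) :
    ∃ g : V → 𝕜, Continuous g ∧ HasCompactSupport g ∧ ∃ hg : MemLp g r (volume : Measure V),
      ‖φ - hg.toLp g‖ ≤ ε := by
  obtain ⟨g, hgc, hle, hg, hgm⟩ := (Lp.memLp φ).exists_hasCompactSupport_eLpNorm_sub_le hr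
    (ε := ENNReal.ofReal ε) (by simpa using hε)
  refine ⟨g, hg, hgc, hgm, ?_⟩
  have h1 : φ - hgm.toLp g = ((Lp.memLp φ).sub hgm).toLp _ := by
    rw [MemLp.toLp_sub (Lp.memLp φ) hgm, Lp.toLp_coeFn]
  rw [h1, Lp.norm_toLp]
  exact ENNReal.toReal_le_of_le_ofReal hε.le hle

/-- The difference is uniformly small and bounded in `L¹`, so it is small in `L^r`; this uses `r >
1` and needs no decay of the kernel beyond integrability. -/
theorem tendsto_convLp_fracSymbol_toLp {β : ℝ} (hβ : 1 ≤ β) {r : ℝ≥0∞} [Fact (1 ≤ r)]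
    (hr1 : 1 < r) (hr : r ≠ ∞) {f : V → 𝕜} (hf : Continuous f) (hfc : HasCompactSupport f)
    (hfr : MemLp f r) :
    Tendsto (fun t => convLp (kernelOf (fracSymbol β t)) r r (hfr.toLp f)) (𝓝[>] 0)
      (𝓝 (hfr.toLp f)) := by
  obtain ⟨A, hA, hAk⟩ := exists_isConvKernel_fracSymbol V hβ
  have hf1 : MemLp f 1 := hf.memLp_of_hasCompactSupport hfc
  have hr1' : 1 < r.toReal := by
    rw [← ENNReal.toReal_one]; exact (ENNReal.toReal_lt_toReal ENNReal.one_ne_top hr).2 hr1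
  set B := (ENNReal.ofReal A * eLpNorm f 1 + eLpNorm f 1) ^ r.toReal⁻¹ with hB
  have hBtop : B ≠ ∞ := ENNReal.rpow_ne_top_of_nonneg (by positivity)
    (ENNReal.add_ne_top.2 ⟨ENNReal.mul_ne_top ENNReal.ofReal_ne_top hf1.2.ne, hf1.2.ne⟩)
  have hexp : 0 < 1 - r.toReal⁻¹ := sub_pos.2 (inv_lt_one_of_one_lt₀ hr1')
  have hsmall : Tendsto (fun η : ℝ => η ^ (1 - r.toReal⁻¹) * B.toReal) (𝓝[>] 0) (𝓝 0) := by
    have h1 := (Real.continuousAt_rpow_const 0 (1 - r.toReal⁻¹) (Or.inr hexp.le)).tendsto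
    rw [Real.zero_rpow hexp.ne'] at h1
    simpa using (h1.mono_left nhdsWithin_le_nhds).mul_const B.toReal
  rw [tendsto_iff_norm_sub_tendsto_zero]
  refine Metric.tendsto_nhds.2 fun ε hε => ?_
  obtain ⟨η, hηε, hη⟩ := ((hsmall.eventually (gt_mem_nhds hε)).and self_mem_nhdsWithin).exists
  have hη0 : (0 : ℝ) < η := hη
  filter_upwards [eventually_norm_convKernel_fracSymbol_sub_le hβ hf hfc hη0,
    self_mem_nhdsWithin] with t ht ht0
  have hk := hAk t ht0
  rw [Real.dist_eq, sub_zero, abs_of_nonneg (norm_nonneg _)]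
  have hcongr : convKernel (kernelOf (fracSymbol β t)) (hfr.toLp f) =
      convKernel (kernelOf (fracSymbol β t)) f := convKernel_congr_ae _ hfr.coeFn_toLp
  have h1 : eLpNorm (convKernel (kernelOf (fracSymbol β t)) f - f) 1
      ≤ ENNReal.ofReal A * eLpNorm f 1 + eLpNorm f 1 := by
    refine (eLpNorm_sub_le (hk.stronglyMeasurable_convKernel hf1.1).aestronglyMeasurable hf1.1
      le_rfl).trans ?_
    gcongr
    have := hk.eLpNorm_convKernel_le le_rfl le_rfl ENNReal.one_ne_top hf1
    simpa using this
  have h2 : ‖convLp (kernelOf (fracSymbol β t)) r r (hfr.toLp f) - hfr.toLp f‖ ≤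
      η ^ (1 - r.toReal⁻¹) * B.toReal := by
    rw [Lp.norm_def]
    refine ENNReal.toReal_le_of_le_ofReal (by positivity) ?_
    have h3 : ⇑(convLp (kernelOf (fracSymbol β t)) r r (hfr.toLp f) - hfr.toLp f) =ᵐ[volume]
        convKernel (kernelOf (fracSymbol β t)) f - f := by
      refine (Lp.coeFn_sub _ _).trans ?_
      filter_upwards [hk.coeFn_convLp le_rfl hr (hfr.toLp f), hfr.coeFn_toLp] with x hx hx'
      rw [Pi.sub_apply, Pi.sub_apply, hx, hx', hcongr]
    rw [eLpNorm_congr_ae h3, ENNReal.ofReal_mul (by positivity), ENNReal.ofReal_toReal hBtop]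
    refine (eLpNorm_le_of_norm_le hη0.le ht hr1.le hr).trans ?_
    rw [hB]
    exact mul_le_mul' le_rfl (ENNReal.rpow_le_rpow h1 (by positivity))
  exact h2.trans_lt hηε

/-- The fractional heat semigroup is strongly continuous at `0` on `L^r`. -/
theorem tendsto_convLp_fracSymbol {β : ℝ} (hβ : 1 ≤ β) {r : ℝ≥0∞} [Fact (1 ≤ r)]
    (hr1 : 1 < r) (hr : r ≠ ∞) (φ : Lp 𝕜 r (volume : Measure V)) :
    Tendsto (fun t => convLp (kernelOf (fracSymbol β t)) r r φ) (𝓝[>] 0) (𝓝 φ) := by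
  obtain ⟨A, hA, hAk⟩ := exists_isConvKernel_fracSymbol V hβ
  refine Metric.tendsto_nhds.2 fun ε hε => ?_
  obtain ⟨g, hg, hgc, hgr, hle⟩ := exists_dense_hasCompactSupport hr φ
    (ε := ε / (2 * (A + 1))) (by positivity)
  have h1 := Metric.tendsto_nhds.1 (tendsto_convLp_fracSymbol_toLp hβ hr1 hr hg hgc hgr) (ε / 2)
    (by positivity)
  filter_upwards [h1, self_mem_nhdsWithin] with t ht ht0
  have hk := (hAk t ht0).norm_convLp_le le_rfl hr (φ - hgr.toLp g)
  simp only [sub_self, sub_zero, Real.rpow_one, Real.rpow_zero, mul_one] at hk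
  rw [dist_eq_norm] at ht ⊢
  set L := convLp (𝕜 := 𝕜) (kernelOf (fracSymbol β t : V → ℂ)) r r with hL
  calc ‖L φ - φ‖ = ‖L (φ - hgr.toLp g) - (φ - hgr.toLp g) + (L (hgr.toLp g) - hgr.toLp g)‖ := by
        rw [map_sub]; congr 1; abel
    _ ≤ ‖L (φ - hgr.toLp g)‖ + ‖φ - hgr.toLp g‖ + ‖L (hgr.toLp g) - hgr.toLp g‖ :=
        (norm_add_le _ _).trans (by gcongr; exact norm_sub_le _ _)
    _ < A * (ε / (2 * (A + 1))) + ε / (2 * (A + 1)) + ε / 2 := by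
        have : A * ‖φ - hgr.toLp g‖ ≤ A * (ε / (2 * (A + 1))) := by gcongr
        linarith
    _ = ε := by field_simp; ring

theorem exists_norm_convLp_fracSymbol_le (V 𝕜 : Type*) [NormedAddCommGroup V]
    [InnerProductSpace ℝ V] [FiniteDimensional ℝ V] [MeasurableSpace V] [BorelSpace V] [RCLike 𝕜]
    {β : ℝ} (hβ : 1 ≤ β) :
    ∃ A : ℝ, 1 ≤ A ∧ ∀ (s e : ℝ≥0∞) [Fact (1 ≤ s)] [Fact (1 ≤ e)], s ≤ e → e ≠ ∞ →
      ∀ t : ℝ, 0 < t → ∀ f : Lp 𝕜 s (volume : Measure V),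
        ‖convLp (𝕜 := 𝕜) (kernelOf (fracSymbol β t)) s e f‖ ≤
          A * t ^ (-(Module.finrank ℝ V / β * (s.toReal⁻¹ - e.toReal⁻¹))) * ‖f‖ := by
  obtain ⟨A, hA, hAk⟩ := exists_isConvKernel_fracSymbol V hβ
  refine ⟨A, hA, fun s e _ _ hse he t ht f => ((hAk t ht).norm_convLp_le hse he f).trans
    (le_of_eq ?_)⟩
  congr 1
  have hA0 : 0 < A := by linarith
  rw [Real.mul_rpow hA0.le (by positivity), ← mul_assoc, ← Real.rpow_add hA0, sub_add_cancel,
    Real.rpow_one, ← Real.rpow_mul ht.le, neg_mul]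

theorem exists_norm_convLp_gradSymbol_le (𝕜 : Type*) [RCLike 𝕜] {β : ℝ} (hβ : 1 ≤ β) (a : V) :
    ∃ A : ℝ, 0 ≤ A ∧ ∀ (s e : ℝ≥0∞) [Fact (1 ≤ s)] [Fact (1 ≤ e)], s ≤ e → e ≠ ∞ →
      ∀ t : ℝ, 0 < t → ∀ f : Lp 𝕜 s (volume : Measure V),
        ‖convLp (𝕜 := 𝕜) (kernelOf (gradSymbol β t a)) s e f‖ ≤
          A * t ^ (-(1 / β + Module.finrank ℝ V / β * (s.toReal⁻¹ - e.toReal⁻¹))) * ‖f‖ := by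
  obtain ⟨A, hA, hAk⟩ := exists_isConvKernel_gradSymbol hβ a
  refine ⟨A, hA, fun s e _ _ hse he t ht f => ((hAk t ht).norm_convLp_le hse he f).trans
    (le_of_eq ?_)⟩
  congr 1
  set x := A * t ^ (-(1 / β)) with hx
  have hx0 : 0 ≤ x := by positivity
  rw [Real.mul_rpow hx0 (by positivity), ← mul_assoc, ← Real.rpow_add' hx0 (by simp),
    sub_add_cancel, Real.rpow_one, ← Real.rpow_mul ht.le, hx, mul_assoc, ← Real.rpow_add ht]
  congr 2
  ring

/-- For `g` in `L^p` the quantity is at most `A t^μ ‖g‖_p`, which tends to `0`. Such `g` are dense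
in `L^r`, and the smoothing estimate controls the rest uniformly in `t`. -/
theorem tendsto_rpow_mul_norm_convLp_fracSymbol {β : ℝ} (hβ : 1 ≤ β) {r p : ℝ≥0∞}
    [hr1 : Fact (1 ≤ r)] [Fact (1 ≤ p)] (hrp : r ≤ p) (hp : p ≠ ∞) {μ : ℝ} (hμ : 0 < μ)
    (hμ' : μ = Module.finrank ℝ V / β * (r.toReal⁻¹ - p.toReal⁻¹))
    (φ : Lp 𝕜 r (volume : Measure V)) :
    Tendsto (fun t => t ^ μ * ‖convLp (kernelOf (fracSymbol β t)) r p φ‖) (𝓝[>] 0) (𝓝 0) := by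
  have hr : r ≠ ∞ := ne_top_of_le_ne_top hp hrp
  obtain ⟨B, hB, hBk⟩ := exists_isConvKernel_fracSymbol V hβ
  obtain ⟨A, hA, hAk⟩ := exists_norm_convLp_fracSymbol_le V 𝕜 hβ
  refine Metric.tendsto_nhds.2 fun ε hε => ?_
  obtain ⟨g, hg, hgc, hgr, hle⟩ := exists_dense_hasCompactSupport hr φ
    (ε := ε / (2 * (A + 1))) (by positivity)
  have hgp : MemLp g p := hg.memLp_of_hasCompactSupport hgc
  have h1 : Tendsto (fun t : ℝ => t ^ μ * (A * ‖hgp.toLp g‖)) (𝓝[>] 0) (𝓝 0) := by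
    have := (Real.continuousAt_rpow_const 0 μ (Or.inr hμ.le)).tendsto
    rw [Real.zero_rpow hμ.ne'] at this
    simpa using (this.mono_left nhdsWithin_le_nhds).mul_const (A * ‖hgp.toLp g‖)
  filter_upwards [h1.eventually (gt_mem_nhds (half_pos hε)), self_mem_nhdsWithin] with t ht ht0
  have ht0' : (0 : ℝ) < t := ht0
  rw [Real.dist_eq, sub_zero, abs_of_nonneg (by positivity)]
  set k : V → ℝ := kernelOf (fracSymbol β t) with hk
  have hkk := hBk t ht0
  have hgg : convLp k r p (hgr.toLp g) = convLp k p p (hgp.toLp g) := by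
    refine Lp.ext ((hkk.coeFn_convLp hrp hp _).trans
      (EventuallyEq.trans ?_ (hkk.coeFn_convLp le_rfl hp _).symm))
    rw [convKernel_congr_ae _ hgr.coeFn_toLp, convKernel_congr_ae _ hgp.coeFn_toLp]
  have e1 := hAk r p hrp hp t ht0 (φ - hgr.toLp g)
  have e2 := hAk p p le_rfl hp t ht0 (hgp.toLp g)
  rw [← hμ'] at e1
  rw [sub_self, mul_zero, neg_zero, Real.rpow_zero, mul_one] at e2
  have e3 : ‖convLp k r p φ‖ ≤ ‖convLp k r p (φ - hgr.toLp g)‖ + ‖convLp k p p (hgp.toLp g)‖ := by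
    rw [← hgg]
    refine le_trans (le_of_eq ?_) (norm_add_le _ _)
    rw [← map_add, sub_add_cancel]
  calc t ^ μ * ‖convLp k r p φ‖
      ≤ t ^ μ * (A * t ^ (-μ) * (ε / (2 * (A + 1))) + A * ‖hgp.toLp g‖) := by
        gcongr
        refine e3.trans (add_le_add (e1.trans ?_) e2)
        gcongr
    _ = A * (ε / (2 * (A + 1))) * (t ^ μ * t ^ (-μ)) + t ^ μ * (A * ‖hgp.toLp g‖) := by ring
    _ < A * (ε / (2 * (A + 1))) + ε / 2 := by
        rw [← Real.rpow_add ht0', add_neg_cancel, Real.rpow_zero, mul_one]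
        linarith
    _ ≤ ε / 2 + ε / 2 := by
        gcongr
        rw [mul_div_assoc', div_le_div_iff₀ (by positivity) (by positivity)]
        nlinarith
    _ = ε := by ring

end HeatSemigroup

/-! ### The power nonlinearity between Lebesgue spaces -/

section Superposition

variable {𝕜 : Type*} [RCLike 𝕜] {Ω : Type*} [MeasurableSpace Ω] {ν : Measure Ω}

/-- With `s = y / x ≤ 1`, Bernoulli's inequality gives `s^{b+1} ≥ 1 - (b+1)(1-s)`, and `s^b ≥
s^{b+1}`. The extra factor `y` on the left makes this valid also for `b < 1`, where `x ↦ x^b` is not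
Lipschitz at `0`. -/
theorem rpow_sub_rpow_mul_le {b x y : ℝ} (hb : 0 < b) (hy : 0 ≤ y) (hyx : y ≤ x) :
    (x ^ b - y ^ b) * y ≤ (b + 1) * x ^ b * (x - y) := by
  rcases hy.eq_or_lt with rfl | hy0
  · rw [mul_zero]; have : 0 ≤ x ^ b := by positivity
    rw [sub_zero]; positivity
  have hx : 0 < x := hy0.trans_le hyx
  set s := y / x with hs
  have hs0 : 0 < s := by positivity
  have hs1 : s ≤ 1 := (div_le_one hx).2 hyx
  have hyx' : y = x * s := by rw [hs]; field_simp
  have h1 := one_add_mul_self_le_rpow_one_add (s := s - 1) (by linarith) (p := b + 1) (by linarith)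
  rw [add_sub_cancel] at h1
  have h2 : s ^ (b + 1) ≤ s ^ b := Real.rpow_le_rpow_of_exponent_ge hs0 hs1 (by linarith)
  have hxb : 0 ≤ x ^ b := by positivity
  have h3 : 1 - s ^ b ≤ (b + 1) * (1 - s) := by linarith
  rw [hyx', Real.mul_rpow hx.le hs0.le]
  calc (x ^ b - x ^ b * s ^ b) * (x * s) = x ^ b * x * s * (1 - s ^ b) := by ring
    _ ≤ x ^ b * x * s * ((b + 1) * (1 - s)) := by gcongr
    _ ≤ x ^ b * x * 1 * ((b + 1) * (1 - s)) := by
        have : 0 ≤ (b + 1) * (1 - s) := mul_nonneg (by linarith) (by linarith)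
        gcongr
    _ = _ := by ring

theorem norm_powerNonlinearity_sub_le {σ b : ℝ} (hσ : |σ| ≤ 1) (hb : 0 < b) (z w : 𝕜) :
    ‖powerNonlinearity σ b z - powerNonlinearity σ b w‖ ≤
      (b + 2) * ((‖z‖ + ‖w‖) ^ b * ‖z - w‖) := by
  have key : ∀ z w : 𝕜, ‖w‖ ≤ ‖z‖ → ‖powerNonlinearity σ b z - powerNonlinearity σ b w‖ ≤
      (b + 2) * ((‖z‖ + ‖w‖) ^ b * ‖z - w‖) := by
    intro z w h
    have e : powerNonlinearity σ b z - powerNonlinearity σ b w =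
        σ • (‖z‖ ^ b • (z - w) + (‖z‖ ^ b - ‖w‖ ^ b) • w) := by
      simp only [powerNonlinearity, mul_smul]
      module
    have h1 : ‖w‖ ^ b ≤ ‖z‖ ^ b := by gcongr
    have h2 : ‖z‖ - ‖w‖ ≤ ‖z - w‖ := norm_sub_norm_le z w
    have h3 : ‖z‖ ^ b ≤ (‖z‖ + ‖w‖) ^ b := by gcongr; linarith [norm_nonneg w]
    rw [e, norm_smul, Real.norm_eq_abs]
    calc |σ| * ‖‖z‖ ^ b • (z - w) + (‖z‖ ^ b - ‖w‖ ^ b) • w‖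
        ≤ 1 * (‖z‖ ^ b * ‖z - w‖ + (‖z‖ ^ b - ‖w‖ ^ b) * ‖w‖) := by
          gcongr
          refine (norm_add_le _ _).trans (le_of_eq ?_)
          rw [norm_smul, norm_smul, Real.norm_of_nonneg (by positivity),
            Real.norm_of_nonneg (sub_nonneg.2 h1)]
      _ ≤ ‖z‖ ^ b * ‖z - w‖ + (b + 1) * ‖z‖ ^ b * (‖z‖ - ‖w‖) := by
          rw [one_mul]
          exact add_le_add le_rfl (rpow_sub_rpow_mul_le hb (norm_nonneg _) h)
      _ ≤ ‖z‖ ^ b * ‖z - w‖ + (b + 1) * ‖z‖ ^ b * ‖z - w‖ := by gcongr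
      _ = (b + 2) * (‖z‖ ^ b * ‖z - w‖) := by ring
      _ ≤ _ := by gcongr
  rcases le_total ‖w‖ ‖z‖ with h | h
  · exact key z w h
  · rw [norm_sub_rev, add_comm ‖z‖, norm_sub_rev z]
    exact key w z h

theorem continuous_powerNonlinearity {σ b : ℝ} (hb : 0 < b) :
    Continuous (powerNonlinearity σ b : 𝕜 → 𝕜) := by
  unfold powerNonlinearity
  exact (continuous_const.mul (continuous_norm.rpow_const fun _ => Or.inr hb.le)).smul continuous_id

theorem powerNonlinearity_zero (σ b : ℝ) : powerNonlinearity σ b (0 : 𝕜) = 0 := by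
  simp [powerNonlinearity]

/-- Interpolation of Lebesgue norms. -/
theorem eLpNorm_le_interpolate {f : Ω → 𝕜} (hf : AEStronglyMeasurable f ν) {r p : ℝ≥0∞} {P θ : ℝ}
    (hr : r ≠ 0) (hr' : r ≠ ∞) (hp : p ≠ 0) (hp' : p ≠ ∞) (hP : 0 < P) (hθ : 0 ≤ θ) (hθ1 : θ ≤ 1)
    (h : P⁻¹ = (1 - θ) * r.toReal⁻¹ + θ * p.toReal⁻¹) :
    (∫⁻ x, ‖f x‖ₑ ^ P ∂ν) ^ P⁻¹ ≤ eLpNorm f r ν ^ (1 - θ) * eLpNorm f p ν ^ θ := by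
  have hr0 : 0 < r.toReal := ENNReal.toReal_pos hr hr'
  have hp0 : 0 < p.toReal := ENNReal.toReal_pos hp hp'
  have hθ' : 0 ≤ 1 - θ := by linarith
  set r₀ := r.toReal with hr₀
  set p₀ := p.toReal with hp₀
  have hsum : P * ((1 - θ) * r₀⁻¹) + P * (θ * p₀⁻¹) = 1 := by
    rw [← mul_add, ← h, mul_inv_cancel₀ hP.ne']
  rw [eLpNorm_eq_lintegral_rpow_enorm_toReal hr hr', eLpNorm_eq_lintegral_rpow_enorm_toReal hp hp',
    one_div, one_div, ← hr₀, ← hp₀]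
  calc (∫⁻ x, ‖f x‖ₑ ^ P ∂ν) ^ P⁻¹
      = (∫⁻ x, (‖f x‖ₑ ^ r₀) ^ (P * ((1 - θ) * r₀⁻¹)) *
          (‖f x‖ₑ ^ p₀) ^ (P * (θ * p₀⁻¹)) ∂ν) ^ P⁻¹ := by
        congr 1
        refine lintegral_congr fun x => ?_
        rw [← ENNReal.rpow_mul, ← ENNReal.rpow_mul,
          ← ENNReal.rpow_add_of_nonneg _ _ (by positivity) (by positivity)]
        congr 1
        field_simp
        ring
    _ ≤ ((∫⁻ x, ‖f x‖ₑ ^ r₀ ∂ν) ^ (P * ((1 - θ) * r₀⁻¹)) *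
          (∫⁻ x, ‖f x‖ₑ ^ p₀ ∂ν) ^ (P * (θ * p₀⁻¹))) ^ P⁻¹ := by
        gcongr
        exact ENNReal.lintegral_mul_norm_pow_le (hf.enorm.pow_const _) (hf.enorm.pow_const _)
          (by positivity) (by positivity) hsum
    _ = _ := by
        rw [ENNReal.mul_rpow_of_nonneg _ _ (by positivity), ← ENNReal.rpow_mul,
          ← ENNReal.rpow_mul, ← ENNReal.rpow_mul, ← ENNReal.rpow_mul]
        congr 2 <;> field_simp

/-- Hölder's inequality for the difference of two powers. -/
theorem lintegral_rpow_powerNonlinearity_sub_le {σ b : ℝ} (hσ : |σ| ≤ 1) (hb : 0 < b)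
    {f g : Ω → 𝕜} (hf : AEStronglyMeasurable f ν) (hg : AEStronglyMeasurable g ν) {P : ℝ}
    (hP : 1 ≤ P) :
    (∫⁻ x, ‖powerNonlinearity σ b (f x) - powerNonlinearity σ b (g x)‖ₑ ^ (P / (b + 1)) ∂ν)
        ^ (P / (b + 1))⁻¹ ≤
      ENNReal.ofReal (b + 2) * ((∫⁻ x, ‖f x‖ₑ ^ P ∂ν) ^ P⁻¹ + (∫⁻ x, ‖g x‖ₑ ^ P ∂ν) ^ P⁻¹) ^ b *
        (∫⁻ x, ‖f x - g x‖ₑ ^ P ∂ν) ^ P⁻¹ := by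
  have hb1 : 0 < b + 1 := by linarith
  have hP0 : 0 < P := by linarith
  have hpt : ∀ x, ‖powerNonlinearity σ b (f x) - powerNonlinearity σ b (g x)‖ₑ ≤
      ENNReal.ofReal (b + 2) * ((‖f x‖ₑ + ‖g x‖ₑ) ^ b * ‖f x - g x‖ₑ) := by
    intro x
    rw [← ofReal_norm]
    refine (ENNReal.ofReal_le_ofReal (norm_powerNonlinearity_sub_le hσ hb (f x) (g x))).trans ?_
    rw [ENNReal.ofReal_mul (by linarith), ENNReal.ofReal_mul (by positivity),
      ← ENNReal.ofReal_rpow_of_nonneg (by positivity) hb.le,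
      ENNReal.ofReal_add (norm_nonneg _) (norm_nonneg _), ofReal_norm, ofReal_norm, ofReal_norm]
  have hfg : AEMeasurable (fun x => ‖f x‖ₑ + ‖g x‖ₑ) ν := hf.enorm.add hg.enorm
  set c := ENNReal.ofReal (b + 2) with hc
  have hcs : c ^ (P / (b + 1)) ≠ ∞ :=
    ENNReal.rpow_ne_top_of_nonneg (by positivity) ENNReal.ofReal_ne_top
  calc (∫⁻ x, ‖powerNonlinearity σ b (f x) - powerNonlinearity σ b (g x)‖ₑ ^ (P / (b + 1)) ∂ν)
        ^ (P / (b + 1))⁻¹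
      ≤ (∫⁻ x, (c * ((‖f x‖ₑ + ‖g x‖ₑ) ^ b * ‖f x - g x‖ₑ)) ^ (P / (b + 1)) ∂ν)
        ^ (P / (b + 1))⁻¹ := by
        gcongr with x
        exact hpt x
    _ = (c ^ (P / (b + 1)) * ∫⁻ x, ((‖f x‖ₑ + ‖g x‖ₑ) ^ P) ^ (b / (b + 1)) *
          (‖f x - g x‖ₑ ^ P) ^ (1 / (b + 1)) ∂ν) ^ (P / (b + 1))⁻¹ := by
        rw [← lintegral_const_mul' _ _ hcs]
        congr 1
        refine lintegral_congr fun x => ?_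
        rw [ENNReal.mul_rpow_of_nonneg _ _ (by positivity),
          ENNReal.mul_rpow_of_nonneg _ _ (by positivity), ← ENNReal.rpow_mul, ← ENNReal.rpow_mul,
          ← ENNReal.rpow_mul]
        congr 3 <;> field_simp
    -- The conjugate exponents are `(b + 1) / b` and `b + 1`.
    _ ≤ (c ^ (P / (b + 1)) * ((∫⁻ x, (‖f x‖ₑ + ‖g x‖ₑ) ^ P ∂ν) ^ (b / (b + 1)) *
          (∫⁻ x, ‖f x - g x‖ₑ ^ P ∂ν) ^ (1 / (b + 1)))) ^ (P / (b + 1))⁻¹ := by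
        gcongr
        exact ENNReal.lintegral_mul_norm_pow_le (hfg.pow_const _)
          ((hf.sub hg).enorm.pow_const _) (by positivity) (by positivity) (by field_simp)
    _ = c * ((∫⁻ x, (‖f x‖ₑ + ‖g x‖ₑ) ^ P ∂ν) ^ P⁻¹) ^ b *
          (∫⁻ x, ‖f x - g x‖ₑ ^ P ∂ν) ^ P⁻¹ := by
        rw [ENNReal.mul_rpow_of_nonneg _ _ (by positivity),
          ENNReal.mul_rpow_of_nonneg _ _ (by positivity), ← ENNReal.rpow_mul, ← ENNReal.rpow_mul,
          ← ENNReal.rpow_mul, ← ENNReal.rpow_mul, mul_inv_cancel₀ (by positivity),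
          ENNReal.rpow_one, mul_assoc]
        congr 3 <;> field_simp
    _ ≤ _ := by
        gcongr
        have := ENNReal.lintegral_Lp_add_le (μ := ν) hf.enorm hg.enorm hP
        simpa only [one_div, Pi.add_apply] using this

variable (ν 𝕜) in
/-- Pairs in `L^r × L^p` that stand for the same function. -/
def coincidenceSubmodule (r p : ℝ≥0∞) [Fact (1 ≤ r)] [Fact (1 ≤ p)] :
    Submodule ℝ (Lp 𝕜 r ν × Lp 𝕜 p ν) where
  carrier := {w | w.1 =ᵐ[ν] w.2}
  add_mem' {w w'} h h' := by
    have h1 : w.1 =ᵐ[ν] w.2 := h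
    have h2 : w'.1 =ᵐ[ν] w'.2 := h'
    exact (Lp.coeFn_add _ _).trans ((h1.add h2).trans (Lp.coeFn_add _ _).symm)
  zero_mem' := (Lp.coeFn_zero _ _ _).trans (Lp.coeFn_zero _ _ _).symm
  smul_mem' c w h := by
    have h1 : w.1 =ᵐ[ν] w.2 := h
    exact (Lp.coeFn_smul _ _).trans ((h1.const_smul c).trans (Lp.coeFn_smul _ _).symm)

variable {r p s : ℝ≥0∞} [Fact (1 ≤ r)] [Fact (1 ≤ p)] [Fact (1 ≤ s)]

theorem mem_coincidenceSubmodule {w : Lp 𝕜 r ν × Lp 𝕜 p ν} :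
    w ∈ coincidenceSubmodule 𝕜 ν r p ↔ w.1 =ᵐ[ν] w.2 := Iff.rfl

/-- Convergence in either Lebesgue norm implies convergence in measure, whose limits are unique
almost everywhere. -/
theorem isClosed_coincidenceSubmodule :
    IsClosed (coincidenceSubmodule 𝕜 ν r p : Set (Lp 𝕜 r ν × Lp 𝕜 p ν)) := by
  refine IsSeqClosed.isClosed fun w w₀ hw hlim => ?_
  have h1 : TendstoInMeasure ν (fun n => ⇑(w n).1) atTop w₀.1 :=
    tendstoInMeasure_of_tendsto_Lp (hlim.fst_nhds)
  have h2 : TendstoInMeasure ν (fun n => ⇑(w n).2) atTop w₀.2 :=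
    tendstoInMeasure_of_tendsto_Lp (hlim.snd_nhds)
  exact tendstoInMeasure_ae_unique (h1.congr_left hw) h2

variable (s) in
/-- The superposition operator of the nonlinearity, with values in `L^s`. -/
def superposition (σ b : ℝ) (w : Lp 𝕜 r ν × Lp 𝕜 p ν) : Lp 𝕜 s ν :=
  open scoped Classical in
  if h : MemLp (fun x => powerNonlinearity σ b (w.1 x)) s ν then h.toLp _ else 0

variable {σ b θ : ℝ}

theorem rpow_lintegral_le_mixNorm {w : Lp 𝕜 r ν × Lp 𝕜 p ν}
    (hw : w ∈ coincidenceSubmodule 𝕜 ν r p) (hr : r ≠ ∞) (hp : p ≠ ∞) {P : ℝ} (hP : 0 < P)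
    (hθ : 0 ≤ θ) (hθ1 : θ ≤ 1) (h : P⁻¹ = (1 - θ) * r.toReal⁻¹ + θ * p.toReal⁻¹) :
    (∫⁻ x, ‖w.1 x‖ₑ ^ P ∂ν) ^ P⁻¹ ≤ ENNReal.ofReal (mixNorm θ w) := by
  have hr1 : r ≠ 0 := (zero_lt_one.trans_le (Fact.out : 1 ≤ r)).ne'
  have hp1 : p ≠ 0 := (zero_lt_one.trans_le (Fact.out : 1 ≤ p)).ne'
  refine (eLpNorm_le_interpolate (Lp.aestronglyMeasurable w.1) hr1 hr hp1 hp hP hθ hθ1 h).trans ?_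
  rw [eLpNorm_congr_ae (p := p) (mem_coincidenceSubmodule.1 hw), mixNorm,
    ENNReal.ofReal_mul (by positivity), ← ENNReal.ofReal_rpow_of_nonneg (norm_nonneg _)
      (by linarith), ← ENNReal.ofReal_rpow_of_nonneg (norm_nonneg _) hθ, Lp.norm_def, Lp.norm_def,
    ENNReal.ofReal_toReal (Lp.eLpNorm_ne_top _), ENNReal.ofReal_toReal (Lp.eLpNorm_ne_top _)]

theorem eLpNorm_powerNonlinearity_sub_le (hσ : |σ| ≤ 1) (hb : 0 < b) (hr : r ≠ ∞) (hp : p ≠ ∞)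
    (hs : s ≠ ∞) (hθ : 0 ≤ θ) (hθ1 : θ ≤ 1)
    (h : s.toReal⁻¹ = (b + 1) * ((1 - θ) * r.toReal⁻¹ + θ * p.toReal⁻¹))
    {w w' : Lp 𝕜 r ν × Lp 𝕜 p ν} (hw : w ∈ coincidenceSubmodule 𝕜 ν r p)
    (hw' : w' ∈ coincidenceSubmodule 𝕜 ν r p) :
    eLpNorm (fun x => powerNonlinearity σ b (w.1 x) - powerNonlinearity σ b (w'.1 x)) s ν ≤
      ENNReal.ofReal ((b + 2) * (mixNorm θ w + mixNorm θ w') ^ b * mixNorm θ (w - w')) := by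
  have hs1 : 1 ≤ s.toReal := by
    rw [← ENNReal.toReal_one]; exact ENNReal.toReal_mono hs Fact.out
  have hs0 : s ≠ 0 := (zero_lt_one.trans_le (Fact.out : 1 ≤ s)).ne'
  have hb1 : 0 < b + 1 := by linarith
  -- A function in `L^P` has its power of order `b + 1` in `L^s`; the hypothesis `h` says that `L^P`
  -- is the interpolation space of parameter `θ` between `L^r` and `L^p`.
  set P := s.toReal * (b + 1) with hPdef
  have hP1 : 1 ≤ P := one_le_mul_of_one_le_of_one_le hs1 (by linarith)
  have hP0 : 0 < P := by linarith
  have hP : P⁻¹ = (1 - θ) * r.toReal⁻¹ + θ * p.toReal⁻¹ := by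
    rw [hPdef, mul_inv, h]; field_simp
  have hsP : s.toReal = P / (b + 1) := by rw [hPdef]; field_simp
  have h1 := lintegral_rpow_powerNonlinearity_sub_le hσ hb (Lp.aestronglyMeasurable w.1)
    (Lp.aestronglyMeasurable w'.1) hP1
  rw [eLpNorm_eq_lintegral_rpow_enorm_toReal hs0 hs, one_div, hsP]
  refine h1.trans ?_
  have hsub := (coincidenceSubmodule 𝕜 ν r p).sub_mem hw hw'
  have m1 := mixNorm_nonneg θ w
  have m2 := mixNorm_nonneg θ w'
  have e1 : ∫⁻ x, ‖w.1 x - w'.1 x‖ₑ ^ P ∂ν = ∫⁻ x, ‖(w - w').1 x‖ₑ ^ P ∂ν := by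
    refine lintegral_congr_ae ?_
    filter_upwards [Lp.coeFn_sub w.1 w'.1] with x hx
    rw [Prod.fst_sub, hx, Pi.sub_apply]
  rw [e1, ENNReal.ofReal_mul (by positivity), ENNReal.ofReal_mul (by linarith),
    ← ENNReal.ofReal_rpow_of_nonneg (by positivity) hb.le, ENNReal.ofReal_add m1 m2]
  gcongr
  · exact rpow_lintegral_le_mixNorm hw hr hp hP0 hθ hθ1 hP
  · exact rpow_lintegral_le_mixNorm hw' hr hp hP0 hθ hθ1 hP
  · exact rpow_lintegral_le_mixNorm hsub hr hp hP0 hθ hθ1 hP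

theorem memLp_powerNonlinearity (hσ : |σ| ≤ 1) (hb : 0 < b) (hr : r ≠ ∞) (hp : p ≠ ∞)
    (hs : s ≠ ∞) (hθ : 0 < θ) (hθ1 : θ ≤ 1)
    (h : s.toReal⁻¹ = (b + 1) * ((1 - θ) * r.toReal⁻¹ + θ * p.toReal⁻¹))
    {w : Lp 𝕜 r ν × Lp 𝕜 p ν} (hw : w ∈ coincidenceSubmodule 𝕜 ν r p) :
    MemLp (fun x => powerNonlinearity σ b (w.1 x)) s ν := by
  refine ⟨(continuous_powerNonlinearity hb).comp_aestronglyMeasurable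
    (Lp.aestronglyMeasurable w.1), lt_of_le_of_lt (le_of_eq ?_)
    ((eLpNorm_powerNonlinearity_sub_le hσ hb hr hp hs hθ.le hθ1 h hw
      (coincidenceSubmodule 𝕜 ν r p).zero_mem).trans_lt ENNReal.ofReal_lt_top)⟩
  refine eLpNorm_congr_ae ?_
  filter_upwards [Lp.coeFn_zero 𝕜 r ν] with x hx
  rw [Prod.fst_zero, hx, Pi.zero_apply, powerNonlinearity_zero, sub_zero]

theorem coeFn_superposition (hσ : |σ| ≤ 1) (hb : 0 < b) (hr : r ≠ ∞) (hp : p ≠ ∞)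
    (hs : s ≠ ∞) (hθ : 0 < θ) (hθ1 : θ ≤ 1)
    (h : s.toReal⁻¹ = (b + 1) * ((1 - θ) * r.toReal⁻¹ + θ * p.toReal⁻¹))
    {w : Lp 𝕜 r ν × Lp 𝕜 p ν} (hw : w ∈ coincidenceSubmodule 𝕜 ν r p) :
    superposition s σ b w =ᵐ[ν] fun x => powerNonlinearity σ b (w.1 x) := by
  have hm := memLp_powerNonlinearity hσ hb hr hp hs hθ hθ1 h hw
  rw [superposition, dif_pos hm]
  exact hm.coeFn_toLp

theorem isPowerLike_superposition (hσ : |σ| ≤ 1) (hb : 0 < b) (hr : r ≠ ∞) (hp : p ≠ ∞)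
    (hs : s ≠ ∞) (hθ : 0 < θ) (hθ1 : θ ≤ 1)
    (h : s.toReal⁻¹ = (b + 1) * ((1 - θ) * r.toReal⁻¹ + θ * p.toReal⁻¹)) :
    IsPowerLike (coincidenceSubmodule 𝕜 ν r p) (superposition s σ b) b θ (b + 2) where
  b_pos := hb
  θ_pos := hθ
  θ_le := hθ1
  nonneg := by linarith
  map_zero := by
    refine Lp.ext ((coeFn_superposition hσ hb hr hp hs hθ hθ1 h
      (coincidenceSubmodule 𝕜 ν r p).zero_mem).trans (EventuallyEq.trans ?_
        (Lp.coeFn_zero 𝕜 s ν).symm))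
    filter_upwards [Lp.coeFn_zero 𝕜 r ν] with x hx
    rw [Prod.fst_zero, hx, Pi.zero_apply, powerNonlinearity_zero]
  norm_sub_le w hw w' hw' := by
    have m1 := mixNorm_nonneg θ w
    have m2 := mixNorm_nonneg θ w'
    have m3 := mixNorm_nonneg θ (w - w')
    rw [Lp.norm_def]
    refine ENNReal.toReal_le_of_le_ofReal (by positivity) ?_
    refine le_trans (le_of_eq (eLpNorm_congr_ae ?_))
      (eLpNorm_powerNonlinearity_sub_le hσ hb hr hp hs hθ.le hθ1 h hw hw')
    filter_upwards [Lp.coeFn_sub (superposition s σ b w) (superposition s σ b w'),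
      coeFn_superposition hσ hb hr hp hs hθ hθ1 h hw,
      coeFn_superposition hσ hb hr hp hs hθ hθ1 h hw'] with x h1 h2 h3
    rw [h1, Pi.sub_apply, h2, h3]

end Superposition

/-! ### Auxiliary Lebesgue exponents -/

section Exponents

/-- A number above two lower bounds (one of them strict) and below two upper bounds (one of them
strict). -/
theorem exists_between_bounds {L O U H : ℝ} (hLU : L ≤ U) (hLH : L < H) (hOU : O < U)
    (hOH : O < H) : ∃ x, L ≤ x ∧ O < x ∧ x ≤ U ∧ x < H := by
  have h1 : O < min U H := lt_min hOU hOH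
  refine ⟨max L ((O + min U H) / 2), le_max_left _ _, lt_max_of_lt_right (by linarith),
    max_le hLU ?_, max_lt hLH ?_⟩
  · linarith [min_le_left U H]
  · linarith [min_le_right U H]

/-- Auxiliary Lebesgue exponents `1 / x₁`, `1 / x₂` for the estimates of the nonlinear term in
`L^r` and in `L^p`, where `R = 1 / r`, `Q = 1 / p`. -/
theorem exists_auxiliary_exponents {n α b R Q : ℝ} (hn : 0 < n) (hα : 0 < α) (hb : 0 < b)
    (hR : 0 < R) (hR1 : R < 1) (hQR : Q < R) (hQb : Q ≤ 1 / (b + 1))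
    (hRb : n * b * R ≤ 2 * α - 1) (hdim : R - Q < 2 * α / n) :
    ∃ x₁ x₂ : ℝ, (Q ≤ x₁ ∧ R ≤ (b + 1) * x₁ ∧ (b + 1) * x₁ ≤ 1 ∧ x₁ < R ∧
      (b + 1) * (R - x₁) < 2 * α / n) ∧
      (Q ≤ x₂ ∧ (b + 1) * x₂ ≤ 1 ∧ x₂ < R ∧ (b + 1) * (R - x₂) < 2 * α / n ∧
        R - Q < (R - x₂) * (b + 1)) := by
  have hb1 : 0 < b + 1 := by linarith
  set D := 2 * α / n with hD
  have hD0 : 0 < D := by positivity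
  -- This is where `r ≥ r₁` enters, with a margin of `1 / n`.
  have hDb : b * R < D := by
    rw [hD, lt_div_iff₀ hn]; nlinarith
  have hOR : R - D / (b + 1) < R := by
    have : 0 < D / (b + 1) := by positivity
    linarith
  have hOU : R - D / (b + 1) < 1 / (b + 1) := by
    rw [sub_lt_iff_lt_add, ← add_div, lt_div_iff₀ hb1]; nlinarith
  have hmul : ∀ x, R - D / (b + 1) < x → (b + 1) * (R - x) < D := fun x hx => by
    have : R - x < D / (b + 1) := by linarith
    rwa [lt_div_iff₀ hb1, mul_comm] at this
  have hle1 : ∀ x, x ≤ 1 / (b + 1) → (b + 1) * x ≤ 1 := fun x hx => by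
    rwa [le_div_iff₀ hb1, mul_comm] at hx
  have hRb1 : R / (b + 1) < R := by
    rw [div_lt_iff₀ hb1]; nlinarith
  obtain ⟨x₁, h1, h2, h3, h4⟩ := exists_between_bounds (L := max Q (R / (b + 1)))
    (O := R - D / (b + 1)) (U := 1 / (b + 1)) (H := R)
    (max_le hQb (by gcongr)) (max_lt hQR hRb1) hOU hOR
  -- The upper bound `x₂ < (bR + Q)/(b + 1)` is the superlinearity condition `R - Q < (b + 1)(R -
  -- x₂)`. That it is compatible with the lower bound `R - D/(b + 1)` is exactly the dimension
  -- condition `R - Q < D`.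
  have hH : (b * R + Q) / (b + 1) < R := by
    rw [div_lt_iff₀ hb1]; nlinarith
  have hOH : R - D / (b + 1) < (b * R + Q) / (b + 1) := by
    rw [sub_lt_iff_lt_add, ← add_div, lt_div_iff₀ hb1]; nlinarith
  have hQH : Q < (b * R + Q) / (b + 1) := by
    rw [lt_div_iff₀ hb1]; nlinarith
  obtain ⟨x₂, k1, k2, k3, k4⟩ := exists_between_bounds (L := Q)
    (O := R - D / (b + 1)) (U := 1 / (b + 1)) (H := (b * R + Q) / (b + 1)) hQb hQH hOU hOH
  refine ⟨x₁, x₂, ⟨(le_max_left _ _).trans h1, ?_, hle1 _ h3, h4, hmul _ h2⟩,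
    k1, hle1 _ k3, k4.trans hH, hmul _ k2, ?_⟩
  · have := (le_max_right Q (R / (b + 1))).trans h1
    rwa [div_le_iff₀ hb1, mul_comm] at this
  · rw [lt_div_iff₀ hb1] at k4
    nlinarith

end Exponents

/-! ### The equation as an instance of the abstract system -/

section Equation

variable {n : ℕ} {𝕜 : Type*} [RCLike 𝕜] {α b σ : ℝ} {a : EuclideanSpace ℝ (Fin n)}
  {q p r : ℝ≥0∞} [Fact (1 ≤ p)] [Fact (1 ≤ r)]

theorem fracKernel_eq_kernelOf (α t : ℝ) :
    fracKernel (n := n) α t = kernelOf (fracSymbol (2 * α) t) := rfl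

theorem fracSemigroup_eq_convKernel (α t : ℝ) (f : EuclideanSpace ℝ (Fin n) → 𝕜) :
    fracSemigroup α t f = convKernel (kernelOf (fracSymbol (2 * α) t)) f := rfl

theorem fracSemigroupDeriv_eq_convKernel (hα : 1 / 2 < α) {t : ℝ} (ht : 0 < t)
    (a : EuclideanSpace ℝ (Fin n)) (f : EuclideanSpace ℝ (Fin n) → 𝕜) :
    fracSemigroupDeriv α t a f = convKernel (kernelOf (gradSymbol (2 * α) t a)) f := by
  funext x
  simp only [fracSemigroupDeriv, convKernel, fracKernel_eq_kernelOf,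
    fderiv_kernelOf_fracSymbol (by linarith : 1 ≤ 2 * α) ht]

/-- The equation fits into the abstract framework. -/
structure Realizes {s₁ s₂ : ℝ≥0∞} [Fact (1 ≤ s₁)] [Fact (1 ≤ s₂)]
    (A : MildSystem (Lp 𝕜 r (volume : Measure (EuclideanSpace ℝ (Fin n))))
      (Lp 𝕜 p (volume : Measure (EuclideanSpace ℝ (Fin n))))
      (Lp 𝕜 s₁ (volume : Measure (EuclideanSpace ℝ (Fin n))))
      (Lp 𝕜 s₂ (volume : Measure (EuclideanSpace ℝ (Fin n)))))
    (α b σ : ℝ) (a : EuclideanSpace ℝ (Fin n)) (q : ℝ≥0∞) : Prop where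
  W_eq : A.W = coincidenceSubmodule 𝕜 volume r p
  S_coe : ∀ t, 0 < t → ∀ φ, A.S t φ =ᵐ[volume] fracSemigroup α t φ
  D_coe : ∀ t, 0 < t → ∀ w ∈ A.W,
    A.D₁ t (A.N₁ w) =ᵐ[volume] fracSemigroupDeriv α t a fun y => powerNonlinearity σ b (w.1 y)
  μ_eq : A.μ = q⁻¹.toReal
  b_eq : A.b = b
  ω_eq : A.ω = (2 * α - 1 - n * b / r.toReal) / (2 * α)

/-- The nonlinearity goes through `L^{s_i}` with `1/s_i = (b+1) x_i`. The conditions on `x_i` give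
`s_i ≥ 1`, `s₁ ≤ r`, `s₂ ≤ p`, an interpolation parameter in `(0, 1]`, and `β_i < 1`. Taking `x_i =
1/p` for both would impose further restrictions, such as `p ≤ (b+1) r`. -/
theorem exists_realizes (hα : 1 / 2 < α) (hb : 0 < b) (hσ : σ = 1 ∨ σ = -1)
    (hr₁ : 1 < n * b / (2 * α - 1)) (hr : n * b / (2 * α - 1) ≤ r.toReal)
    (hadm : IsGeneralizedAdmissible n α q p r) (hrp : r < p) (hbp : b + 1 ≤ p.toReal) :
    ∃ (s₁ s₂ : ℝ≥0∞) (_ : Fact (1 ≤ s₁)) (_ : Fact (1 ≤ s₂))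
      (A : MildSystem (Lp 𝕜 r (volume : Measure (EuclideanSpace ℝ (Fin n))))
        (Lp 𝕜 p (volume : Measure (EuclideanSpace ℝ (Fin n))))
        (Lp 𝕜 s₁ (volume : Measure (EuclideanSpace ℝ (Fin n))))
        (Lp 𝕜 s₂ (volume : Measure (EuclideanSpace ℝ (Fin n))))),
      Realizes A α b σ a q := by
  have hp' : p ≠ ∞ := hadm.lt_top.ne
  have hr' : r ≠ ∞ := (hrp.trans hadm.lt_top).ne
  have hβ : 1 ≤ 2 * α := by linarith
  have hα0 : 0 < α := by linarith
  have hα1 : 0 < 2 * α - 1 := by linarith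
  have hb1 : 0 < b + 1 := by linarith
  -- Dimension zero is excluded by `r₁ > 1`.
  have hn : (0 : ℝ) < n := by
    rcases (Nat.cast_nonneg (α := ℝ) n).eq_or_lt with h | h
    · rw [← h, zero_mul, zero_div] at hr₁; linarith
    · exact h
  have hr1 : 1 < r.toReal := hr₁.trans_le hr
  have hr0 : 0 < r.toReal := by linarith
  have hrp' : r.toReal < p.toReal := (ENNReal.toReal_lt_toReal hr' hp').2 hrp
  have hp0 : 0 < p.toReal := by linarith
  have hσ1 : |σ| ≤ 1 := by rcases hσ with rfl | rfl <;> simp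
  set R := r.toReal⁻¹ with hR
  set Q := p.toReal⁻¹ with hQ
  have hR0 : 0 < R := by positivity
  have hQ0 : 0 < Q := by positivity
  have hR1 : R < 1 := inv_lt_one_of_one_lt₀ hr1
  have hQR : Q < R := inv_strictAnti₀ hr0 hrp'
  have hQb : Q ≤ 1 / (b + 1) := by
    rw [one_div]; exact inv_anti₀ hb1 hbp
  have hRb : n * b * R ≤ 2 * α - 1 := by
    rw [div_le_iff₀ hα1] at hr
    rw [hR, ← div_eq_mul_inv, div_le_iff₀ hr0]
    linarith
  -- That is, `1/q < 1`. It is the upper bound on `p` when `n > 2αr`, and automatic otherwise since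
  -- then `1/r ≤ 2α/n`.
  have hdim : R - Q < 2 * α / n := by
    rcases lt_or_ge (2 * α * r.toReal) n with h | h
    · have h1 := hadm.lt_of_dim h
      have h2 : 0 < n - 2 * α * r.toReal := by linarith
      have h3 : (n * r.toReal / (n - 2 * α * r.toReal))⁻¹ < Q := inv_strictAnti₀ hp0 h1
      have h4 : (n * r.toReal / (n - 2 * α * r.toReal))⁻¹ = R - 2 * α / n := by
        rw [hR]; field_simp
      linarith
    · have : R ≤ 2 * α / n := by
        rw [hR, le_div_iff₀ hn, inv_mul_le_iff₀ hr0]; linarith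
      linarith
  obtain ⟨x₁, x₂, ⟨hx1Q, hx1R, hx1b, hx1lt, hx1n⟩, hx2Q, hx2b, hx2lt, hx2n, hx2θ⟩ :=
    exists_auxiliary_exponents hn hα0 hb hR0 hR1 hQR hQb hRb hdim
  have hx1 : 0 < x₁ := hQ0.trans_le hx1Q
  have hx2 : 0 < x₂ := hQ0.trans_le hx2Q
  have hRQ : 0 < R - Q := by linarith
  set s₁ := ENNReal.ofReal ((b + 1) * x₁)⁻¹ with hs₁
  set s₂ := ENNReal.ofReal ((b + 1) * x₂)⁻¹ with hs₂
  have hs₁R : s₁.toReal = ((b + 1) * x₁)⁻¹ := ENNReal.toReal_ofReal (by positivity)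
  have hs₂R : s₂.toReal = ((b + 1) * x₂)⁻¹ := ENNReal.toReal_ofReal (by positivity)
  have hs₁i : s₁.toReal⁻¹ = (b + 1) * x₁ := by rw [hs₁R, inv_inv]
  have hs₂i : s₂.toReal⁻¹ = (b + 1) * x₂ := by rw [hs₂R, inv_inv]
  have f₁ : Fact (1 ≤ s₁) := ⟨by
    rw [hs₁, ENNReal.one_le_ofReal]; exact (one_le_inv₀ (by positivity)).2 hx1b⟩
  have f₂ : Fact (1 ≤ s₂) := ⟨by
    rw [hs₂, ENNReal.one_le_ofReal]; exact (one_le_inv₀ (by positivity)).2 hx2b⟩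
  have hs₁' : s₁ ≠ ∞ := ENNReal.ofReal_ne_top
  have hs₂' : s₂ ≠ ∞ := ENNReal.ofReal_ne_top
  have hs₁r : s₁ ≤ r := by
    rw [← ENNReal.toReal_le_toReal hs₁' hr', hs₁R, ← inv_inv r.toReal]
    exact inv_anti₀ hR0 hx1R
  have hs₂p : s₂ ≤ p := by
    rw [← ENNReal.toReal_le_toReal hs₂' hp', hs₂R, ← inv_inv p.toReal]
    exact inv_anti₀ hQ0 (by nlinarith)
  obtain ⟨A₀, hA₀, hA⟩ := exists_norm_convLp_fracSymbol_le (EuclideanSpace ℝ (Fin n)) 𝕜 hβ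
  obtain ⟨B₀, hB₀, hB⟩ := exists_norm_convLp_gradSymbol_le 𝕜 hβ a
  obtain ⟨A₁, -, hK⟩ := exists_isConvKernel_fracSymbol (EuclideanSpace ℝ (Fin n)) hβ
  obtain ⟨B₁, -, hG⟩ := exists_isConvKernel_gradSymbol hβ a
  simp only [finrank_euclideanSpace, Fintype.card_fin] at hA hB hK hG
  set κ := (n : ℝ) / (2 * α) with hκ
  have hκ0 : 0 < κ := by positivity
  have hκn : κ * (2 * α / n) = 1 := by rw [hκ]; field_simp
  set μ := κ * (R - Q) with hμ
  have hμ0 : 0 < μ := by positivity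
  -- The parameter that places the exponent `1/x₁` between `r` and `p`, so that `x₁ = (1 - θ₁)/r +
  -- θ₁/p`.
  set θ₁ := (R - x₁) / (R - Q) with hθ₁
  set θ₂ := (R - x₂) / (R - Q) with hθ₂
  have hθ₁0 : 0 < θ₁ := div_pos (by linarith) hRQ
  have hθ₂0 : 0 < θ₂ := div_pos (by linarith) hRQ
  have hθ₁1 : θ₁ ≤ 1 := (div_le_one hRQ).2 (by linarith)
  have hθ₂1 : θ₂ ≤ 1 := (div_le_one hRQ).2 (by linarith)
  have hμθ₁ : μ * θ₁ = κ * (R - x₁) := by rw [hμ, hθ₁]; field_simp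
  have hμθ₂ : μ * θ₂ = κ * (R - x₂) := by rw [hμ, hθ₂]; field_simp
  have hx₁ : s₁.toReal⁻¹ = (b + 1) * ((1 - θ₁) * R + θ₁ * Q) := by
    have : θ₁ * (R - Q) = R - x₁ := by rw [hθ₁]; field_simp
    rw [hs₁i]; congr 1; linarith
  have hx₂ : s₂.toReal⁻¹ = (b + 1) * ((1 - θ₂) * R + θ₂ * Q) := by
    have : θ₂ * (R - Q) = R - x₂ := by rw [hθ₂]; field_simp
    rw [hs₂i]; congr 1; linarith
  set ω := (2 * α - 1 - n * b / r.toReal) / (2 * α) with hω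
  have hω' : ω = 1 - 1 / (2 * α) - κ * b * R := by
    rw [hω, hκ, hR]; field_simp
  have hω0 : 0 ≤ ω := div_nonneg (by rw [div_eq_mul_inv, ← hR]; linarith) (by linarith)
  have hθ₂b : 1 < θ₂ * (b + 1) := by
    rw [hθ₂, div_mul_eq_mul_div, one_lt_div hRQ]; exact hx2θ
  set γ₁ := 1 / (2 * α) + κ * (s₁.toReal⁻¹ - R) with hγ₁
  set γ₂ := 1 / (2 * α) + κ * (s₂.toReal⁻¹ - Q) with hγ₂
  -- The auxiliary exponent cancels in the sum of the two singularities, leaving `1/(2α) +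
  -- nbR/(2α)`; hence `ω` is the same for both estimates.
  have hsc₁ : 1 - γ₁ - μ * θ₁ * (b + 1) = ω := by
    rw [hγ₁, hμθ₁, hs₁i, hω']; ring
  have hsc₂ : 1 - γ₂ - μ * θ₂ * (b + 1) + μ = ω := by
    rw [hγ₂, hμθ₂, hs₂i, hω', hμ]; ring
  have hSadd : ∀ s t : ℝ, 0 < s → 0 < t →
      ∀ x : Lp 𝕜 r (volume : Measure (EuclideanSpace ℝ (Fin n))),
      convLp (kernelOf (fracSymbol (2 * α) (s + t))) r r x =
        convLp (kernelOf (fracSymbol (2 * α) s)) r r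
          (convLp (kernelOf (fracSymbol (2 * α) t)) r r x) := fun s t hs ht x =>
    (hK s hs).convLp_convLp (hK t ht) (hK _ (add_pos hs ht)) (kernelOf_fracSymbol_add hβ hs ht)
      le_rfl le_rfl hr' x
  have hDadd : ∀ (s e : ℝ≥0∞) [Fact (1 ≤ s)] [Fact (1 ≤ e)], s ≤ e → e ≠ ∞ →
      ∀ s' t : ℝ, 0 < s' → 0 < t →
      ∀ x : Lp 𝕜 s (volume : Measure (EuclideanSpace ℝ (Fin n))),
      convLp (kernelOf (gradSymbol (2 * α) (s' + t) a)) s e x =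
        convLp (kernelOf (fracSymbol (2 * α) s')) e e
          (convLp (kernelOf (gradSymbol (2 * α) t a)) s e x) := fun s e _ _ hse he s' t hs ht x =>
    (hK s' hs).convLp_convLp (hG t ht) (hG _ (add_pos hs ht)) (kernelOf_gradSymbol_add hβ hs ht a)
      hse le_rfl he x
  have hSbd : ∀ (e : ℝ≥0∞) [Fact (1 ≤ e)], e ≠ ∞ → ∀ t : ℝ, 0 < t →
      ∀ x : Lp 𝕜 e (volume : Measure (EuclideanSpace ℝ (Fin n))),
      ‖convLp (𝕜 := 𝕜) (kernelOf (fracSymbol (2 * α) t)) e e x‖ ≤ A₀ * ‖x‖ :=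
    fun e _ he t ht x => by simpa using hA e e le_rfl he t ht x
  have hA₀0 : 0 ≤ A₀ := by linarith
  have hcont : ∀ (s e : ℝ≥0∞) [Fact (1 ≤ s)] [Fact (1 ≤ e)], 1 < e → e ≠ ∞ →
      ∀ D : ℝ → Lp 𝕜 s (volume : Measure (EuclideanSpace ℝ (Fin n))) →L[ℝ]
        Lp 𝕜 e (volume : Measure (EuclideanSpace ℝ (Fin n))),
      (∀ s t, 0 < s → 0 < t → ∀ x, D (s + t) x =
        convLp (kernelOf (fracSymbol (2 * α) s)) e e (D t x)) →
      ∀ x, ContinuousOn (fun t => D t x) (Ioi 0) := fun s e _ _ he1 he D hD x =>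
    continuousOn_of_semigroup_action hA₀0 (hSbd e he) (tendsto_convLp_fracSymbol hβ he1 he) hD x
  have hr1' : 1 < r := hadm.one_lt
  have hp1' : 1 < p := hr1'.trans hrp
  have hN₁coe := fun (w : Lp 𝕜 r (volume : Measure (EuclideanSpace ℝ (Fin n))) × Lp 𝕜 p volume)
    hw => coeFn_superposition hσ1 hb hr' hp' hs₁' hθ₁0 hθ₁1 hx₁ (w := w) hw
  have hN₂coe := fun (w : Lp 𝕜 r (volume : Measure (EuclideanSpace ℝ (Fin n))) × Lp 𝕜 p volume)
    hw => coeFn_superposition hσ1 hb hr' hp' hs₂' hθ₂0 hθ₂1 hx₂ (w := w) hw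
  let A : MildSystem (Lp 𝕜 r (volume : Measure (EuclideanSpace ℝ (Fin n))))
        (Lp 𝕜 p (volume : Measure (EuclideanSpace ℝ (Fin n))))
        (Lp 𝕜 s₁ (volume : Measure (EuclideanSpace ℝ (Fin n))))
        (Lp 𝕜 s₂ (volume : Measure (EuclideanSpace ℝ (Fin n)))) :=
    { W := coincidenceSubmodule 𝕜 volume r p
      S := fun t => convLp (kernelOf (fracSymbol (2 * α) t)) r r
      SP := fun t => convLp (kernelOf (fracSymbol (2 * α) t)) r p
      D₁ := fun t => convLp (kernelOf (gradSymbol (2 * α) t a)) s₁ r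
      D₂ := fun t => convLp (kernelOf (gradSymbol (2 * α) t a)) s₂ p
      N₁ := superposition s₁ σ b
      N₂ := superposition s₂ σ b
      b := b, μ := μ, θ₁ := θ₁, θ₂ := θ₂, γ₁ := γ₁, γ₂ := γ₂, ω := ω, C := A₀
      c₁ := b + 2, c₂ := b + 2, C₁ := B₀, C₂ := B₀
      isClosed_W := isClosed_coincidenceSubmodule
      eq_zero_of_mem := fun y hy =>
        Lp.ext ((mem_coincidenceSubmodule.1 hy).symm.trans
          ((Lp.coeFn_zero _ _ _).trans (Lp.coeFn_zero _ _ _).symm))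
      μ_pos := hμ0
      γ₁_lt := by
        have : 0 < μ * θ₁ * (b + 1) := by positivity
        linarith
      -- By the second scaling relation and `ω ≥ 0`, `γ₂` is at most `1 - μ (θ₂ (b + 1) - 1)`.
      γ₂_lt := by
        have : μ * 1 < μ * (θ₂ * (b + 1)) := by gcongr
        linarith
      β₁_lt := by
        rw [hμθ₁, mul_assoc, mul_comm (R - x₁)]
        refine lt_of_lt_of_eq ?_ hκn
        exact mul_lt_mul_of_pos_left hx1n hκ0
      β₂_lt := by
        rw [hμθ₂, mul_assoc, mul_comm (R - x₂)]
        refine lt_of_lt_of_eq ?_ hκn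
        exact mul_lt_mul_of_pos_left hx2n hκ0
      ω_nonneg := hω0
      scaling₁ := hsc₁
      scaling₂ := hsc₂
      lt_θ₂ := hθ₂b
      one_le_C := hA₀
      S_bound := hSbd r hr'
      S_cont := hcont r r hr1' hr' _ hSadd
      S_tendsto := tendsto_convLp_fracSymbol hβ hr1' hr'
      SP_smoothing := ⟨hA₀0, hcont r p hp1' hp' _ fun s t hs ht x =>
          (hK s hs).convLp_convLp (hK t ht) (hK _ (add_pos hs ht))
            (kernelOf_fracSymbol_add hβ hs ht) hrp.le le_rfl hp' x,
        fun t ht f => hA r p hrp.le hp' t ht f⟩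
      SP_tendsto := tendsto_rpow_mul_norm_convLp_fracSymbol hβ hrp.le hp' hμ0
        (by simp only [finrank_euclideanSpace, Fintype.card_fin]; exact hμ)
      D₁_smoothing := ⟨hB₀, hcont s₁ r hr1' hr' _ (hDadd s₁ r hs₁r hr'),
        fun t ht f => hB s₁ r hs₁r hr' t ht f⟩
      D₂_smoothing := ⟨hB₀, hcont s₂ p hp1' hp' _ (hDadd s₂ p hs₂p hp'),
        fun t ht f => hB s₂ p hs₂p hp' t ht f⟩
      N₁_power := isPowerLike_superposition hσ1 hb hr' hp' hs₁' hθ₁0 hθ₁1 hx₁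
      N₂_power := isPowerLike_superposition hσ1 hb hr' hp' hs₂' hθ₂0 hθ₂1 hx₂
      S_mem := fun t ht x => ((hK t ht).coeFn_convLp le_rfl hr' x).trans
        ((hK t ht).coeFn_convLp hrp.le hp' x).symm
      D_mem := fun t ht w hw => by
        refine ((hG t ht).coeFn_convLp hs₁r hr' _).trans
          (EventuallyEq.trans ?_ ((hG t ht).coeFn_convLp hs₂p hp' _).symm)
        rw [convKernel_congr_ae _ (hN₁coe w hw), convKernel_congr_ae _ (hN₂coe w hw)]
      S_add := hSadd
      D_add := hDadd s₁ r hs₁r hr' }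
  refine ⟨s₁, s₂, f₁, f₂, A, rfl, fun t ht φ => ?_, fun t ht w hw => ?_, ?_, rfl, rfl⟩
  · rw [fracSemigroup_eq_convKernel]
    exact (hK t ht).coeFn_convLp le_rfl hr' φ
  · rw [fracSemigroupDeriv_eq_convKernel hα ht, ← convKernel_congr_ae _ (hN₁coe w hw)]
    exact (hG t ht).coeFn_convLp hs₁r hr' _
  · change μ = _
    rw [hadm.inv_eq, one_div, one_div, ENNReal.toReal_ofReal (by positivity)]

variable {s₁ s₂ : ℝ≥0∞} [Fact (1 ≤ s₁)] [Fact (1 ≤ s₂)]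
  {A : MildSystem (Lp 𝕜 r (volume : Measure (EuclideanSpace ℝ (Fin n))))
    (Lp 𝕜 p (volume : Measure (EuclideanSpace ℝ (Fin n))))
    (Lp 𝕜 s₁ (volume : Measure (EuclideanSpace ℝ (Fin n))))
    (Lp 𝕜 s₂ (volume : Measure (EuclideanSpace ℝ (Fin n))))}
  {φ : Lp 𝕜 r (volume : Measure (EuclideanSpace ℝ (Fin n)))} {T : ℝ≥0∞}
  {u : ℝ → Lp 𝕜 r (volume : Measure (EuclideanSpace ℝ (Fin n)))}

namespace Realizes

theorem isYSolution_of_solves (hA : Realizes A α b σ a q) (h : A.Solves φ T u) :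
    IsYSolution α b σ a q p φ T u := by
  obtain ⟨v, hv⟩ := h
  obtain ⟨M, ε, hM, hε, hb⟩ := hv.bdd
  have hmem : ∀ t ∈ timeInterval T, 0 < t → t ∈ timeInterval T \ {0} := fun t ht ht0 =>
    ⟨ht, ht0.ne'⟩
  refine ⟨⟨hv.init, fun t ht ht0 => ⟨fun τ => A.D₁ (t - τ) (A.N₁ (u τ, v τ)), fun τ hτ => ?_,
    hv.toIsCurve.integrable₁ hb hM hε (hmem t ht ht0), ?_⟩⟩, ⟨hv.cont_u, max (2 * M) ‖u 0‖,
      fun t ht => ?_⟩, v, ⟨⟨hv.cont_v, 2 * ε, fun t ht => ?_⟩, ?_⟩, fun t ht ht0 => ?_⟩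
  · exact hA.D_coe _ (sub_pos.2 hτ.2) _
      (hv.mem_W τ (timeInterval_sdiff_Ioc_subset (hmem t ht ht0) ⟨hτ.1, hτ.2.le⟩))
  · rw [hv.eq t (hmem t ht ht0)]
    filter_upwards [Lp.coeFn_add (A.S t φ) (A.J₁ u v t), hA.S_coe t ht0 φ] with x h1 h2
    rw [h1, Pi.add_apply, h2]
    rfl
  · rcases eq_or_ne t 0 with rfl | h0
    · exact le_max_right _ _
    · exact (hb t ⟨ht, h0⟩).1.trans (le_max_left _ _)
  · rw [← hA.μ_eq]; exact (hb t ht).2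
  · rw [← hA.μ_eq]; exact hv.tendsto_v
  · have := hv.mem_W t (hmem t ht ht0)
    rw [hA.W_eq, mem_coincidenceSubmodule] at this
    exact this.symm

/-- The Bochner integrand `F` in the definition of a mild solution is determined on `(0, t)` as an
element of `L^r`, so its integral is the abstract Duhamel term. -/
theorem solves_of_isYSolution (hA : Realizes A α b σ a q) (h : IsYSolution α b σ a q p φ T u) :
    A.Solves φ T u := by
  obtain ⟨⟨hinit, heq⟩, ⟨hcu, M, hM⟩, v, ⟨⟨hcv, N, hN⟩, htv⟩, hvu⟩ := h
  have hW : ∀ t ∈ timeInterval T \ {0}, (u t, v t) ∈ A.W := fun t ht => by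
    rw [hA.W_eq, mem_coincidenceSubmodule]
    exact (hvu t ht.1 (timeInterval_sdiff_pos ht)).symm
  refine ⟨v, ⟨hcu, hcv, by rw [hA.μ_eq]; exact htv, hW⟩, hinit, ⟨max M 0, max N 0, le_max_right _ _,
    le_max_right _ _, fun t ht => ⟨?_, ?_⟩⟩, fun t ht => ?_⟩
  · have := hM t ht.1
    linarith [le_max_left M 0, le_max_right M 0]
  · have := hN t ht
    rw [hA.μ_eq]
    linarith [le_max_left N 0, le_max_right N 0]
  · have ht0 := timeInterval_sdiff_pos ht
    obtain ⟨F, hF, -, hu⟩ := heq t ht.1 ht0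
    have hFeq : ∀ τ ∈ Ioo 0 t, F τ = A.D₁ (t - τ) (A.N₁ (u τ, v τ)) := fun τ hτ =>
      Lp.ext ((hF τ hτ).trans (hA.D_coe _ (sub_pos.2 hτ.2) _
        (hW τ (timeInterval_sdiff_Ioc_subset ht ⟨hτ.1, hτ.2.le⟩))).symm)
    have hJ : ∫ τ in (0 : ℝ)..t, F τ = A.J₁ u v t := by
      rw [MildSystem.J₁, duhamel, intervalIntegral.integral_of_le ht0.le,
        intervalIntegral.integral_of_le ht0.le, integral_Ioc_eq_integral_Ioo,
        integral_Ioc_eq_integral_Ioo]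
      exact setIntegral_congr_fun measurableSet_Ioo hFeq
    refine Lp.ext ?_
    filter_upwards [hu, Lp.coeFn_add (A.S t φ) (A.J₁ u v t), hA.S_coe t ht0 φ] with x h1 h2 h3
    rw [h1, h2, Pi.add_apply, h3, hJ]

theorem isYSolution_iff (hA : Realizes A α b σ a q) :
    IsYSolution α b σ a q p φ T u ↔ A.Solves φ T u :=
  ⟨hA.solves_of_isYSolution, hA.isYSolution_of_solves⟩

theorem hasUniqueYSolution (hA : Realizes A α b σ a q) (h : ∃ u, A.Solves φ T u) :
    HasUniqueYSolution α b σ a q p φ T := by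
  obtain ⟨u, hu⟩ := h
  exact ⟨u, hA.isYSolution_iff.2 hu, fun v hv => (hA.isYSolution_iff.1 hv).unique hu⟩

end Realizes

end Equation

end

theorem theorem4p4 {𝕜 : Type*} [RCLike 𝕜] (n : ℕ) (α b σ : ℝ)
    (a : EuclideanSpace ℝ (Fin n)) (q p r : ℝ≥0∞) [Fact (1 ≤ p)] [Fact (1 ≤ r)]
    (hα : 1 / 2 < α) (hb : 0 < b) (hσ : σ = 1 ∨ σ = -1)
    (hr₁ : 1 < n * b / (2 * α - 1)) (hr : n * b / (2 * α - 1) ≤ r.toReal)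
    (hadm : IsGeneralizedAdmissible n α q p r) (hrp : r < p) (hbp : b + 1 ≤ p.toReal) :
    -- (i), subcritical case: the existence time depends only on the size of the data
    (n * b / (2 * α - 1) < r.toReal →
      ∀ M : ℝ, ∃ T : ℝ, 0 < T ∧
        ∀ φ : Lp 𝕜 r (volume : Measure (EuclideanSpace ℝ (Fin n))), ‖φ‖ ≤ M →
          HasUniqueYSolution α b σ a q p φ (ENNReal.ofReal T)) ∧
    -- (i), critical case: the existence time depends on the data
    (r.toReal = n * b / (2 * α - 1) →
      ∀ φ : Lp 𝕜 r (volume : Measure (EuclideanSpace ℝ (Fin n))), ∃ T : ℝ, 0 < T ∧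
        HasUniqueYSolution α b σ a q p φ (ENNReal.ofReal T)) ∧
    -- (ii) global solutions for small data in the critical case
    (r.toReal = n * b / (2 * α - 1) →
      ∃ δ : ℝ, 0 < δ ∧
        ∀ φ : Lp 𝕜 r (volume : Measure (EuclideanSpace ℝ (Fin n))), ‖φ‖ ≤ δ →
          HasUniqueYSolution α b σ a q p φ ∞) ∧
    -- (iii) lower bound at a finite maximal time in the subcritical case
    (n * b / (2 * α - 1) < r.toReal →
      ∃ C : ℝ, 0 < C ∧
        ∀ φ : Lp 𝕜 r (volume : Measure (EuclideanSpace ℝ (Fin n))),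
          (∃ Tmax u, IsMaximalYSolution α b σ a q p φ Tmax u) ∧
          ∀ (Tmax : ℝ) (u : ℝ → Lp 𝕜 r (volume : Measure (EuclideanSpace ℝ (Fin n)))),
            IsMaximalYSolution α b σ a q p φ (ENNReal.ofReal Tmax) u →
            ∀ s : ℝ, 0 ≤ s → s < Tmax →
              C / (Tmax - s) ^ (1 / b - 1 / (2 * b * α) - n / (2 * r.toReal * α)) ≤ ‖u s‖) := by
  obtain ⟨s₁, s₂, _, _, A, hA⟩ :=
    exists_realizes (𝕜 := 𝕜) (a := a) hα hb hσ hr₁ hr hadm hrp hbp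
  have hr0 : 0 < r.toReal := by linarith
  have hα1 : 0 < 2 * α - 1 := by linarith
  refine ⟨fun hlt M => ?_, fun _ φ => ?_, fun hcrit => ?_, fun _ => ?_⟩
  · obtain ⟨δ, hδ, h⟩ := A.exists_solves_of_mul_rpow_le
    have hω : 0 < A.ω := by
      rw [hA.ω_eq]
      rw [div_lt_iff₀ hα1] at hlt
      have : n * b / r.toReal < 2 * α - 1 := by rw [div_lt_iff₀ hr0]; linarith
      exact div_pos (by linarith) (by linarith)
    have hκ : 0 < A.ω / A.b := div_pos hω A.b_pos
    -- This solves `(|M| + 1) T^{ω/b} = δ`; positivity of `ω` is needed to invert the power, and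
    -- `|M| + 1` is positive for every `M`.
    refine ⟨(δ / (|M| + 1)) ^ (A.ω / A.b)⁻¹, by positivity, fun φ hφ => ?_⟩
    refine hA.hasUniqueYSolution (h φ _ (by positivity) ?_)
    rw [← Real.rpow_mul (by positivity), inv_mul_cancel₀ hκ.ne', Real.rpow_one]
    calc ‖φ‖ * (δ / (|M| + 1)) ≤ (|M| + 1) * (δ / (|M| + 1)) := by
          gcongr; linarith [le_abs_self M]
      _ = δ := by field_simp
  · obtain ⟨T, hT, h⟩ := A.exists_solves φ
    exact ⟨T, hT, hA.hasUniqueYSolution h⟩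
  -- At `r = r₁` one has `nb/r = 2α - 1`, hence `ω = 0`; the cancellation uses `nb ≠ 0`.
  · obtain ⟨δ, hδ, h⟩ := A.exists_solves_top (by
      rw [hA.ω_eq, hcrit]
      have : (n * b : ℝ) ≠ 0 := fun h0 => by
        rw [h0, zero_div] at hr₁; linarith
      rw [div_div_cancel₀ this, sub_self, zero_div])
    exact ⟨δ, hδ, fun φ hφ => hA.hasUniqueYSolution (h φ hφ)⟩
  · obtain ⟨C, hC, h⟩ := A.lower_bound_of_maximal
    refine ⟨C, hC, fun φ => ⟨?_, fun Tmax u hu s hs hsT => ?_⟩⟩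
    · obtain ⟨Tmax, u, hT, h1, h2⟩ := A.exists_maximal φ
      exact ⟨Tmax, u, hT, fun T hT0 hTT => hA.isYSolution_iff.2 (h1 T hT0 hTT),
        fun T v hTT hv _ => h2 T v hTT (hA.isYSolution_iff.1 hv)⟩
    -- The exponent in the lower bound is the exponent `ω/b` of the abstract existence time.
    · have hκ : A.ω / A.b = 1 / b - 1 / (2 * b * α) - n / (2 * r.toReal * α) := by
        rw [hA.ω_eq, hA.b_eq]
        field_simp
      rw [← hκ]
      exact h φ Tmax u (fun T hT0 hTT => hA.isYSolution_iff.1 (hu.2.1 T hT0 hTT))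
        (fun T u' hTT hu' => hu.2.2 T u' hTT (hA.isYSolution_iff.2 hu')) s hs hsT
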